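/- **Theorem 4.1.** Let $A=(a_{ij})_{i,j\in I}$ be an affine Cartan matrix, i.e. $I$ is finite and nonempty and $A$ is an indecomposable symmetrizable generalized Cartan matrix for which there is a vector $u$ with positive entries and $Au=0$. Let $a_i$ (resp. $a_i^\vee$) be the numerical labels of $A$ (resp. of $A^{T}$): the coprime positive integers with $\sum_j a_{ij}a_j=0$ for all $i$ (resp. $\sum_j a_{ji}a^\vee_j=0$ for all $i$). Put $d_i=a_i^\vee/a_i$. Let $q\in\mathbb C^\times$ be not a root of unity, fix $\hbar\in\mathbb C$ with $e^{\hbar}=q$, write $q^s=e^{s\hbar}$ for $s\in\mathbb Q$, and put $q_i=q^{d_i}$. Let $\mathcal A=\mathbb C[x_i^{\pm1},\,i\in I]$, let $\zeta_i$ be the algebra automorphism of $\mathcal A$ with $\zeta_i(x_j)=q_i^{-\delta_{ij}}x_j$, put $y_i=\prod_{j\in I}x_j^{a_{ji}}$, and for a unit $u$ of $\mathcal A$ put $\{u\}_i=\dfrac{u-u^{-1}}{q_i-q_i^{-1}}$. Consider the system, for $(\phi_i)_{i\in I}\in\mathcal A^I$, $$\zeta_i(\phi_i)-\phi_i=\{y_i\}_i\quad(i\in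 I),\qquad \phi_i\phi_j=\zeta_j^{-1}(\phi_i)\,\zeta_i^{-1}(\phi_j)\quad(i,j\in I,\ i\ne j).\tag{4.1}$$ The system (4.1) has a solution if and only if, for some $n$ and some numbering of $I$ by $0,1,\dots,n$, the matrix $A$ is one of the following; here $a_{ii}=2$, all off-diagonal entries not mentioned are $-1$ if $|i-j|=1$ and $0$ otherwise. * $A_n^{(1)}$ ($n\ge1$): for $n=1$, $a_{01}=a_{10}=-2$; for $n\ge2$, $a_{0n}=a_{n0}=-1$. * $C_n^{(1)}$ ($n\ge2$): $a_{10}=a_{n-1,n}=-2$. * $A_{2n}^{(2)}$ ($n\ge1$): for $n=1$, $a_{01}=-1$, $a_{10}=-4$; for $n\ge2$, $a_{10}=a_{n,n-1}=-2$. * $D_{n+1}^{(2)}$ ($n\ge2$): $a_{01}=a_{n,n-1}=-2$. Moreover, for every such numbering, all solutions of (4.1) are the following, with $\imath=\sqrt{-1}$. * $A_n^{(1)}$: $\phi_i=\{qbz_i\}_i\{bz_{i+1}\}_i$ for $0\le i\le n$ (with $z_{n+1}=z_0$), with $b\in\mathbb C^\times$ arbitrary, where $z_i=x_{i-1}^{-1}x_i$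 for $1\le i\le n$ and $z_0=(z_1\cdots z_n)^{-1}$. * $C_n^{(1)}$: $\phi_0=\{q_0bz_1^{-1}\}_0\{bz_1\}_0$, $\phi_i=\{q_ibz_i\}_i\{bz_{i+1}\}_i$ for $0<i<n$, $\phi_n=\{q_nbz_n\}_n\{bz_n^{-1}\}_n$, with $b=q^{-1/4}$ or $b=\imath q^{-1/4}$, where $z_i=x_{i-1}^{-1}x_i$. * $A_{2n}^{(2)}$: $\phi_0=\{\imath q^{-3/2}z_1\}_0\{\imath q^{-1/2}z_1\}_0$, $\phi_i=\{\imath q^{1/2}z_i\}_i\{\imath q^{-1/2}z_{i+1}\}_i$ for $0<i<n$, $\phi_n=\frac{\imath}{q_n-q_n^{-1}}\{\imath q^{1/2}z_n\}_n$, where $z_i=x_{i-1}^{-1}x_i$ for $1\le i<n$ and $z_n=x_{n-1}^{-1}x_n^2$. * $D_{n+1}^{(2)}$: $\phi_0=\frac{\imath}{q_0-q_0^{-1}}\{\imath q^{-1}z_1\}_0$, $\phi_i=\{\imath qz_i\}_i\{\imath q^{-1}z_{i+1}\}_i$ for $0<i<n$, $\phi_n=\frac{\imath}{q_n-q_n^{-1}}\{\imath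 qz_n\}_n$, where $z_1=x_0^{-2}x_1$, $z_i=x_{i-1}^{-1}x_i$ for $1<i<n$ and $z_n=x_{n-1}^{-1}x_n^2$. -/

import Mathlib

open scoped Matrix

noncomputable section

namespace QShift

/-! ### Affine Cartan matrices -/

/-- Generalized Cartan matrices. -/
structure IsGCM {I : Type*} (A : Matrix I I ℤ) : Prop where
  diag : ∀ i, A i i = 2
  offDiag : ∀ i j, i ≠ j → A i j ≤ 0
  zero : ∀ i j, A i j = 0 → A j i = 0

/-- `A` is symmetrizable: `D * A` is symmetric for a positive diagonal matrix `D`. -/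
def IsSymmetrizable {I : Type*} (A : Matrix I I ℤ) : Prop :=
  ∃ d : I → ℚ, (∀ i, 0 < d i) ∧ ∀ i j, d i * A i j = d j * A j i

/-- `A` is indecomposable: its Dynkin diagram is connected. -/
def IsIndecomposable {I : Type*} (A : Matrix I I ℤ) : Prop :=
  ∀ S : Set I, S.Nonempty → Sᶜ.Nonempty → ∃ i ∈ S, ∃ j ∈ Sᶜ, A i j ≠ 0

/-- Affine Cartan matrices: (symmetrizable) indecomposable generalized Cartan matrices with a
strictly positive vector `u` such that `A u = 0`. -/
structure IsAffineCartan {I : Type*} [Fintype I] (A : Matrix I I ℤ) : Prop where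
  nonempty : Nonempty I
  gcm : IsGCM A
  symmetrizable : IsSymmetrizable A
  indecomposable : IsIndecomposable A
  null : ∃ u : I → ℝ, (∀ i, 0 < u i) ∧ A.map (Int.cast : ℤ → ℝ) *ᵥ u = 0

/-- `a` is the family of numerical labels of the Dynkin diagram of an affine Cartan matrix `A`:
the coprime positive integers with `∑ j, a_{ij} a_j = 0` for all `i`. The labels `a_i^∨` of the
dual diagram are the numerical labels of `Aᵀ`. -/
structure IsLabels {I : Type*} [Fintype I] (A : Matrix I I ℤ) (a : I → ℕ) : Prop where
  pos : ∀ i, 0 < a i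
  coprime : Finset.univ.gcd a = 1
  null : ∀ i, ∑ j, A i j * (a j : ℤ) = 0

/-! ### The Laurent polynomial ring and the shift operators -/

/-- The Laurent polynomial ring `ℂ[x_i^{±1}, i ∈ I]` (for finite `I`), as the group algebra of
the free abelian group `ℤ^I` of exponent vectors. -/
abbrev Laurent (I : Type*) : Type _ := AddMonoidAlgebra ℂ (I → ℤ)

section ring

variable {I : Type*}

/-- The monomial `∏ j, x_j ^ (v j)`, as a unit of the Laurent polynomial ring. -/
def mono (v : I → ℤ) : (Laurent I)ˣ where
  val := AddMonoidAlgebra.single v 1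
  inv := AddMonoidAlgebra.single (-v) 1
  val_inv := by simp [AddMonoidAlgebra.single_mul_single, AddMonoidAlgebra.one_def]
  inv_val := by simp [AddMonoidAlgebra.single_mul_single, AddMonoidAlgebra.one_def]

/-- The variable `x_i`. -/
def x [DecidableEq I] (i : I) : (Laurent I)ˣ := mono (Pi.single i 1)

/-- A nonzero scalar, as a unit of the Laurent polynomial ring. -/
def scal (c : ℂˣ) : (Laurent I)ˣ := Units.map (algebraMap ℂ (Laurent I)).toMonoidHom c

/-- The algebra endomorphism `x_i ↦ c x_i`, `x_j ↦ x_j` for `j ≠ i`. -/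
def scaleHom (i : I) (c : ℂˣ) : Laurent I →ₐ[ℂ] Laurent I :=
  AddMonoidAlgebra.lift ℂ (Laurent I) (I → ℤ)
    { toFun := fun v => AddMonoidAlgebra.single v.toAdd ((c ^ (v.toAdd i) : ℂˣ) : ℂ)
      map_one' := by simp [AddMonoidAlgebra.one_def]
      map_mul' := fun v w => by
        simp [AddMonoidAlgebra.single_mul_single, zpow_add] }

theorem scaleHom_single (i : I) (c : ℂˣ) (v : I → ℤ) (r : ℂ) :
    scaleHom i c (AddMonoidAlgebra.single v r) =
      AddMonoidAlgebra.single v (r * ((c ^ (v i) : ℂˣ) : ℂ)) := by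
  simp [scaleHom, AddMonoidAlgebra.lift_single, AddMonoidAlgebra.smul_single]

theorem scaleHom_comp_inv (i : I) (c : ℂˣ) :
    (scaleHom i c).comp (scaleHom i c⁻¹) = AlgHom.id ℂ (Laurent I) := by
  apply AddMonoidAlgebra.algHom_ext
  · intro v
    simp only [AlgHom.comp_apply, scaleHom_single, AlgHom.id_apply]
    congr 1
    rw [one_mul, ← Units.val_mul, ← mul_zpow, inv_mul_cancel, one_zpow, Units.val_one]
  · ext

/-- The algebra automorphism `x_i ↦ c x_i`, `x_j ↦ x_j` for `j ≠ i`. -/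
def scaleEquiv (i : I) (c : ℂˣ) : Laurent I ≃ₐ[ℂ] Laurent I :=
  AlgEquiv.ofAlgHom (scaleHom i c) (scaleHom i c⁻¹) (scaleHom_comp_inv i c)
    (by simpa using scaleHom_comp_inv i c⁻¹)

/-- The shift operator `ζ_i`, the algebra automorphism with `ζ_i(x_j) = q_i^{-δ_{ij}} x_j`,
where `Q i` is `q_i`. -/
def zeta (Q : I → ℂˣ) (i : I) : Laurent I ≃ₐ[ℂ] Laurent I := scaleEquiv i (Q i)⁻¹

theorem zeta_x [DecidableEq I] (Q : I → ℂˣ) (i j : I) :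
    zeta Q i (x j : Laurent I) = ((Q i : ℂ) ^ (if i = j then (-1 : ℤ) else 0)) • (x j : Laurent I) := by
  have h : zeta Q i (x j : Laurent I) = scaleHom i (Q i)⁻¹ (x j : Laurent I) := rfl
  rw [h]
  by_cases hij : i = j
  · subst hij
    simp [x, mono, scaleHom_single, AddMonoidAlgebra.smul_single]
  · simp [x, mono, scaleHom_single, hij]

/-- `{u}_c = (u - u⁻¹) / (c - c⁻¹)` for a unit `u`; thus `{u}_i` is `brace (Q i) u`. -/
def brace (c : ℂˣ) (u : (Laurent I)ˣ) : Laurent I :=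
  ((c : ℂ) - (c : ℂ)⁻¹)⁻¹ • ((u : Laurent I) - ((u⁻¹ : (Laurent I)ˣ) : Laurent I))

/-- `(f, g)` is `(i, j)`-shiftable: `f g = ζ_j⁻¹(f) ζ_i⁻¹(g)`. -/
def Shiftable (Q : I → ℂˣ) (i j : I) (f g : Laurent I) : Prop :=
  f * g = (zeta Q j).symm f * (zeta Q i).symm g

/-- `y_i = ∏ j, x_j ^ a_{ji}`. -/
def y [Fintype I] [DecidableEq I] (A : Matrix I I ℤ) (i : I) : (Laurent I)ˣ :=
  ∏ j, x j ^ A j i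

/-- The system of equations `ζ_i(φ_i) - φ_i = {y_i}_i`, and `(φ_i, φ_j)` is `(i, j)`-shiftable,
for all `i ≠ j` in `I`. -/
def IsSolution [Fintype I] [DecidableEq I] (A : Matrix I I ℤ) (Q : I → ℂˣ) (φ : I → Laurent I) :
    Prop :=
  (∀ i, zeta Q i (φ i) - φ i = brace (Q i) (y A i)) ∧
    ∀ i j, i ≠ j → Shiftable Q i j (φ i) (φ j)

end ring

/-! ### Powers of `q` -/

/-- The power `q^s` for rational `s`, where `q = e^ħ`. Fixing the logarithm `ħ` of `q` fixes the
roots of `q` in a compatible way. -/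
def qpow (ħ : ℂ) (s : ℚ) : ℂˣ := Units.mk0 (Complex.exp ((s : ℂ) * ħ)) (Complex.exp_ne_zero _)

/-- `q_i = q^{d_i}` with `d_i = a_i^∨ / a_i`; here `a'` stands for the dual labels `a^∨`. -/
def qi {I : Type*} (ħ : ℂ) (a a' : I → ℕ) (i : I) : ℂˣ := qpow ħ ((a' i : ℚ) / (a i : ℚ))

/-- The imaginary unit, as a unit of `ℂ`. -/
def im : ℂˣ := Units.mk0 Complex.I Complex.I_ne_zero

/-! ### The four families of affine Cartan matrices, with nodes `0, …, n` -/

/-- Cartan matrix of type `A_n^{(1)}` for `n ≥ 1`; the indices are added cyclically, and for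
`n = 1` the two neighbours of a node coincide, so that the off-diagonal entries are `-2`. -/
def cartanA (n : ℕ) : Matrix (Fin (n + 1)) (Fin (n + 1)) ℤ := Matrix.of fun i j =>
  (if i = j then 2 else 0) - (if j = i + 1 then 1 else 0) - (if i = j + 1 then 1 else 0)

/-- The tridiagonal matrix with diagonal entries `2` and with `a_{k,k+1} = u k`,
`a_{k+1,k} = l k`. -/
def tridiag (n : ℕ) (u l : ℕ → ℤ) : Matrix (Fin (n + 1)) (Fin (n + 1)) ℤ := Matrix.of fun i j =>
  if i = j then 2
  else if j.val = i.val + 1 then u i.val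
  else if i.val = j.val + 1 then l j.val
  else 0

/-- Cartan matrix of type `C_n^{(1)}`, `0 ⇒ 1 - ⋯ - (n-1) ⇐ n`. -/
def cartanC (n : ℕ) : Matrix (Fin (n + 1)) (Fin (n + 1)) ℤ :=
  tridiag n (fun k => if k + 1 = n then -2 else -1) (fun k => if k = 0 then -2 else -1)

/-- Cartan matrix of type `A_{2n}^{(2)}`, `0 ⇒ 1 - ⋯ - (n-1) ⇒ n` (node `n` is the shortest root);
for `n = 1` it has `a_{01} = -1` and `a_{10} = -4`. -/
def cartanA2 (n : ℕ) : Matrix (Fin (n + 1)) (Fin (n + 1)) ℤ :=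
  tridiag n (fun _ => -1)
    (fun k => -((if k = 0 then 2 else 1) * (if k + 1 = n then 2 else 1)))

/-- Cartan matrix of type `D_{n+1}^{(2)}`, `0 ⇐ 1 - ⋯ - (n-1) ⇒ n`. -/
def cartanD2 (n : ℕ) : Matrix (Fin (n + 1)) (Fin (n + 1)) ℤ :=
  tridiag n (fun k => if k = 0 then -2 else -1) (fun k => if k + 1 = n then -2 else -1)

/-- `e` numbers the nodes `0, …, n` in such a way that `A` becomes the matrix `B`. -/
def IsNumbering {I : Type*} {n : ℕ} (A : Matrix I I ℤ) (B : Matrix (Fin (n + 1)) (Fin (n + 1)) ℤ)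
    (e : Fin (n + 1) ≃ I) : Prop :=
  ∀ i j, A (e i) (e j) = B i j

/-- `A` is the matrix `B` up to the numbering of the nodes. -/
def HasType {I : Type*} {n : ℕ} (A : Matrix I I ℤ) (B : Matrix (Fin (n + 1)) (Fin (n + 1)) ℤ) :
    Prop :=
  ∃ e : Fin (n + 1) ≃ I, IsNumbering A B e

/-! ### The explicit solutions

Here `Q` stands for the family `q_i`, and `e` for a numbering of the nodes by `0, …, n`. -/

section solutions

variable {I : Type*} [DecidableEq I] {n : ℕ}

/-- The variable attached to the node number `k` (for `k ≤ n`). -/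
def X (e : Fin (n + 1) ≃ I) (k : ℕ) : (Laurent I)ˣ := x (e (Fin.ofNat (n + 1) k))

/-- `z_i = x_{i-1}⁻¹ x_i` for `1 ≤ i ≤ n` and `z_0 = x_n⁻¹ x_0 = (z_1 ⋯ z_n)⁻¹`. -/
def zA (e : Fin (n + 1) ≃ I) (i : Fin (n + 1)) : (Laurent I)ˣ := (x (e (i - 1)))⁻¹ * x (e i)

/-- `z_k = x_{k-1}⁻¹ x_k` for `1 ≤ k ≤ n`. -/
def zC (e : Fin (n + 1) ≃ I) (k : ℕ) : (Laurent I)ˣ := (X e (k - 1))⁻¹ * X e k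

/-- `z_k = x_{k-1}⁻¹ x_k` for `1 ≤ k < n` and `z_n = x_{n-1}⁻¹ x_n²`. -/
def zA2 (e : Fin (n + 1) ≃ I) (k : ℕ) : (Laurent I)ˣ :=
  (X e (k - 1))⁻¹ * X e k ^ (if k = n then 2 else 1)

/-- `z_1 = x_0⁻² x_1`, `z_k = x_{k-1}⁻¹ x_k` for `1 < k < n`, and `z_n = x_{n-1}⁻¹ x_n²`. -/
def zD2 (e : Fin (n + 1) ≃ I) (k : ℕ) : (Laurent I)ˣ :=
  (X e (k - 1) ^ (if k = 1 then 2 else 1))⁻¹ * X e k ^ (if k = n then 2 else 1)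

/-- `φ_i = {q b z_i} {b z_{i+1}}` for all `i` (cyclically), where `q = q_i`. -/
def solA (Q : I → ℂˣ) (e : Fin (n + 1) ≃ I) (b : ℂˣ) (i : Fin (n + 1)) : Laurent I :=
  brace (Q (e i)) (scal (Q (e i) * b) * zA e i) * brace (Q (e i)) (scal b * zA e (i + 1))

/-- `φ_0 = {q_0 b z_1⁻¹}_0 {b z_1}_0`, `φ_i = {q_i b z_i}_i {b z_{i+1}}_i` for `0 < i < n`, and
`φ_n = {q_n b z_n}_n {b z_n⁻¹}_n`. -/
def solC (Q : I → ℂˣ) (e : Fin (n + 1) ≃ I) (b : ℂˣ) (i : Fin (n + 1)) : Laurent I :=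
  let c := Q (e i)
  if i.val = 0 then brace c (scal (c * b) * (zC e 1)⁻¹) * brace c (scal b * zC e 1)
  else if i.val = n then brace c (scal (c * b) * zC e n) * brace c (scal b * (zC e n)⁻¹)
  else brace c (scal (c * b) * zC e i.val) * brace c (scal b * zC e (i.val + 1))

/-- `φ_0 = {ι q^{-3/2} z_1}_0 {ι q^{-1/2} z_1}_0`,
`φ_i = {ι q^{1/2} z_i}_i {ι q^{-1/2} z_{i+1}}_i` for `0 < i < n`, and
`φ_n = ι (q_n - q_n⁻¹)⁻¹ {ι q^{1/2} z_n}_n`, where `ι² = -1` and `q = e^ħ`. -/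
def solA2 (ħ : ℂ) (Q : I → ℂˣ) (e : Fin (n + 1) ≃ I) (i : Fin (n + 1)) : Laurent I :=
  let c := Q (e i)
  if i.val = 0 then
    brace c (scal (im * qpow ħ (-3 / 2)) * zA2 e 1) * brace c (scal (im * qpow ħ (-1 / 2)) * zA2 e 1)
  else if i.val = n then
    (Complex.I / ((c : ℂ) - (c : ℂ)⁻¹)) • brace c (scal (im * qpow ħ (1 / 2)) * zA2 e n)
  else
    brace c (scal (im * qpow ħ (1 / 2)) * zA2 e i.val) *
      brace c (scal (im * qpow ħ (-1 / 2)) * zA2 e (i.val + 1))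

/-- `φ_0 = ι (q_0 - q_0⁻¹)⁻¹ {ι q⁻¹ z_1}_0`, `φ_i = {ι q z_i}_i {ι q⁻¹ z_{i+1}}_i` for `0 < i < n`,
and `φ_n = ι (q_n - q_n⁻¹)⁻¹ {ι q z_n}_n`, where `ι² = -1` and `q = e^ħ`. -/
def solD2 (ħ : ℂ) (Q : I → ℂˣ) (e : Fin (n + 1) ≃ I) (i : Fin (n + 1)) : Laurent I :=
  let c := Q (e i)
  if i.val = 0 then
    (Complex.I / ((c : ℂ) - (c : ℂ)⁻¹)) • brace c (scal (im * qpow ħ (-1)) * zD2 e 1)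
  else if i.val = n then
    (Complex.I / ((c : ℂ) - (c : ℂ)⁻¹)) • brace c (scal (im * qpow ħ 1) * zD2 e n)
  else
    brace c (scal (im * qpow ħ 1) * zD2 e i.val) *
      brace c (scal (im * qpow ħ (-1)) * zD2 e (i.val + 1))

end solutions

end QShift

end

/-!
Rescale the unknowns to `f_i = -(q_i - q_i⁻¹)² φ_i`. The first equation then says that `f_i` is
`q_i y_i + q_i⁻¹ y_i⁻¹` up to terms of degree `0` in `x_i`, and the top and bottom components in
`x_i` of the shift equation for `(f_i, f_j)` bound the `x_i`-degrees of the terms of `f_j` by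
`-a_{ij}`. If `a_{ij} = -1`, then `f_j` has only terms of degree `±1` in `x_i`, and the components
of degree `±1` of the shift equation combine to say that a product of two Laurent polynomials,
formed from the part of `f_i` of degree `0` in `x_i`, is a nonzero constant. Both factors are
therefore monomials up to scalars, so that `f_i = q_i y_i + q_i⁻¹ y_i⁻¹ + q_i⁻¹ w + q_i w⁻¹` for a
monomial `w = c x^v`, which also determines `f_j`.

Comparing such expansions shows that an edge with `a_{ij} = -1` has `a_{ji} = -1`, or `a_{ji} = -2`
and one of its ends is a leaf, or `a_{ji} = -4`, and that there are no branch nodes. With the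
positive null vector this leaves the cycles with simple edges, the paths with simple interior edges
and double edges at both ends, and the matrices with two nodes and `a_{ij} a_{ji} = 4`. In these
diagrams the monomial `w` propagates from node to node with the same constant `c`, which is free on
a cycle and is restricted by the ends of a path.
-/

noncomputable section

namespace QShift

/-! ### Laurent polynomials graded by the degree in one variable -/

section laurent

open AddMonoidAlgebra

theorem exists_eq_single_of_mul_eq_single {R M : Type*} [Semiring R] [NoZeroDivisors R] [Add M]
    [TwoUniqueSums M] {f g : AddMonoidAlgebra R M} {m : M} {r : R} (hr : r ≠ 0)
    (h : f * g = single m r) : ∃ m' r', r' ≠ 0 ∧ f = single m' r' := by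
  have hfg : single m r ≠ (0 : AddMonoidAlgebra R M) := by simpa using hr
  have hf : f.coeff.support.Nonempty := by
    rw [Finsupp.support_nonempty_iff, Ne, coeff_eq_zero]
    rintro rfl
    exact hfg (by rw [← h, zero_mul])
  have hg : g.coeff.support.Nonempty := by
    rw [Finsupp.support_nonempty_iff, Ne, coeff_eq_zero]
    rintro rfl
    exact hfg (by rw [← h, mul_zero])
  have hunique : ∀ p ∈ f.coeff.support ×ˢ g.coeff.support,
      UniqueAdd f.coeff.support g.coeff.support p.1 p.2 → p.1 + p.2 = m := by
    intro p hp hu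
    by_contra hne
    have hcoeff := coeff_mul_add_of_uniqueAdd hu
    rw [h, coeff_single, Finsupp.single_eq_of_ne hne] at hcoeff
    simp only [Finset.mem_product, Finsupp.mem_support_iff] at hp
    exact mul_ne_zero hp.1 hp.2 hcoeff.symm
  have hcard : f.coeff.support.card * g.coeff.support.card ≤ 1 := by
    by_contra! hlt
    obtain ⟨p, hp, p', hp', hne, hu, hu'⟩ := TwoUniqueSums.uniqueAdd_of_one_lt_card hlt
    have heq := (hunique p' hp' hu').trans (hunique p hp hu).symm
    rw [Finset.mem_product] at hp'
    obtain ⟨h1, h2⟩ := hu hp'.1 hp'.2 heq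
    exact hne (Prod.ext h1 h2).symm
  have hf1 : f.coeff.support.card = 1 := by
    have := hf.card_pos
    have := hg.card_pos
    nlinarith
  obtain ⟨m', r', hr', hf'⟩ := Finsupp.card_support_eq_one'.1 hf1
  exact ⟨m', r', hr', coeff_injective (by rw [hf', coeff_single])⟩

variable {I : Type*}

theorem coeff_single_mul (v w : I → ℤ) (r : ℂ) (f : Laurent I) :
    (single v r * f).coeff w = r * f.coeff (w - v) := by
  apply coeff_single_mul_eq_mul_coeff
  intro m _
  rw [eq_sub_iff_add_eq, add_comm]

theorem coeff_mul_one_add_single (v w : I → ℤ) (r : ℂ) (f : Laurent I) :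
    (f * (1 + single v r)).coeff w = f.coeff w + r * f.coeff (w - v) := by
  rw [mul_add, mul_one, mul_comm f, coeff_add, Finsupp.add_apply, coeff_single_mul]

theorem coeff_scaleHom (i : I) (c : ℂˣ) (f : Laurent I) (v : I → ℤ) :
    (scaleHom i c f).coeff v = (c : ℂ) ^ v i * f.coeff v := by
  classical
  induction f using AddMonoidAlgebra.induction_linear with
  | zero => simp
  | add f g hf hg => simp [hf, hg, mul_add]
  | single m r =>
    rw [scaleHom_single, coeff_single, coeff_single]
    rcases eq_or_ne m v with rfl | h
    · simp [mul_comm]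
    · simp [Finsupp.single_eq_of_ne' h]

theorem coeff_zeta (Q : I → ℂˣ) (i : I) (f : Laurent I) (v : I → ℤ) :
    (zeta Q i f).coeff v = ((Q i : ℂ) ^ v i)⁻¹ * f.coeff v := by
  change (scaleHom i (Q i)⁻¹ f).coeff v = _
  simp [coeff_scaleHom]

theorem coeff_zeta_symm (Q : I → ℂˣ) (i : I) (f : Laurent I) (v : I → ℤ) :
    ((zeta Q i).symm f).coeff v = (Q i : ℂ) ^ v i * f.coeff v := by
  change (scaleHom i (Q i)⁻¹⁻¹ f).coeff v = _
  simp [coeff_scaleHom]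

theorem zeta_symm_single (Q : I → ℂˣ) (i : I) (v : I → ℤ) (r : ℂ) :
    (zeta Q i).symm (single v r) = single v ((Q i : ℂ) ^ v i * r) := by
  change scaleHom i (Q i)⁻¹⁻¹ (single v r) = _
  simp [scaleHom_single, mul_comm]

/-- The grading of the Laurent polynomial ring by the degree in `x_i`. -/
abbrev xGrading (i : I) : ℤ → Submodule ℂ (Laurent I) :=
  gradeBy ℂ (Pi.evalAddMonoidHom (fun _ => ℤ) i)

/-- The component of degree `n` in `x_i` of a Laurent polynomial. -/
def xComponent (i : I) (n : ℤ) : Laurent I →+ Laurent I := GradedRing.proj (xGrading i) n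

theorem mem_xGrading {i : I} {n : ℤ} {f : Laurent I} :
    f ∈ xGrading i n ↔ ∀ v, f.coeff v ≠ 0 → v i = n := by
  simp only [← Finsupp.mem_support_iff]
  rfl

theorem single_mem_xGrading {i : I} {n : ℤ} {v : I → ℤ} (hv : v i = n) (r : ℂ) :
    single v r ∈ xGrading i n :=
  hv ▸ single_mem_gradeBy (Pi.evalAddMonoidHom (fun _ => ℤ) i) v r

theorem xComponent_mem (i : I) (n : ℤ) (f : Laurent I) : xComponent i n f ∈ xGrading i n :=
  SetLike.coe_mem _

theorem coeff_xComponent (i : I) (n : ℤ) (f : Laurent I) (v : I → ℤ) :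
    (xComponent i n f).coeff v = if v i = n then f.coeff v else 0 := by
  split_ifs with hv
  · induction f using AddMonoidAlgebra.induction_linear with
    | zero => simp
    | add f g hf hg => simp [hf, hg]
    | single w r =>
      rw [xComponent, GradedRing.proj_apply]
      by_cases hw : w i = n
      · rw [DirectSum.decompose_of_mem_same _ (single_mem_xGrading hw r)]
      · rw [DirectSum.decompose_of_mem_ne _ (single_mem_xGrading rfl r) hw, coeff_single,
          Finsupp.single_eq_of_ne (by rintro rfl; exact hw hv)]
        rfl
  · by_contra h
    exact hv (mem_xGrading.1 (xComponent_mem i n f) v h)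

theorem xComponent_mul_of_left_mem {i : I} {m : ℤ} {g : Laurent I} (hg : g ∈ xGrading i m) (n : ℤ)
    (f : Laurent I) : xComponent i n (g * f) = g * xComponent i (n - m) f := by
  obtain ⟨k, rfl⟩ : ∃ k, n = m + k := ⟨n - m, by ring⟩
  rw [add_sub_cancel_left]
  exact DirectSum.coe_decompose_mul_add_of_left_mem _ hg

theorem xComponent_eq_zero_iff {i : I} {n : ℤ} {f : Laurent I} :
    xComponent i n f = 0 ↔ ∀ v, f.coeff v ≠ 0 → v i ≠ n := by
  constructor
  · intro h v hv hn
    have := coeff_xComponent i n f v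
    rw [h, if_pos hn] at this
    exact hv this.symm
  · intro h
    ext v
    rw [coeff_xComponent, ite_eq_right_iff.2 fun hn => by_contra fun hv => h v hv hn]
    rfl

theorem zeta_symm_mem_xGrading {i : I} {n : ℤ} {f : Laurent I} (hf : f ∈ xGrading i n)
    (Q : I → ℂˣ) (j : I) : (zeta Q j).symm f ∈ xGrading i n := by
  refine mem_xGrading.2 fun v hv => mem_xGrading.1 hf v ?_
  rw [coeff_zeta_symm] at hv
  exact right_ne_zero_of_mul hv

theorem zeta_symm_eq_smul {i : I} {n : ℤ} {f : Laurent I} (hf : f ∈ xGrading i n) (Q : I → ℂˣ) :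
    (zeta Q i).symm f = (Q i : ℂ) ^ n • f := by
  ext v
  rw [coeff_zeta_symm, coeff_smul, Finsupp.smul_apply, smul_eq_mul]
  by_cases hv : f.coeff v = 0
  · rw [hv, mul_zero, mul_zero]
  · rw [mem_xGrading.1 hf v hv]

theorem xComponent_zeta_symm (Q : I → ℂˣ) (i : I) (n : ℤ) (f : Laurent I) :
    xComponent i n ((zeta Q i).symm f) = (Q i : ℂ) ^ n • xComponent i n f := by
  ext v
  simp only [coeff_xComponent, coeff_zeta_symm, coeff_smul, Finsupp.smul_apply, smul_eq_mul]
  split_ifs with h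
  · rw [h]
  · rw [mul_zero]

theorem shiftable_comm {Q : I → ℂˣ} {i j : I} {f g : Laurent I} :
    Shiftable Q i j f g ↔ Shiftable Q j i g f := by
  unfold Shiftable
  rw [mul_comm f g, mul_comm ((zeta Q j).symm f)]

theorem shiftable_smul_smul {Q : I → ℂˣ} {i j : I} {f g : Laurent I} {a b : ℂ} (ha : a ≠ 0)
    (hb : b ≠ 0) : Shiftable Q i j (a • f) (b • g) ↔ Shiftable Q i j f g := by
  unfold Shiftable
  rw [map_smul, map_smul, smul_mul_smul_comm, smul_mul_smul_comm]
  exact (smul_right_injective _ (mul_ne_zero ha hb)).eq_iff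

theorem shiftable_of_mem_xGrading_zero {Q : I → ℂˣ} {i j : I} {f g : Laurent I}
    (hf : f ∈ xGrading j 0) (hg : g ∈ xGrading i 0) : Shiftable Q i j f g := by
  unfold Shiftable
  rw [zeta_symm_eq_smul hf, zeta_symm_eq_smul hg, zpow_zero, zpow_zero, one_smul, one_smul]

end laurent

section degree

variable {I : Type*}

open AddMonoidAlgebra

/-- The Laurent polynomial `q_i y_i + q_i⁻¹ y_i⁻¹`; the exponent vector of `y_i` is the `i`-th
column of `A`. -/
def twoTerm (A : Matrix I I ℤ) (Q : I → ℂˣ) (i : I) : Laurent I :=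
  single (A.col i) (Q i : ℂ) + single (-A.col i) (Q i : ℂ)⁻¹

/-- The first equation of the system for the rescaled unknown `-(q_i - q_i⁻¹)² φ_i`: it is
`q_i y_i + q_i⁻¹ y_i⁻¹` up to terms of degree `0` in `x_i`. -/
def IsNormal (A : Matrix I I ℤ) (Q : I → ℂˣ) (i : I) (f : Laurent I) : Prop :=
  ∃ g ∈ xGrading i 0, f = twoTerm A Q i + g

/-- The family `Q i = q ^ d i` for a symmetrizer `d` of `A` and `q` not a root of unity. -/
structure IsQFamily (A : Matrix I I ℤ) (Q : I → ℂˣ) (d : I → ℚ) : Prop where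
  pos : ∀ i, 0 < d i
  symm : ∀ i j, d i * A i j = d j * A j i
  pow : ∀ i j (m n : ℤ), (Q i : ℂ) ^ m * (Q j : ℂ) ^ n = 1 ↔ d i * m + d j * n = 0

variable {A : Matrix I I ℤ} {Q : I → ℂˣ} {d : I → ℚ} {i j : I} {f g F : Laurent I} {n : ℤ}

theorem IsQFamily.zpow_eq_one (hQ : IsQFamily A Q d) (i : I) (n : ℤ) :
    (Q i : ℂ) ^ n = 1 ↔ n = 0 := by
  simpa [(hQ.pos i).ne'] using hQ.pow i i n 0

theorem IsQFamily.zpow_eq (hQ : IsQFamily A Q d) (i j : I) :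
    (Q j : ℂ) ^ A j i = (Q i : ℂ) ^ A i j := by
  have h := (hQ.pow j i (A j i) (-A i j)).2 (by push_cast; linarith [hQ.symm i j])
  rw [zpow_neg] at h
  exact eq_of_mul_inv_eq_one h

theorem IsQFamily.sub_inv_ne_zero (hQ : IsQFamily A Q d) (i : I) :
    (Q i : ℂ) - (Q i : ℂ)⁻¹ ≠ 0 := fun h => by
  refine (hQ.zpow_eq_one i 2).not.2 two_ne_zero ?_
  rw [zpow_two, ← mul_inv_cancel₀ (Q i).ne_zero, ← sub_eq_zero.1 h]

theorem IsGCM.single_col_mem (hA : IsGCM A) (i : I) (r : ℂ) :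
    single (A.col i) r ∈ xGrading i 2 :=
  single_mem_xGrading (v := A.col i) (hA.diag i) r

theorem IsGCM.single_neg_col_mem (hA : IsGCM A) (i : I) (r : ℂ) :
    single (-A.col i) r ∈ xGrading i (-2) :=
  single_mem_xGrading (v := -A.col i) (congrArg Neg.neg (hA.diag i)) r

theorem xComponent_eq_of_shiftable (hA : IsGCM A) (hQ : IsQFamily A Q d) (hg : g ∈ xGrading i 0)
    (h : Shiftable Q i j (twoTerm A Q i + g) F) (n : ℤ) :
    (1 - (Q i : ℂ) ^ (n - 2 + A i j)) • (single (A.col i) (Q i : ℂ) * xComponent i (n - 2) F) +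
        (1 - (Q i : ℂ) ^ (n + 2 - A i j)) •
          (single (-A.col i) (Q i : ℂ)⁻¹ * xComponent i (n + 2) F) =
      ((Q i : ℂ) ^ n • (zeta Q j).symm g - g) * xComponent i n F := by
  have hq := (Q i).ne_zero
  have hy : (zeta Q j).symm (single (A.col i) (Q i : ℂ)) =
      (Q i : ℂ) ^ A i j • single (A.col i) (Q i : ℂ) := by
    rw [zeta_symm_single, Matrix.col_apply, hQ.zpow_eq, ← smul_eq_mul, smul_single]
  have hy' : (zeta Q j).symm (single (-A.col i) (Q i : ℂ)⁻¹) =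
      (Q i : ℂ) ^ (-A i j) • single (-A.col i) (Q i : ℂ)⁻¹ := by
    rw [zeta_symm_single, Pi.neg_apply, Matrix.col_apply, zpow_neg, hQ.zpow_eq, ← zpow_neg,
      ← smul_eq_mul, smul_single]
  have hl : ∀ {m : ℤ} {p : Laurent I}, p ∈ xGrading i m →
      xComponent i n (p * F) = p * xComponent i (n - m) F :=
    fun hp => xComponent_mul_of_left_mem hp n F
  have hr : ∀ {m : ℤ} {p : Laurent I}, p ∈ xGrading i m →
      xComponent i n ((zeta Q j).symm p * (zeta Q i).symm F) =
        (Q i : ℂ) ^ (n - m) • ((zeta Q j).symm p * xComponent i (n - m) F) := fun hp => by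
    rw [xComponent_mul_of_left_mem (zeta_symm_mem_xGrading hp Q j), xComponent_zeta_symm,
      mul_smul_comm]
  have hn := congrArg (xComponent i n) h
  simp only [twoTerm, map_add, add_mul, hl hg, hr hg, hl (hA.single_col_mem i _),
    hr (hA.single_col_mem i _), hl (hA.single_neg_col_mem i _),
    hr (hA.single_neg_col_mem i _)] at hn
  simp only [hy, hy', smul_mul_assoc, smul_smul, ← zpow_add₀ hq, sub_neg_eq_add, sub_zero,
    ← sub_eq_add_neg] at hn
  simp only [sub_mul, smul_mul_assoc, sub_smul, one_smul]
  linear_combination (exp := 1) hn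

theorem single_mul_eq_zero {v : I → ℤ} {c : ℂ} (hc : c ≠ 0) : single v c * F = 0 ↔ F = 0 := by
  rw [mul_eq_zero, single_eq_zero, or_iff_right hc]

theorem IsNormal.eq_of_xComponent_top (hA : IsGCM A) (hQ : IsQFamily A Q d)
    (hf : IsNormal A Q i f) (h : Shiftable Q i j f F) (hn : xComponent i n F ≠ 0)
    (h₂ : xComponent i (n + 2) F = 0) (h₄ : xComponent i (n + 4) F = 0) : n = -A i j := by
  obtain ⟨g, hg, rfl⟩ := hf
  have heq := xComponent_eq_of_shiftable hA hQ hg h (n + 2)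
  rw [add_sub_cancel_right, add_assoc, h₂, show n + (2 + 2) = n + 4 by norm_num, h₄, mul_zero,
    mul_zero, smul_zero, add_zero, smul_eq_zero, single_mul_eq_zero (Q i).ne_zero,
    or_iff_left hn, sub_eq_zero, eq_comm, hQ.zpow_eq_one] at heq
  lia

theorem IsNormal.eq_of_xComponent_bot (hA : IsGCM A) (hQ : IsQFamily A Q d)
    (hf : IsNormal A Q i f) (h : Shiftable Q i j f F) (hn : xComponent i n F ≠ 0)
    (h₂ : xComponent i (n - 2) F = 0) (h₄ : xComponent i (n - 4) F = 0) : n = A i j := by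
  obtain ⟨g, hg, rfl⟩ := hf
  have heq := xComponent_eq_of_shiftable hA hQ hg h (n - 2)
  rw [sub_add_cancel, sub_sub n, h₂, show n - (2 + 2) = n - 4 by norm_num, h₄, mul_zero,
    mul_zero, smul_zero, zero_add, smul_eq_zero, single_mul_eq_zero (inv_ne_zero (Q i).ne_zero),
    or_iff_left hn, sub_eq_zero, eq_comm, hQ.zpow_eq_one] at heq
  lia

theorem IsNormal.abs_apply_le (hA : IsGCM A) (hQ : IsQFamily A Q d) (hf : IsNormal A Q i f)
    (h : Shiftable Q i j f F) {v : I → ℤ} (hv : F.coeff v ≠ 0) : |v i| ≤ -A i j := by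
  have hne : F.coeff.support.Nonempty := ⟨v, Finsupp.mem_support_iff.2 hv⟩
  obtain ⟨u, hu, hmax⟩ := Finset.exists_max_image F.coeff.support (fun v => v i) hne
  obtain ⟨w, hw, hmin⟩ := Finset.exists_min_image F.coeff.support (fun v => v i) hne
  simp only [Finsupp.mem_support_iff] at hu hmax hw hmin
  have hmaxdeg : u i = -A i j :=
    hf.eq_of_xComponent_top hA hQ h (fun h0 => xComponent_eq_zero_iff.1 h0 u hu rfl)
      (xComponent_eq_zero_iff.2 fun v hv => by have := hmax v hv; lia)
      (xComponent_eq_zero_iff.2 fun v hv => by have := hmax v hv; lia)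
  have hmindeg : w i = A i j :=
    hf.eq_of_xComponent_bot hA hQ h (fun h0 => xComponent_eq_zero_iff.1 h0 w hw rfl)
      (xComponent_eq_zero_iff.2 fun v hv => by have := hmin v hv; lia)
      (xComponent_eq_zero_iff.2 fun v hv => by have := hmin v hv; lia)
  exact abs_le.2 ⟨by linarith [hmin v hv], by linarith [hmax v hv]⟩

theorem IsNormal.xComponent_eq_zero (hA : IsGCM A) (hQ : IsQFamily A Q d) (hf : IsNormal A Q i f)
    (h : Shiftable Q i j f F) (hn : -A i j < |n|) : xComponent i n F = 0 :=
  xComponent_eq_zero_iff.2 fun _ hv hvn => hn.not_ge (hvn ▸ hf.abs_apply_le hA hQ h hv)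

end degree

/-! ### Edges with `a_{ij} = -1` -/

section edge

variable {I : Type*}

open AddMonoidAlgebra

/-- The Laurent polynomial `q_i y_i + q_i⁻¹ y_i⁻¹ + q_i⁻¹ w + q_i w⁻¹` for `w = c x^v`. -/
def fourTerm (A : Matrix I I ℤ) (Q : I → ℂˣ) (i : I) (v : I → ℤ) (c : ℂ) : Laurent I :=
  twoTerm A Q i + (single v ((Q i : ℂ)⁻¹ * c) + single (-v) ((Q i : ℂ) * c⁻¹))

/-- The conditions on the monomial `w = c x^v` under which `fourTerm A Q i v c` can occur along
an edge with `a_{ij} = -1`. -/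
structure IsEdgeMonomial (A : Matrix I I ℤ) (Q : I → ℂˣ) (i j : I) (v : I → ℤ) (c : ℂ) :
    Prop where
  ne_zero : c ≠ 0
  self : v i = 0
  target : v j = -A j i ∨ (v = 0 ∧ c ^ 2 = Q i)

variable {A : Matrix I I ℤ} {Q : I → ℂˣ} {d : I → ℚ} {i j : I} {f g σ F : Laurent I}
  {v : I → ℤ} {c : ℂ}

/-- Both factors on the left divide a unit, so they are monomials. -/
theorem exists_eq_single_add_single {q : ℂ} (hq : q ≠ 0) (hs : q - q⁻¹ ≠ 0)
    (h : (q • σ - g) * (q⁻¹ • σ - g) = single 0 (-(q - q⁻¹) ^ 2)) :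
    ∃ v c, c ≠ 0 ∧ g = single v (q⁻¹ * c) + single (-v) (q * c⁻¹) ∧
      σ = single v c + single (-v) c⁻¹ ∧ q • σ - g = single v ((q - q⁻¹) * c) := by
  obtain ⟨v, r, hr, hU⟩ := exists_eq_single_of_mul_eq_single (neg_ne_zero.2 (pow_ne_zero 2 hs)) h
  have hV : q⁻¹ • σ - g = single (-v) (-(q - q⁻¹) ^ 2 * r⁻¹) := by
    calc q⁻¹ • σ - g = single (-v) r⁻¹ * (single v r * (q⁻¹ • σ - g)) := by
          rw [← mul_assoc, single_mul_single, neg_add_cancel, inv_mul_cancel₀ hr, ← one_def,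
            one_mul]
      _ = single (-v) (-(q - q⁻¹) ^ 2 * r⁻¹) := by
          rw [← hU, h, single_mul_single, add_zero, mul_comm]
  have hσ : σ = (q - q⁻¹)⁻¹ • ((q • σ - g) - (q⁻¹ • σ - g)) := by
    rw [sub_sub_sub_cancel_right, ← sub_smul, inv_smul_smul₀ hs]
  have hg : g = (q - q⁻¹)⁻¹ • (q⁻¹ • (q • σ - g) - q • (q⁻¹ • σ - g)) := by
    rw [smul_sub q⁻¹, inv_smul_smul₀ hq, smul_sub q, smul_inv_smul₀ hq, sub_sub_sub_cancel_left,
      ← sub_smul, inv_smul_smul₀ hs]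
  refine ⟨v, (q - q⁻¹)⁻¹ * r, mul_ne_zero (inv_ne_zero hs) hr, hg.trans ?_, hσ.trans ?_, ?_⟩
  · rw [hU, hV, smul_single, smul_single, smul_sub, smul_single, smul_single,
      sub_eq_add_neg (single v _), ← single_neg]
    simp only [smul_eq_mul]
    congr 2 <;> field_simp
  · rw [hU, hV, sub_eq_add_neg (single v r), ← single_neg, smul_add, smul_single, smul_single]
    simp only [smul_eq_mul]
    congr 2
    field_simp
  · rw [hU, mul_inv_cancel_left₀ hs]

theorem coeff_single_add_single_neg (hv : v ≠ 0) (a b : ℂ) :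
    (single v a + single (-v) b : Laurent I).coeff v = a := by
  rw [coeff_add, Finsupp.add_apply, coeff_single, coeff_single, Finsupp.single_eq_same,
    Finsupp.single_eq_of_ne' (neg_eq_self.not.2 hv), add_zero]

theorem isEdgeMonomial_of_zeta_symm_eq (hQ : IsQFamily A Q d) (hij : A i j = -1) (hc : c ≠ 0)
    (hg : single v ((Q i : ℂ)⁻¹ * c) + single (-v) ((Q i : ℂ) * c⁻¹) ∈ xGrading i 0)
    (hσ : (zeta Q j).symm (single v ((Q i : ℂ)⁻¹ * c) + single (-v) ((Q i : ℂ) * c⁻¹)) =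
      single v c + single (-v) c⁻¹) : IsEdgeMonomial A Q i j v c := by
  have hq := (Q i).ne_zero
  rcases eq_or_ne v 0 with rfl | hv
  · refine ⟨hc, rfl, Or.inr ⟨rfl, ?_⟩⟩
    rw [neg_zero, ← single_add, ← single_add, zeta_symm_single, Pi.zero_apply, zpow_zero, one_mul,
      single_right_inj] at hσ
    have hq1 : 1 - (Q i : ℂ) ≠ 0 := fun h0 => one_ne_zero <|
      (hQ.zpow_eq_one i 1).1 (by rw [zpow_one]; exact (sub_eq_zero.1 h0).symm)
    field_simp at hσ
    exact mul_left_cancel₀ hq1 (by linear_combination hσ)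
  · have hcoeff := congrArg (fun p : Laurent I => p.coeff v) hσ
    simp only [coeff_zeta_symm, coeff_single_add_single_neg hv] at hcoeff
    have hpow : (Q j : ℂ) ^ (v j + A j i) = 1 := by
      rw [zpow_add₀ (Q j).ne_zero, hQ.zpow_eq, hij, zpow_neg_one]
      exact mul_right_cancel₀ hc (by rw [mul_assoc, hcoeff, one_mul])
    refine ⟨hc, mem_xGrading.1 hg v ?_, Or.inl (eq_neg_of_add_eq_zero_left
      ((hQ.zpow_eq_one j _).1 hpow))⟩
    rw [coeff_single_add_single_neg hv]
    exact mul_ne_zero (inv_ne_zero hq) hc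

theorem IsNormal.eq_xComponent_add (hA : IsGCM A) (hQ : IsQFamily A Q d) (hij : A i j = -1)
    (hf : IsNormal A Q i f) (h : Shiftable Q i j f F) :
    F = xComponent i 1 F + xComponent i (-1) F := by
  ext v
  rw [coeff_add, Finsupp.add_apply, coeff_xComponent, coeff_xComponent]
  by_cases hv : F.coeff v = 0
  · simp [hv]
  · have hne : v i ≠ 0 := fun h0 => by
      have := hf.eq_of_xComponent_top hA hQ h (n := 0)
        (fun h1 => xComponent_eq_zero_iff.1 h1 v hv h0)
        (hf.xComponent_eq_zero hA hQ h (by simp [hij]))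
        (hf.xComponent_eq_zero hA hQ h (by simp [hij]))
      lia
    have hb := abs_le.1 (hf.abs_apply_le hA hQ h hv)
    obtain h1 | h1 : v i = 1 ∨ v i = -1 := by lia
    all_goals simp [h1]

theorem IsNormal.exists_eq_fourTerm (hA : IsGCM A) (hQ : IsQFamily A Q d) (hij : A i j = -1)
    (hf : IsNormal A Q i f) (hF : xComponent i (-1) F ≠ 0) (h : Shiftable Q i j f F) :
    ∃ v c, IsEdgeMonomial A Q i j v c ∧ f = fourTerm A Q i v c ∧
      ∃ h ∈ xGrading i 1, F = h * (1 + single (v - A.col i) c) := by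
  have hsum := hf.eq_xComponent_add hA hQ hij h
  have h₃ : xComponent i 3 F = 0 := hf.xComponent_eq_zero hA hQ h (by simp [hij])
  have h₃' : xComponent i (-3) F = 0 := hf.xComponent_eq_zero hA hQ h (by simp [hij])
  obtain ⟨g, hg, rfl⟩ := hf
  have hq := (Q i).ne_zero
  have hs := hQ.sub_inv_ne_zero i
  have hpos : (1 - ((Q i : ℂ) ^ 2)⁻¹) • (single (A.col i) (Q i : ℂ) * xComponent i (-1) F) =
      ((Q i : ℂ) • (zeta Q j).symm g - g) * xComponent i 1 F := by
    have h₁ := xComponent_eq_of_shiftable hA hQ hg h 1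
    norm_num [hij, h₃] at h₁
    exact h₁
  have hneg : (1 - (Q i : ℂ) ^ 2) • (single (-A.col i) (Q i : ℂ)⁻¹ * xComponent i 1 F) =
      ((Q i : ℂ)⁻¹ • (zeta Q j).symm g - g) * xComponent i (-1) F := by
    have h₁ := xComponent_eq_of_shiftable hA hQ hg h (-1)
    norm_num [hij, h₃'] at h₁
    exact h₁
  have hprod : ((Q i : ℂ) • (zeta Q j).symm g - g) * ((Q i : ℂ)⁻¹ • (zeta Q j).symm g - g) =
      single 0 (-((Q i : ℂ) - (Q i : ℂ)⁻¹) ^ 2) := by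
    refine mul_right_cancel₀ hF ?_
    rw [mul_assoc, ← hneg, mul_smul_comm, mul_left_comm, ← hpos, mul_smul_comm, ← mul_assoc,
      single_mul_single, neg_add_cancel, inv_mul_cancel₀ hq, smul_smul, ← smul_mul_assoc,
      smul_single, smul_eq_mul, mul_one]
    congr 2
    field_simp
    ring
  obtain ⟨v, c, hc, rfl, hσ, hU⟩ := exists_eq_single_add_single hq hs hprod
  refine ⟨v, c, isEdgeMonomial_of_zeta_symm_eq hQ hij hc hg hσ, rfl, _, xComponent_mem i 1 F, ?_⟩
  have hF' : xComponent i (-1) F = single (v - A.col i) c * xComponent i 1 F := by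
    have hk : 1 - ((Q i : ℂ) ^ 2)⁻¹ ≠ 0 := fun h0 => hs (by field_simp at h0 ⊢; simpa using h0)
    refine mul_left_cancel₀ (a := single (A.col i) (Q i : ℂ)) (single_ne_zero.2 hq)
      ((smul_right_inj hk).1 ?_)
    rw [hpos, hU, ← mul_assoc, single_mul_single, add_sub_cancel, ← smul_mul_assoc, smul_single,
      smul_eq_mul]
    congr 2
    field_simp
  rw [mul_add, mul_one, mul_comm _ (single _ _), ← hF', ← hsum]

end edge

section factor

variable {I : Type*}

open AddMonoidAlgebra

variable {A : Matrix I I ℤ} {Q : I → ℂˣ} {d : I → ℚ} {i j : I} {f h : Laurent I}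
  {v w δ : I → ℤ} {c : ℂ}

theorem one_add_single_mul (u v : I → ℤ) (r s t : ℂ) :
    (1 + single (v - u) r : Laurent I) * (single u s + single (-v) t) =
      single u s + single (-u) (r * t) + (single v (r * s) + single (-v) t) := by
  rw [add_mul, one_mul, mul_add, single_mul_single, single_mul_single, sub_add_cancel,
    show v - u + -v = -u by abel]
  abel

theorem fourTerm_eq_mul (hc : c ≠ 0) : fourTerm A Q i v c =
    (Q i : ℂ) • ((1 + single (v - A.col i) (((Q i : ℂ) ^ 2)⁻¹ * c)) *
      (single (A.col i) 1 + single (-v) c⁻¹)) := by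
  have hq := (Q i).ne_zero
  rw [one_add_single_mul, fourTerm, twoTerm]
  simp only [smul_add, smul_single, smul_eq_mul]
  congr 3 <;> field_simp

theorem IsEdgeMonomial.zeta_symm_fourTerm (hQ : IsQFamily A Q d) (hij : A i j = -1)
    (hE : IsEdgeMonomial A Q i j v c) : (zeta Q j).symm (fourTerm A Q i v c) =
      (1 + single (v - A.col i) c) * (single (A.col i) 1 + single (-v) c⁻¹) := by
  have hq := (Q i).ne_zero
  have hc := hE.ne_zero
  have hκ : (Q j : ℂ) ^ A j i = (Q i : ℂ)⁻¹ := by rw [hQ.zpow_eq, hij, zpow_neg_one]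
  rw [one_add_single_mul, fourTerm, twoTerm]
  simp only [map_add, zeta_symm_single, Pi.neg_apply, Matrix.col_apply, zpow_neg, hκ]
  rw [inv_inv, inv_mul_cancel₀ hq, mul_inv_cancel₀ hq, mul_inv_cancel₀ hc, mul_one]
  congr 1
  rcases hE.target with hv | ⟨rfl, hv⟩
  · rw [hv, zpow_neg, hκ, inv_inv, mul_inv_cancel_left₀ hq, inv_mul_cancel_left₀ hq]
  · rw [neg_zero, ← single_add, ← single_add, Pi.zero_apply, zpow_zero, ← hv]
    congr 1
    field_simp
    ring

theorem IsEdgeMonomial.shiftable_mul (hA : IsGCM A) (hQ : IsQFamily A Q d) (hij : A i j = -1)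
    (hE : IsEdgeMonomial A Q i j v c) (hh : h ∈ xGrading i 1) :
    Shiftable Q i j (fourTerm A Q i v c) (h * (1 + single (v - A.col i) c)) := by
  have hδ : (v - A.col i) i = -2 := by
    rw [Pi.sub_apply, hE.self, Matrix.col_apply, hA.diag, zero_sub]
  unfold Shiftable
  rw [hE.zeta_symm_fourTerm hQ hij, fourTerm_eq_mul hE.ne_zero, map_mul, zeta_symm_eq_smul hh,
    map_add, map_one, zeta_symm_single, hδ, zpow_one, zpow_neg, zpow_ofNat, smul_mul_assoc,
    smul_mul_assoc, mul_smul_comm]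
  congr 1
  ring

theorem fourTerm_eq_mul_one_add_single (hc : c ≠ 0) : fourTerm A Q j (δ - A.col j) c =
    (single (-A.col j) (Q j : ℂ)⁻¹ + single (A.col j - δ) ((Q j : ℂ) * c⁻¹)) *
      (1 + single δ c) := by
  rw [mul_add, mul_one, add_mul, single_mul_single, single_mul_single, fourTerm, twoTerm,
    sub_add_cancel, inv_mul_cancel_right₀ hc, neg_sub, show -A.col j + δ = δ - A.col j by abel]
  abel

theorem twoTerm_eq_mul_one_add_single (hδ : δ = 2 • A.col j) (hc : c = (Q j : ℂ) ^ 2) :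
    twoTerm A Q j = single (-A.col j) (Q j : ℂ)⁻¹ * (1 + single δ c) := by
  rw [mul_add, mul_one, single_mul_single, hδ, hc, two_smul, neg_add_cancel_left, pow_two,
    inv_mul_cancel_left₀ (Q j).ne_zero, twoTerm, add_comm]

theorem shiftable_fourTerm (hA : IsGCM A) (hQ : IsQFamily A Q d) (hij : A i j = -1)
    (hE : IsEdgeMonomial A Q i j v c) :
    Shiftable Q i j (fourTerm A Q i v c) (fourTerm A Q j (v - A.col i - A.col j) c) := by
  rw [fourTerm_eq_mul_one_add_single hE.ne_zero]
  refine hE.shiftable_mul hA hQ hij (add_mem (single_mem_xGrading ?_ _) (single_mem_xGrading ?_ _))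
  · rw [Pi.neg_apply, Matrix.col_apply, hij, neg_neg]
  · simp [Matrix.col_apply, hij, hE.self, hA.diag]

theorem shiftable_twoTerm (hA : IsGCM A) (hQ : IsQFamily A Q d) (hij : A i j = -1)
    (hE : IsEdgeMonomial A Q i j v c) (hδ : v - A.col i = 2 • A.col j)
    (hc : c = (Q j : ℂ) ^ 2) :
    Shiftable Q i j (fourTerm A Q i v c) (twoTerm A Q j) := by
  rw [twoTerm_eq_mul_one_add_single hδ hc]
  refine hE.shiftable_mul hA hQ hij (single_mem_xGrading ?_ _)
  rw [Pi.neg_apply, Matrix.col_apply, hij, neg_neg]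

theorem IsGCM.neg_col_ne (hA : IsGCM A) (i : I) : -A.col i ≠ A.col i := fun h => by
  have := congrFun h i
  rw [Pi.neg_apply, Matrix.col_apply, hA.diag] at this
  lia

theorem coeff_twoTerm_ne_zero (hw : (twoTerm A Q i).coeff w ≠ 0) :
    w = A.col i ∨ w = -A.col i := by
  contrapose! hw
  rw [twoTerm, coeff_add, Finsupp.add_apply, coeff_single, coeff_single,
    Finsupp.single_eq_of_ne hw.1, Finsupp.single_eq_of_ne hw.2, add_zero]

theorem IsNormal.coeff_eq (hf : IsNormal A Q i f) (hw : w i ≠ 0) :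
    f.coeff w = (twoTerm A Q i).coeff w := by
  obtain ⟨g, hg, rfl⟩ := hf
  rw [coeff_add, Finsupp.add_apply, add_eq_left]
  exact by_contra fun h => hw (mem_xGrading.1 hg w h)

theorem IsNormal.coeff_col (hA : IsGCM A) (hf : IsNormal A Q i f) :
    f.coeff (A.col i) = Q i := by
  rw [hf.coeff_eq (by simp [Matrix.col_apply, hA.diag]), twoTerm, coeff_add, Finsupp.add_apply,
    coeff_single, coeff_single, Finsupp.single_eq_same, Finsupp.single_eq_of_ne' (hA.neg_col_ne i),
    add_zero]

theorem IsNormal.coeff_neg_col (hA : IsGCM A) (hf : IsNormal A Q i f) :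
    f.coeff (-A.col i) = (Q i : ℂ)⁻¹ := by
  rw [hf.coeff_eq (by simp [Matrix.col_apply, hA.diag]), twoTerm, coeff_add, Finsupp.add_apply,
    coeff_single, coeff_single, Finsupp.single_eq_same, Finsupp.single_eq_of_ne (hA.neg_col_ne i),
    zero_add]

theorem IsNormal.eq_or_eq_neg (hf : IsNormal A Q i f) (h : f.coeff w ≠ 0) (hw : w i ≠ 0) :
    w = A.col i ∨ w = -A.col i :=
  coeff_twoTerm_ne_zero (hf.coeff_eq hw ▸ h)

end factor

section simpleEdge

variable {I : Type*}

open AddMonoidAlgebra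

variable {A : Matrix I I ℤ} {Q : I → ℂˣ} {d : I → ℚ} {i j k : I} {f : I → Laurent I}
  {h : Laurent I} {v w δ : I → ℤ} {c : ℂ} {n : ℤ}

theorem eq_single_add_single (hne : v ≠ w) (hsupp : ∀ u, h.coeff u ≠ 0 → u = v ∨ u = w) :
    h = single v (h.coeff v) + single w (h.coeff w) := by
  ext u
  rw [coeff_add, Finsupp.add_apply, coeff_single, coeff_single]
  by_cases hu : h.coeff u = 0
  · rw [hu]
    rcases eq_or_ne v u with rfl | hvu
    · simp [hu, hne.symm]
    · rcases eq_or_ne w u with rfl | hwu <;> simp [*]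
  · rcases hsupp u hu with rfl | rfl <;> simp [hne, hne.symm]

theorem coeff_mul_one_add_single_of_mem (hδ : δ i ≠ 0) (hh : h ∈ xGrading i n) {w : I → ℤ}
    (hw : w i = n) : (h * (1 + single δ c)).coeff w = h.coeff w := by
  have hw' : h.coeff (w - δ) = 0 := by_contra fun h0 =>
    hδ (by have := mem_xGrading.1 hh _ h0; rw [Pi.sub_apply] at this; lia)
  rw [coeff_mul_one_add_single, hw', mul_zero, add_zero]

theorem coeff_mul_one_add_single_add_of_mem (hδ : δ i ≠ 0) (hh : h ∈ xGrading i n) {w : I → ℤ}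
    (hw : w i = n) : (h * (1 + single δ c)).coeff (w + δ) = c * h.coeff w := by
  have hw' : h.coeff (w + δ) = 0 := by_contra fun h0 =>
    hδ (by have := mem_xGrading.1 hh _ h0; rw [Pi.add_apply] at this; lia)
  rw [coeff_mul_one_add_single, hw', zero_add, add_sub_cancel_right]

theorem IsNormal.factor_coeff (hA : IsGCM A) (hij : A i j = -1) (hc : c ≠ 0)
    (hδ : δ i = -2) (hh : h ∈ xGrading i 1) (hf : IsNormal A Q j (h * (1 + single δ c))) :
    h.coeff (-A.col j) = (Q j : ℂ)⁻¹ ∧ h.coeff (A.col j - δ) = (Q j : ℂ) * c⁻¹ ∧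
      (δ j = 2 ∨ δ = 2 • A.col j) ∧ ∀ u, h.coeff u ≠ 0 → u = -A.col j ∨ u = A.col j - δ := by
  have hleft : ∀ w, w i = 1 → (h * (1 + single δ c)).coeff w = h.coeff w := fun w =>
    coeff_mul_one_add_single_of_mem (by lia) hh
  have hright : ∀ w, w i = 1 → (h * (1 + single δ c)).coeff (w + δ) = c * h.coeff w := fun w =>
    coeff_mul_one_add_single_add_of_mem (by lia) hh
  have hcol : A.col j i = -1 := hij
  have hcolj : A.col j j = 2 := hA.diag j
  have hlow : h.coeff (-A.col j) = (Q j : ℂ)⁻¹ := by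
    rw [← hleft _ (by rw [Pi.neg_apply, hcol, neg_neg]), hf.coeff_neg_col hA]
  have hδj : δ j = 2 ∨ δ = 2 • A.col j := by
    refine or_iff_not_imp_left.2 fun h2 => ?_
    have hne : (h * (1 + single δ c)).coeff (-A.col j + δ) ≠ 0 := by
      rw [hright _ (by rw [Pi.neg_apply, hcol, neg_neg]), hlow]
      exact mul_ne_zero hc (inv_ne_zero (Q j).ne_zero)
    rcases hf.eq_or_eq_neg hne (by simp only [Pi.add_apply, Pi.neg_apply]; lia) with h3 | h3
    · rw [two_smul, ← neg_add_eq_iff_eq_add, h3]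
    · rw [add_eq_left] at h3
      simp [h3] at hδ
  refine ⟨hlow, ?_, hδj, fun u hu => ?_⟩
  · have hup := hright (A.col j - δ) (by rw [Pi.sub_apply]; lia)
    rw [sub_add_cancel, hf.coeff_col hA] at hup
    rw [hup, mul_comm c, mul_inv_cancel_right₀ hc]
  · have hui : u i = 1 := mem_xGrading.1 hh u hu
    by_cases huj : u j = 0
    · have hne : (h * (1 + single δ c)).coeff (u + δ) ≠ 0 := by
        rw [hright u hui]
        exact mul_ne_zero hc hu
      have hδj' : δ j ≠ 0 := by
        rcases hδj with h2 | h2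
        · lia
        · rw [h2, Pi.smul_apply, hcolj]
          norm_num
      rcases hf.eq_or_eq_neg hne (by rwa [Pi.add_apply, huj, zero_add]) with h3 | h3
      · exact Or.inr (eq_sub_of_add_eq h3)
      · have := congrFun h3 i
        simp only [Pi.add_apply, Pi.neg_apply] at this
        lia
    · refine Or.inl ((hf.eq_or_eq_neg (by rwa [hleft u hui]) huj).resolve_left ?_)
      rintro rfl
      lia

theorem IsNormal.eq_fourTerm_or_eq_twoTerm (hA : IsGCM A) (hij : A i j = -1) (hc : c ≠ 0)
    (hδ : δ i = -2) (hh : h ∈ xGrading i 1) (hf : IsNormal A Q j (h * (1 + single δ c))) :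
    (δ j = 2 ∧ h * (1 + single δ c) = fourTerm A Q j (δ - A.col j) c) ∨
      (δ = 2 • A.col j ∧ c = (Q j : ℂ) ^ 2 ∧ h * (1 + single δ c) = twoTerm A Q j) := by
  obtain ⟨hlow, hup, hδj | hδj, hsupp⟩ := hf.factor_coeff hA hij hc hδ hh
  · refine Or.inl ⟨hδj, ?_⟩
    have hne : -A.col j ≠ A.col j - δ := fun h0 => by
      have := congrFun h0 j
      simp [Matrix.col_apply, hA.diag, hδj] at this
    rw [fourTerm_eq_mul_one_add_single hc, ← hlow, ← hup, ← eq_single_add_single hne hsupp]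
  · have heq : A.col j - δ = -A.col j := by rw [hδj, two_smul]; abel
    have hc' : c = (Q j : ℂ) ^ 2 := by
      rw [heq, hlow] at hup
      field_simp at hup
      exact hup
    refine Or.inr ⟨hδj, hc', ?_⟩
    have hh' : h = single (-A.col j) (Q j : ℂ)⁻¹ := by
      rw [← hlow]
      ext u
      rw [coeff_single]
      by_cases hu : h.coeff u = 0
      · rcases eq_or_ne (-A.col j) u with rfl | hne <;> simp [*]
      · obtain rfl : u = -A.col j := by simpa [heq] using hsupp u hu
        simp
    rw [twoTerm_eq_mul_one_add_single hδj hc', ← hh']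

/-- The system of equations for the rescaled unknowns `f_i = -(q_i - q_i⁻¹)² φ_i`. -/
structure IsNormalSolution (A : Matrix I I ℤ) (Q : I → ℂˣ) (f : I → Laurent I) : Prop where
  normal : ∀ i, IsNormal A Q i (f i)
  shift : ∀ i j, i ≠ j → Shiftable Q i j (f i) (f j)

theorem isNormal_twoTerm : IsNormal A Q i (twoTerm A Q i) :=
  ⟨0, zero_mem _, (add_zero _).symm⟩

theorem single_add_single_neg_mem (hv : v i = 0) (a b : ℂ) :
    single v a + single (-v) b ∈ xGrading i 0 :=
  add_mem (single_mem_xGrading hv a) (single_mem_xGrading (by rw [Pi.neg_apply, hv, neg_zero]) b)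

theorem isNormal_fourTerm (hv : v i = 0) (c : ℂ) : IsNormal A Q i (fourTerm A Q i v c) :=
  ⟨_, single_add_single_neg_mem hv _ _, rfl⟩

theorem coeff_twoTerm_of_apply_eq_zero (hA : IsGCM A) (hw : w i = 0) :
    (twoTerm A Q i).coeff w = 0 := by
  by_contra h
  rcases coeff_twoTerm_ne_zero h with rfl | rfl <;>
    simp [Matrix.col_apply, hA.diag] at hw

theorem coeff_fourTerm (hA : IsGCM A) (hvi : v i = 0) (hv : v ≠ 0) (c : ℂ) :
    (fourTerm A Q i v c).coeff v = (Q i : ℂ)⁻¹ * c := by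
  rw [fourTerm, coeff_add, Finsupp.add_apply, coeff_twoTerm_of_apply_eq_zero hA hvi, zero_add,
    coeff_single_add_single_neg hv]

theorem IsNormalSolution.abs_apply_le (hA : IsGCM A) (hQ : IsQFamily A Q d)
    (hf : IsNormalSolution A Q f) (hfi : f i = fourTerm A Q i v c) (hc : c ≠ 0) (hvi : v i = 0)
    (hki : k ≠ i) : |v k| ≤ -A k i := by
  rcases eq_or_ne v 0 with rfl | hv
  · simpa using hA.offDiag k i hki
  · refine (hf.normal k).abs_apply_le hA hQ (hf.shift k i hki) ?_
    rw [hfi, coeff_fourTerm hA hvi hv]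
    exact mul_ne_zero (inv_ne_zero (Q i).ne_zero) hc

theorem IsNormalSolution.exists_isEdgeMonomial (hA : IsGCM A) (hQ : IsQFamily A Q d)
    (hf : IsNormalSolution A Q f) (hne : i ≠ j) (hij : A i j = -1) :
    ∃ v c, IsEdgeMonomial A Q i j v c ∧ f i = fourTerm A Q i v c ∧
      (∀ k, k ≠ i → k ≠ j → v k = A k i) ∧
      ((v j - A j i = 2 ∧ f j = fourTerm A Q j (v - A.col i - A.col j) c) ∨
        (v - A.col i = 2 • A.col j ∧ c = (Q j : ℂ) ^ 2 ∧ f j = twoTerm A Q j)) := by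
  have hF : xComponent i (-1) (f j) ≠ 0 := fun h0 => by
    refine xComponent_eq_zero_iff.1 h0 (A.col j) ?_ hij
    rw [(hf.normal j).coeff_col hA]
    exact (Q j).ne_zero
  obtain ⟨v, c, hE, hfi, h, hh, hfj⟩ :=
    (hf.normal i).exists_eq_fourTerm hA hQ hij hF (hf.shift i j hne)
  have hδ : (v - A.col i) i = -2 := by
    rw [Pi.sub_apply, hE.self, Matrix.col_apply, hA.diag, zero_sub]
  have hcases := (hfj ▸ hf.normal j).eq_fourTerm_or_eq_twoTerm hA hij hE.ne_zero hδ hh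
  rw [← hfj] at hcases
  refine ⟨v, c, hE, hfi, fun k hki hkj => ?_, hcases⟩
  have hlow := abs_le.1 (hf.abs_apply_le hA hQ hfi hE.ne_zero hE.self hki)
  rcases hcases with ⟨hδj, hfj'⟩ | ⟨hδ', -, -⟩
  · have hself : (v - A.col i - A.col j) j = 0 := by
      rw [Pi.sub_apply, hδj, Matrix.col_apply, hA.diag, sub_self]
    have hup := abs_le.1 (hf.abs_apply_le hA hQ hfj' hE.ne_zero hself hkj)
    simp only [Pi.sub_apply, Matrix.col_apply] at hup
    lia
  · have hvk := congrFun hδ' k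
    have hkj := hA.offDiag k j hkj
    simp only [Pi.sub_apply, Pi.smul_apply, nsmul_eq_mul, Matrix.col_apply] at hvk
    push_cast at hvk
    lia

end simpleEdge

/-! ### Normalization of the unknowns -/

section normalization

variable {I : Type*}

open AddMonoidAlgebra

theorem mono_add (v w : I → ℤ) : (mono (v + w) : (Laurent I)ˣ) = mono v * mono w := by
  ext1
  rw [Units.val_mul, mono, mono, mono, single_mul_single, one_mul]

theorem mono_zero : (mono 0 : (Laurent I)ˣ) = 1 := rfl

/-- The isomorphism of the group of exponent vectors with the group of monomials. -/
def monoHom : Multiplicative (I → ℤ) →* (Laurent I)ˣ where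
  toFun v := mono v.toAdd
  map_one' := mono_zero
  map_mul' _ _ := mono_add _ _

theorem mono_neg (v : I → ℤ) : (mono (-v) : (Laurent I)ˣ) = (mono v)⁻¹ :=
  map_inv monoHom (Multiplicative.ofAdd v)

theorem mono_zsmul (v : I → ℤ) (n : ℤ) : (mono (n • v) : (Laurent I)ˣ) = mono v ^ n :=
  map_zpow monoHom (Multiplicative.ofAdd v) n

theorem mono_sum {ι : Type*} (s : Finset ι) (v : ι → I → ℤ) :
    (mono (∑ k ∈ s, v k) : (Laurent I)ˣ) = ∏ k ∈ s, mono (v k) :=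
  map_prod monoHom (fun k => Multiplicative.ofAdd (v k)) s

theorem y_eq_mono [Fintype I] [DecidableEq I] (A : Matrix I I ℤ) (i : I) :
    y A i = mono (A.col i) := by
  rw [pi_eq_sum_univ' (A.col i), mono_sum]
  exact Finset.prod_congr rfl fun j _ => (mono_zsmul _ _).symm

theorem scal_mul_mono (a : ℂˣ) (v : I → ℤ) :
    ((scal a * mono v : (Laurent I)ˣ) : Laurent I) = single v (a : ℂ) := by
  simp [scal, mono, coe_algebraMap, single_mul_single]

theorem brace_scal_mono (c a : ℂˣ) (v : I → ℤ) :
    brace c (scal a * mono v) =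
      ((c : ℂ) - (c : ℂ)⁻¹)⁻¹ • (single v (a : ℂ) + single (-v) (-(a : ℂ)⁻¹)) := by
  have hinv : (scal a * mono v : (Laurent I)ˣ)⁻¹ = scal a⁻¹ * mono (-v) := by
    rw [mono_neg, mul_inv, scal, scal, map_inv]
  rw [brace, hinv, scal_mul_mono, scal_mul_mono, Units.val_inv_eq_inv_val, single_neg,
    ← sub_eq_add_neg]

theorem brace_mono (c : ℂˣ) (v : I → ℤ) :
    brace c (mono v) = ((c : ℂ) - (c : ℂ)⁻¹)⁻¹ • (single v (1 : ℂ) + single (-v) (-1 : ℂ)) := by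
  simpa [scal] using brace_scal_mono c 1 v

theorem brace_scal_mono_neg (c a : ℂˣ) (v : I → ℤ) :
    brace c (scal a * mono v) = brace c (scal (-a⁻¹) * mono (-v)) := by
  rw [brace_scal_mono, brace_scal_mono, neg_neg, Units.val_neg, Units.val_inv_eq_inv_val, inv_neg,
    inv_inv, neg_neg, add_comm]

variable {A : Matrix I I ℤ} {Q : I → ℂˣ} {d : I → ℚ} {i : I} {f g : Laurent I}

theorem zeta_single (Q : I → ℂˣ) (i : I) (v : I → ℤ) (r : ℂ) :
    zeta Q i (single v r) = single v (((Q i : ℂ) ^ v i)⁻¹ * r) := by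
  rw [← (zeta Q i).apply_symm_apply (single v (_ * r)), zeta_symm_single,
    mul_inv_cancel_left₀ (zpow_ne_zero _ (Q i).ne_zero)]

theorem IsQFamily.zeta_eq_self_iff (hQ : IsQFamily A Q d) :
    zeta Q i f = f ↔ f ∈ xGrading i 0 := by
  refine ⟨fun h => mem_xGrading.2 fun v hv => ?_, fun h => ?_⟩
  · have hcoeff := congrArg (fun p : Laurent I => p.coeff v) h
    rw [coeff_zeta, mul_eq_right₀ hv, inv_eq_one] at hcoeff
    exact (hQ.zpow_eq_one i _).1 hcoeff
  · conv_lhs => rw [← one_smul ℂ f, ← zpow_zero (Q i : ℂ), ← zeta_symm_eq_smul h]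
    exact (zeta Q i).apply_symm_apply f

theorem isNormal_iff : IsNormal A Q i f ↔ f - twoTerm A Q i ∈ xGrading i 0 :=
  ⟨fun ⟨g, hg, hf⟩ => by rwa [hf, add_sub_cancel_left],
    fun h => ⟨_, h, (add_sub_cancel _ _).symm⟩⟩

/-- The factor `-(q_i - q_i⁻¹)²` used to normalize the unknowns. -/
def scaleFactor (Q : I → ℂˣ) (i : I) : ℂ := -((Q i : ℂ) - (Q i : ℂ)⁻¹) ^ 2

theorem IsQFamily.scaleFactor_ne_zero (hQ : IsQFamily A Q d) (i : I) : scaleFactor Q i ≠ 0 :=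
  neg_ne_zero.2 (pow_ne_zero _ (hQ.sub_inv_ne_zero i))

theorem zeta_twoTerm_sub [Fintype I] [DecidableEq I] (hA : IsGCM A) (hQ : IsQFamily A Q d) :
    zeta Q i (twoTerm A Q i) - twoTerm A Q i = scaleFactor Q i • brace (Q i) (y A i) := by
  have hq := (Q i).ne_zero
  have hs : scaleFactor Q i * ((Q i : ℂ) - (Q i : ℂ)⁻¹)⁻¹ = (Q i : ℂ)⁻¹ - Q i := by
    rw [scaleFactor, sq, neg_mul, mul_inv_cancel_right₀ (hQ.sub_inv_ne_zero i), neg_sub]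
  have hcol : A.col i i = 2 := hA.diag i
  rw [y_eq_mono, brace_mono, smul_smul, hs, twoTerm, map_add, zeta_single, zeta_single,
    add_sub_add_comm, sub_eq_add_neg, sub_eq_add_neg, ← single_neg, ← single_neg, ← single_add,
    ← single_add, smul_add, smul_single, smul_single, Pi.neg_apply, hcol, smul_eq_mul,
    smul_eq_mul, zpow_neg, zpow_ofNat]
  congr 2 <;> field_simp <;> ring

theorem zeta_sub_eq_brace_iff [Fintype I] [DecidableEq I] (hA : IsGCM A) (hQ : IsQFamily A Q d) :
    zeta Q i f - f = brace (Q i) (y A i) ↔ IsNormal A Q i (scaleFactor Q i • f) := by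
  rw [isNormal_iff, ← hQ.zeta_eq_self_iff, map_sub, map_smul, sub_eq_sub_iff_sub_eq_sub,
    zeta_twoTerm_sub hA hQ, ← smul_sub]
  exact (smul_right_injective _ (hQ.scaleFactor_ne_zero i)).eq_iff.symm

theorem isSolution_iff [Fintype I] [DecidableEq I] (hA : IsGCM A) (hQ : IsQFamily A Q d)
    {φ : I → Laurent I} :
    IsSolution A Q φ ↔ IsNormalSolution A Q fun i => scaleFactor Q i • φ i := by
  have hshift : ∀ i j, Shiftable Q i j (scaleFactor Q i • φ i) (scaleFactor Q j • φ j) ↔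
      Shiftable Q i j (φ i) (φ j) := fun i j =>
    shiftable_smul_smul (hQ.scaleFactor_ne_zero i) (hQ.scaleFactor_ne_zero j)
  constructor
  · rintro ⟨h, h'⟩
    exact ⟨fun i => (zeta_sub_eq_brace_iff hA hQ).1 (h i),
      fun i j hij => (hshift i j).2 (h' i j hij)⟩
  · rintro ⟨h, h'⟩
    exact ⟨fun i => (zeta_sub_eq_brace_iff hA hQ).2 (h i),
      fun i j hij => (hshift i j).1 (h' i j hij)⟩

theorem IsQFamily.scaleFactor_smul_eq_iff (hQ : IsQFamily A Q d) {h : Laurent I}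
    (hg : scaleFactor Q i • g = h) : scaleFactor Q i • f = h ↔ f = g := by
  rw [← hg]
  exact (smul_right_injective _ (hQ.scaleFactor_ne_zero i)).eq_iff

theorem IsQFamily.scaleFactor_smul_brace_mul_brace (hQ : IsQFamily A Q d) {v w : I → ℤ} {a b : ℂˣ}
    (hvw : v - w = A.col i) (hab : a = Q i * b) :
    scaleFactor Q i • (brace (Q i) (scal a * mono v) * brace (Q i) (scal b * mono w)) =
      fourTerm A Q i (v + w) (-((Q i : ℂ) ^ 2 * (b : ℂ) ^ 2)) := by
  have hs := hQ.sub_inv_ne_zero i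
  have hq := (Q i).ne_zero
  have hb := b.ne_zero
  have hscale : scaleFactor Q i * (((Q i : ℂ) - (Q i : ℂ)⁻¹)⁻¹ *
      ((Q i : ℂ) - (Q i : ℂ)⁻¹)⁻¹) = -1 := by
    rw [scaleFactor, neg_mul, sq, ← mul_inv, mul_inv_cancel₀ (mul_ne_zero hs hs)]
  have hprod : (single v (a : ℂ) + single (-v) (-(a : ℂ)⁻¹) : Laurent I) *
      (single w (b : ℂ) + single (-w) (-(b : ℂ)⁻¹)) =
        single (v + w) (a * b : ℂ) + single (v - w) (-(a * (b : ℂ)⁻¹)) +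
          (single (-(v - w)) (-((a : ℂ)⁻¹ * b)) + single (-(v + w)) ((a : ℂ)⁻¹ * (b : ℂ)⁻¹)) := by
    rw [add_mul, mul_add, mul_add]
    simp only [single_mul_single, mul_neg, neg_mul, neg_neg, ← sub_eq_add_neg, neg_sub, neg_add]
    rw [neg_add_eq_sub, ← neg_add', neg_add]
  rw [brace_scal_mono, brace_scal_mono, smul_mul_smul_comm, smul_smul, hscale, hprod, hvw,
    fourTerm, twoTerm, hab, Units.val_mul]
  simp only [smul_add, smul_single, smul_eq_mul]
  rw [add_comm (single (v + w) _), add_add_add_comm]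
  congr 3 <;> field_simp

theorem IsQFamily.scaleFactor_smul_I_smul_brace (hQ : IsQFamily A Q d) {v : I → ℤ} {a : ℂˣ}
    (h : (v = A.col i ∧ (a : ℂ) = Complex.I * Q i) ∨
      (v = -A.col i ∧ (a : ℂ) = Complex.I * (Q i : ℂ)⁻¹)) :
    scaleFactor Q i • ((Complex.I / ((Q i : ℂ) - (Q i : ℂ)⁻¹)) • brace (Q i) (scal a * mono v)) =
      twoTerm A Q i := by
  have hs := hQ.sub_inv_ne_zero i
  have hI := Complex.I_mul_I
  have hscale : scaleFactor Q i * (Complex.I / ((Q i : ℂ) - (Q i : ℂ)⁻¹) *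
      ((Q i : ℂ) - (Q i : ℂ)⁻¹)⁻¹) = -Complex.I := by
    rw [scaleFactor]
    generalize (Q i : ℂ) - (Q i : ℂ)⁻¹ = s at hs
    field_simp
  have hI' : ∀ z, -Complex.I * (Complex.I * z) = z := fun z => by linear_combination -z * hI
  have hI'' : ∀ z, -Complex.I * -(Complex.I * z)⁻¹ = z⁻¹ := fun z => by
    rw [mul_inv, Complex.inv_I]
    linear_combination -z⁻¹ * hI
  rw [brace_scal_mono, smul_smul, smul_smul, mul_assoc, hscale, smul_add, smul_single, smul_single,
    twoTerm]
  rcases h with ⟨rfl, ha⟩ | ⟨rfl, ha⟩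
  · rw [ha, smul_eq_mul, smul_eq_mul, hI', hI'']
  · rw [ha, smul_eq_mul, smul_eq_mul, hI', hI'', inv_inv, neg_neg, add_comm]

end normalization

/-! ### Numerical labels and the family `q_i` -/

section labels

variable {I : Type*} {A : Matrix I I ℤ}

theorem IsGCM.transpose (hA : IsGCM A) : IsGCM A.transpose where
  diag := hA.diag
  offDiag i j h := hA.offDiag j i h.symm
  zero i j := hA.zero j i

theorem IsIndecomposable.transpose (hA : IsGCM A) (h : IsIndecomposable A) :
    IsIndecomposable A.transpose := fun S hS hS' => by
  obtain ⟨i, hi, j, hj, hij⟩ := h S hS hS'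
  exact ⟨i, hi, j, hj, fun h0 => hij (hA.zero j i h0)⟩

theorem eq_zero_of_null_of_nonneg [Fintype I] (hA : IsGCM A) (h : IsIndecomposable A)
    {v : I → ℚ} (hv : ∀ i, 0 ≤ v i) (hv0 : ∀ i, ∑ j, (A i j : ℚ) * v j = 0) {i₀ : I}
    (hi₀ : v i₀ = 0) : v = 0 := by
  by_contra hne
  obtain ⟨k, hk⟩ := Function.ne_iff.1 hne
  obtain ⟨i, hi, j, hj, hij⟩ := h {i | v i = 0} ⟨i₀, hi₀⟩ ⟨k, hk⟩
  have hterm : ∀ k ∈ Finset.univ, (A i k : ℚ) * v k ≤ 0 := fun k _ => by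
    rcases eq_or_ne i k with rfl | hik
    · exact (mul_eq_zero_of_right _ hi).le
    · exact mul_nonpos_of_nonpos_of_nonneg (by exact_mod_cast hA.offDiag i k hik) (hv k)
  have hj0 := (Finset.sum_eq_zero_iff_of_nonpos hterm).1 (hv0 i) j (Finset.mem_univ j)
  exact (mul_ne_zero (Int.cast_ne_zero.2 hij) hj) hj0

theorem exists_eq_smul_of_null [Fintype I] [Nonempty I] (hA : IsGCM A)
    (h : IsIndecomposable A) {u w : I → ℚ} (hw : ∀ i, 0 < w i)
    (hu0 : ∀ i, ∑ j, (A i j : ℚ) * u j = 0) (hw0 : ∀ i, ∑ j, (A i j : ℚ) * w j = 0) :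
    ∃ t : ℚ, u = t • w := by
  obtain ⟨i₀, hi₀⟩ := Finite.exists_min fun i => u i / w i
  refine ⟨u i₀ / w i₀, sub_eq_zero.1 <|
    eq_zero_of_null_of_nonneg hA h (fun i => ?_) (fun i => ?_) (i₀ := i₀) ?_⟩
  · exact sub_nonneg.2 ((le_div_iff₀ (hw i)).1 (hi₀ i))
  · simp only [Pi.sub_apply, Pi.smul_apply, smul_eq_mul, mul_sub, mul_left_comm,
      Finset.sum_sub_distrib, ← Finset.mul_sum, hu0, hw0, mul_zero, sub_self]
  · simp [(hw i₀).ne']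

theorem labels_symmetrize [Fintype I] (hA : IsAffineCartan A) {a a' : I → ℕ}
    (ha : IsLabels A a) (ha' : IsLabels A.transpose a') (i j : I) :
    ((a' i : ℚ) / a i) * A i j = ((a' j : ℚ) / a j) * A j i := by
  have := hA.nonempty
  obtain ⟨D, hD, hDs⟩ := hA.symmetrizable
  have hpos : ∀ i, 0 < (a i : ℚ) := fun i => by exact_mod_cast ha.pos i
  have hDa : ∀ i, ∑ j, (A.transpose i j : ℚ) * (D j * a j) = 0 := fun i => by
    have hnull : ∑ j, (A i j : ℚ) * a j = 0 := by exact_mod_cast ha.null i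
    calc ∑ j, (A.transpose i j : ℚ) * (D j * a j) = ∑ j, D i * ((A i j : ℚ) * a j) :=
          Finset.sum_congr rfl fun j _ => by
            rw [Matrix.transpose_apply]
            linear_combination (-(a j : ℚ)) * hDs i j
      _ = 0 := by rw [← Finset.mul_sum, hnull, mul_zero]
  obtain ⟨t, ht⟩ := exists_eq_smul_of_null hA.gcm.transpose
    (hA.indecomposable.transpose hA.gcm) (u := fun i => (a' i : ℚ)) (w := fun i => D i * a i)
    (fun i => mul_pos (hD i) (hpos i)) (fun i => by exact_mod_cast ha'.null i) hDa
  have hd : ∀ i, (a' i : ℚ) / a i = t * D i := fun i => by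
    rw [div_eq_iff (hpos i).ne', congrFun ht i, Pi.smul_apply, smul_eq_mul, mul_assoc]
  rw [hd, hd]
  linear_combination t * hDs i j

theorem coe_qpow (ħ : ℂ) (s : ℚ) : (qpow ħ s : ℂ) = Complex.exp (s * ħ) := rfl

theorem qpow_add (ħ : ℂ) (s t : ℚ) : qpow ħ (s + t) = qpow ħ s * qpow ħ t := by
  ext1
  rw [Units.val_mul, coe_qpow, coe_qpow, coe_qpow, ← Complex.exp_add]
  push_cast
  ring_nf

theorem qpow_zpow (ħ : ℂ) (s : ℚ) (n : ℤ) : qpow ħ s ^ n = qpow ħ (s * n) := by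
  ext1
  rw [Units.val_zpow_eq_zpow_val, coe_qpow, coe_qpow, ← Complex.exp_int_mul]
  push_cast
  ring_nf

theorem qpow_pow (ħ : ℂ) (s : ℚ) (n : ℕ) : qpow ħ s ^ n = qpow ħ (s * n) := by
  rw [← zpow_natCast, qpow_zpow, Int.cast_natCast]

theorem qpow_zero (ħ : ℂ) : qpow ħ 0 = 1 := by
  ext1
  simp [coe_qpow]

theorem qpow_neg (ħ : ℂ) (s : ℚ) : qpow ħ (-s) = (qpow ħ s)⁻¹ := by
  rw [eq_inv_iff_mul_eq_one, ← qpow_add, neg_add_cancel, qpow_zero]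

theorem qpow_intCast (ħ : ℂ) (m : ℤ) : (qpow ħ m : ℂ) = Complex.exp ħ ^ m := by
  rw [coe_qpow, Rat.cast_intCast, Complex.exp_int_mul]

theorem zpow_eq_one_iff_of_not_rootOfUnity {z : ℂ} (hz : ∀ m : ℕ, 0 < m → z ^ m ≠ 1) {n : ℤ} :
    z ^ n = 1 ↔ n = 0 := by
  refine ⟨fun h => by_contra fun hn => hz _ (Int.natAbs_pos.2 hn) ?_, fun h => by simp [h]⟩
  rcases Int.natAbs_eq n with habs | habs <;> rw [habs] at h
  · rwa [zpow_natCast] at h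
  · rwa [zpow_neg, inv_eq_one, zpow_natCast] at h

theorem qpow_eq_one_iff {ħ : ℂ} (hq : ∀ m : ℕ, 0 < m → Complex.exp ħ ^ m ≠ 1) {s : ℚ} :
    qpow ħ s = 1 ↔ s = 0 := by
  refine ⟨fun h => ?_, fun h => by rw [h, qpow_zero]⟩
  have hnum : qpow ħ s.num = 1 := by rw [← Rat.mul_den_eq_num, ← qpow_pow, h, one_pow]
  rwa [Units.ext_iff, qpow_intCast, Units.val_one, zpow_eq_one_iff_of_not_rootOfUnity hq,
    Rat.num_eq_zero] at hnum

theorem isQFamily_qi [Fintype I] (hA : IsAffineCartan A) {a a' : I → ℕ}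
    (ha : IsLabels A a) (ha' : IsLabels A.transpose a') {ħ : ℂ}
    (hq : ∀ m : ℕ, 0 < m → Complex.exp ħ ^ m ≠ 1) :
    IsQFamily A (qi ħ a a') fun i => (a' i : ℚ) / a i where
  pos i := div_pos (by exact_mod_cast ha'.pos i) (by exact_mod_cast ha.pos i)
  symm := labels_symmetrize hA ha ha'
  pow i j m n := by
    rw [← Units.val_zpow_eq_zpow_val, ← Units.val_zpow_eq_zpow_val, ← Units.val_mul,
      Units.val_eq_one, qi, qi, qpow_zpow, qpow_zpow, ← qpow_add, qpow_eq_one_iff hq]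

end labels

/-! ### Diagrams with two nodes -/

section edges

variable {I : Type*}

open AddMonoidAlgebra

variable {A : Matrix I I ℤ} {Q : I → ℂˣ} {d : I → ℚ} {i j : I} {f : I → Laurent I}
  {F : Laurent I} {v w : I → ℤ} {c c' : ℂ}

theorem IsQFamily.eq_of_eq (hQ : IsQFamily A Q d) (h : A i j = A j i) (h0 : A i j ≠ 0) :
    Q i = Q j := by
  have hd : d i = d j :=
    mul_right_cancel₀ (Int.cast_ne_zero.2 h0) ((hQ.symm i j).trans (by rw [h]))
  have hpow := (hQ.pow i j 1 (-1)).2 (by rw [hd]; push_cast; ring)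
  rw [zpow_one, zpow_neg_one] at hpow
  exact Units.ext (eq_of_mul_inv_eq_one hpow)

theorem fourTerm_neg (v : I → ℤ) (c : ℂ) :
    fourTerm A Q i (-v) c = fourTerm A Q i v ((Q i : ℂ) ^ 2 * c⁻¹) := by
  have hq := (Q i).ne_zero
  rw [fourTerm, fourTerm, neg_neg, add_comm (single (-v) _)]
  congr 3 <;> field_simp

theorem fourTerm_left_injective (hA : IsGCM A) (hvi : v i = 0) (hv : v ≠ 0) (hc : c ≠ 0)
    (h : fourTerm A Q i v c = fourTerm A Q i w c') : v = w ∨ v = -w := by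
  by_contra! hvw
  have hcoeff := coeff_fourTerm (Q := Q) hA hvi hv c
  rw [h, fourTerm, coeff_add, Finsupp.add_apply, coeff_twoTerm_of_apply_eq_zero hA hvi] at hcoeff
  simp [Finsupp.single_eq_of_ne' hvw.1.symm, Finsupp.single_eq_of_ne' hvw.2.symm, hc] at hcoeff

theorem fourTerm_right_injective (hA : IsGCM A) (hvi : v i = 0) (hv : v ≠ 0)
    (h : fourTerm A Q i v c = fourTerm A Q i v c') : c = c' := by
  have hcoeff := coeff_fourTerm (Q := Q) hA hvi hv c
  rw [h, coeff_fourTerm hA hvi hv] at hcoeff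
  exact (mul_left_cancel₀ (inv_ne_zero (Q i).ne_zero) hcoeff).symm

theorem twoTerm_mem_xGrading (h : A j i = 0) : twoTerm A Q i ∈ xGrading j 0 :=
  single_add_single_neg_mem (v := A.col i) h _ _

theorem fourTerm_mem_xGrading (h : A j i = 0) (hv : v j = 0) (c : ℂ) :
    fourTerm A Q i v c ∈ xGrading j 0 :=
  add_mem (twoTerm_mem_xGrading h) (single_add_single_neg_mem hv _ _)

theorem IsNormalSolution.simple_edge [DecidableEq I] (hA : IsGCM A) (hQ : IsQFamily A Q d)
    (hf : IsNormalSolution A Q f) (hne : i ≠ j) (hij : A i j = -1) (hji : A j i = -1) :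
    ∃ c, c ≠ 0 ∧
      f i = fourTerm A Q i (A.col i - 2 • Pi.single i 1 + 2 • Pi.single j 1) c ∧
      f j = fourTerm A Q j (2 • Pi.single j 1 - 2 • Pi.single i 1 - A.col j) c := by
  obtain ⟨v, c, hE, hfi, hvk, hj⟩ := hf.exists_isEdgeMonomial hA hQ hne hij
  obtain ⟨hvj, hfj⟩ : v j = 1 ∧ f j = fourTerm A Q j (v - A.col i - A.col j) c := by
    rcases hj with ⟨hvj, hfj⟩ | ⟨hv, -⟩
    · exact ⟨by lia, hfj⟩
    · have hvj : v j + 1 = 4 := by simpa [hji, hA.diag] using congrFun hv j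
      rcases hE.target with h | ⟨h, -⟩
      · lia
      · simp [h] at hvj
  have hv : v = A.col i - 2 • Pi.single i 1 + 2 • Pi.single j 1 := by
    funext k
    rcases eq_or_ne k i with rfl | hki
    · simp [hE.self, hA.diag, hne]
    · rcases eq_or_ne k j with rfl | hkj
      · simp [hvj, hji, hki]
      · simp [hvk k hki hkj, hki, hkj]
  refine ⟨c, hE.ne_zero, hv ▸ hfi, ?_⟩
  rw [hfj, hv]
  congr 1
  abel

theorem IsNormal.apply_eq_of_shiftable (hA : IsGCM A) (hQ : IsQFamily A Q d) (hij : A i j = -2)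
    {f : Laurent I} (hf : IsNormal A Q i f) (h : Shiftable Q i j f F) (hw : F.coeff w ≠ 0) :
    w i = 0 ∨ w i = 2 ∨ w i = -2 := by
  have hzero : ∀ n : ℤ, 2 < |n| → xComponent i n F = 0 := fun n hn =>
    hf.xComponent_eq_zero hA hQ h (by rwa [hij])
  have htop : xComponent i 1 F = 0 := by_contra fun h1 => by
    have := hf.eq_of_xComponent_top hA hQ h h1 (hzero _ (by norm_num)) (hzero _ (by norm_num))
    lia
  have hbot : xComponent i (-1) F = 0 := by_contra fun h1 => by
    have := hf.eq_of_xComponent_bot hA hQ h h1 (hzero _ (by norm_num)) (hzero _ (by norm_num))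
    lia
  have hle := abs_le.1 (hf.abs_apply_le hA hQ h hw)
  have hne_one := xComponent_eq_zero_iff.1 htop w hw
  have hne_neg_one := xComponent_eq_zero_iff.1 hbot w hw
  lia

end edges

section rankTwo

variable {I : Type*}

open AddMonoidAlgebra

variable {A : Matrix I I ℤ} {Q : I → ℂˣ} {d : I → ℚ} {i j : I} {f : I → Laurent I}

theorem xComponent_single (i : I) (n : ℤ) (v : I → ℤ) (r : ℂ) :
    xComponent i n (single v r) = if v i = n then single v r else 0 := by
  ext w
  rw [coeff_xComponent]
  rcases eq_or_ne v w with rfl | hvw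
  · split_ifs <;> simp
  · split_ifs <;> simp [hvw]

theorem eq_single_add_single_zero_add_single_neg {g : Laurent I} {t : I → ℤ} (ht : t ≠ 0)
    (hg : ∀ w, g.coeff w ≠ 0 → w = t ∨ w = 0 ∨ w = -t) :
    g = single t (g.coeff t) + single 0 (g.coeff 0) + single (-t) (g.coeff (-t)) := by
  have htt : t ≠ -t := self_ne_neg.2 ht
  have htt' : -t ≠ t := htt.symm
  ext w
  simp only [coeff_add, coeff_single, Finsupp.add_apply]
  by_cases hw : w = t ∨ w = 0 ∨ w = -t
  · rcases hw with rfl | rfl | rfl <;> simp [ht, ht.symm, htt, htt']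
  · have h0 : g.coeff w = 0 := not_not.1 (mt (hg w) hw)
    push Not at hw
    simp [h0, hw.1.symm, hw.2.1.symm, hw.2.2.symm]

theorem eq_zero_and_eq_of_mul_eq {s t : I → ℤ} (ht : t ≠ 0) {p a b γ γ' : ℂ} (hp : p ≠ 0)
    (hp2 : p ^ 2 ≠ 1) (hp4 : p ^ 4 ≠ 1)
    (h : single (s - t) ((p - p⁻¹) * γ') =
      (single t (a * (p ^ 4 - 1)) + single 0 (γ * (p ^ 2 - 1))) *
        (single (s - t) p⁻¹ + single s b : Laurent I)) : a = 0 ∧ γ' = γ := by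
  have hts : t + s ≠ s := fun h => ht (add_eq_right.1 h)
  have hst : s - t ≠ s := fun h => ht (sub_eq_self.1 h)
  have htst : s - t ≠ t + s := fun h => self_ne_neg.2 ht <| by
    rw [sub_eq_add_neg, add_comm t, add_left_cancel_iff] at h
    exact h.symm
  have hcoeff := fun w => congrArg (fun F : Laurent I => F.coeff w) h
  simp only [add_mul, mul_add, single_mul_single, coeff_add, coeff_single, Finsupp.add_apply,
    zero_add, add_sub_cancel] at hcoeff
  have htop : a * (p ^ 4 - 1) * b = 0 := by
    simpa [hts, hts.symm, htst, htst.symm] using (hcoeff (t + s)).symm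
  have hmid : a * (p ^ 4 - 1) * p⁻¹ + γ * (p ^ 2 - 1) * b = 0 := by
    simpa [hts, hts.symm, hst, hst.symm] using (hcoeff s).symm
  have hbot : (p - p⁻¹) * γ' = γ * (p ^ 2 - 1) * p⁻¹ := by
    simpa [hst, hst.symm, htst, htst.symm] using hcoeff (s - t)
  refine ⟨?_, mul_left_cancel₀ (mul_ne_zero (sub_ne_zero.2 hp2) (inv_ne_zero hp)) ?_⟩
  · by_contra ha
    have hap : a * (p ^ 4 - 1) ≠ 0 := mul_ne_zero ha (sub_ne_zero.2 hp4)
    rw [(mul_eq_zero.1 htop).resolve_left hap, mul_zero, add_zero] at hmid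
    exact mul_ne_zero hap (inv_ne_zero hp) hmid
  · rw [← sub_eq_zero] at hbot ⊢
    rw [← hbot]
    field_simp

theorem IsNormalSolution.exists_eq_of_rankTwo [DecidableEq I] (hA : IsGCM A) (hQ : IsQFamily A Q d)
    (hf : IsNormalSolution A Q f) (hne : i ≠ j) (hji : A j i = -2)
    (hI : ∀ k, k = i ∨ k = j) :
    ∃ a γ a', f i = twoTerm A Q i + (single (2 • Pi.single j 1) a + single 0 γ +
      single (-(2 • Pi.single j 1)) a') := by
  obtain ⟨g, hg, hfi⟩ := hf.normal i
  refine ⟨_, _, _, hfi.trans (congrArg _ (eq_single_add_single_zero_add_single_neg ?_ ?_))⟩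
  · exact fun h => by simpa using congrFun h j
  · intro w hw
    have hwi : w i = 0 := mem_xGrading.1 hg w hw
    have hwj := (hf.normal j).apply_eq_of_shiftable hA hQ hji (hf.shift j i hne.symm) (w := w) (by
      rwa [hfi, coeff_add, Finsupp.add_apply, coeff_twoTerm_of_apply_eq_zero hA hwi, zero_add])
    have heq : ∀ v : I → ℤ, v i = 0 → w j = v j → w = v := fun v hvi hvj => funext fun k => by
      rcases hI k with rfl | rfl
      · rw [hwi, hvi]
      · exact hvj
    rcases hwj with h | h | h
    · exact Or.inr (Or.inl (heq _ rfl h))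
    · exact Or.inl (heq _ (by simp [hne]) (by simp [h]))
    · exact Or.inr (Or.inr (heq _ (by simp [hne]) (by simp [h])))

/-- The components of degree `2` and `-2` in `x_i` of the shift equation are two instances of
`eq_zero_and_eq_of_mul_eq`, for `q_i` and for `q_i⁻¹`. -/
theorem eq_of_shiftable_rankTwo (hA : IsGCM A) (hQ : IsQFamily A Q d) {s t : I → ℤ}
    (hsi : s i = 2) (hsj : s j = 0) (hti : t i = 0) (htj : t j = 2) (hi : A.col i = s - t)
    (hj : A.col j = t - s) {a γ a' b γ' b' : ℂ}
    (h : Shiftable Q i j (twoTerm A Q i + (single t a + single 0 γ + single (-t) a'))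
      (twoTerm A Q j + (single s b + single 0 γ' + single (-s) b'))) :
    a = 0 ∧ a' = 0 ∧ γ' = γ := by
  have hij : A i j = -2 := by simpa [hsi, hti] using congrFun hj i
  have hji : A j i = -2 := by simpa [hsj, htj] using congrFun hi j
  have hQj : Q j = Q i := hQ.eq_of_eq (hji.trans hij.symm) (by simp [hji])
  have ht : t ≠ 0 := fun h => by simp [h] at htj
  have hq2 : (Q i : ℂ) ^ 2 ≠ 1 := mt (hQ.zpow_eq_one i 2).1 two_ne_zero
  have hq4 : (Q i : ℂ) ^ 4 ≠ 1 := mt (hQ.zpow_eq_one i 4).1 four_ne_zero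
  have hg : single t a + single 0 γ + single (-t) a' ∈ xGrading i 0 :=
    add_mem (add_mem (single_mem_xGrading hti _) (single_mem_xGrading rfl _))
      (single_mem_xGrading (by simp [hti]) _)
  have hcomp := xComponent_eq_of_shiftable hA hQ hg h
  rw [twoTerm, hj, hQj] at hcomp
  have htop := hcomp 2
  have hbot := hcomp (-2)
  simp only [hi, hij, neg_sub, map_add, xComponent_single, zeta_symm_single, Pi.sub_apply,
    Pi.neg_apply, Pi.zero_apply, hsi, hti, htj, hQj] at htop hbot
  norm_num [single_mul_single] at htop hbot
  have hq := (Q i).ne_zero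
  generalize (Q i : ℂ) = q at *
  obtain ⟨ha, hγ⟩ := eq_zero_and_eq_of_mul_eq (s := s) (γ := γ) (γ' := γ') (a := a) (b := b)
    ht hq hq2 hq4 <| by
      convert htop using 2
      · field_simp
      · rw [add_sub_add_comm, ← single_sub, ← single_sub]
        congr 2 <;> ring
  obtain ⟨ha', -⟩ := eq_zero_and_eq_of_mul_eq (s := -s) (t := -t) (p := q⁻¹) (γ := γ) (γ' := γ')
    (a := a') (b := b') (neg_ne_zero.2 ht) (inv_ne_zero hq) (by simpa using hq2)
    (by simpa using hq4) <| by
      convert hbot using 2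
      · rw [neg_sub_neg]
      · field_simp
      · rw [add_sub_add_comm, add_sub_add_comm, sub_self, zero_add, ← single_sub, ← single_sub,
          add_comm]
        congr 2 <;> field_simp
      · rw [neg_sub_neg, inv_inv]
  exact ⟨ha, ha', hγ⟩

theorem IsNormalSolution.exists_eq_twoTerm_add_single (hA : IsGCM A) (hQ : IsQFamily A Q d)
    (hf : IsNormalSolution A Q f) (hne : i ≠ j) (hij : A i j = -2) (hji : A j i = -2)
    (hI : ∀ k, k = i ∨ k = j) :
    ∃ γ, f i = twoTerm A Q i + single 0 γ ∧ f j = twoTerm A Q j + single 0 γ := by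
  classical
  obtain ⟨a, γ, a', hfi⟩ := hf.exists_eq_of_rankTwo hA hQ hne hji hI
  obtain ⟨b, γ', b', hfj⟩ := hf.exists_eq_of_rankTwo hA hQ hne.symm hij fun k => (hI k).symm
  have hi : A.col i = 2 • Pi.single i 1 - 2 • Pi.single j 1 := funext fun k => by
    rcases hI k with rfl | rfl <;> simp [hA.diag, hji, hne, hne.symm]
  have hj : A.col j = 2 • Pi.single j 1 - 2 • Pi.single i 1 := funext fun k => by
    rcases hI k with rfl | rfl <;> simp [hA.diag, hij, hne, hne.symm]
  obtain ⟨rfl, rfl, rfl⟩ := eq_of_shiftable_rankTwo hA hQ (by simp) (by simp [hne.symm])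
    (by simp [hne]) (by simp) hi hj (hfi ▸ hfj ▸ hf.shift i j hne)
  obtain ⟨rfl, rfl, -⟩ := eq_of_shiftable_rankTwo hA hQ (by simp) (by simp [hne])
    (by simp [hne.symm]) (by simp) hj hi (hfj ▸ hfi ▸ hf.shift j i hne.symm)
  simp only [single_zero, zero_add, add_zero] at hfi hfj
  exact ⟨_, hfi, hfj⟩

end rankTwo

/-! ### Type `A_n^{(1)}` -/

section cyclic

variable {I : Type*}

open AddMonoidAlgebra

variable {A : Matrix I I ℤ} {Q : I → ℂˣ} {d : I → ℚ} {i j : I} {f : I → Laurent I}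

theorem fourTerm_zero (c : ℂ) : fourTerm A Q i 0 c =
    twoTerm A Q i + single 0 ((Q i : ℂ)⁻¹ * c + (Q i : ℂ) * c⁻¹) := by
  rw [fourTerm, neg_zero, single_add]

theorem exists_inv_mul_add_mul_inv_eq {q : ℂ} (hq : q ≠ 0) (γ : ℂ) :
    ∃ c, c ≠ 0 ∧ q⁻¹ * c + q * c⁻¹ = γ := by
  obtain ⟨s, hs⟩ := IsAlgClosed.exists_pow_nat_eq (γ ^ 2 - 4) two_pos
  have hγs : γ + s ≠ 0 := fun h => by
    rw [eq_neg_of_add_eq_zero_right h] at hs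
    have h4 : (4 : ℂ) = 0 := by linear_combination hs
    norm_num at h4
  refine ⟨q * ((γ + s) / 2), by simp [hq, hγs], ?_⟩
  field_simp
  linear_combination hs

theorem zeta_symm_fourTerm_zero (hA : IsGCM A) (hcol : A.col j = -A.col i) (hQ : Q i = Q j)
    (c : ℂ) : (zeta Q j).symm (fourTerm A Q i 0 c) = fourTerm A Q j 0 c := by
  have hq := (Q j).ne_zero
  have hji : A j i = -2 := by
    simpa [hA.diag, neg_eq_iff_eq_neg, eq_comm] using congrFun hcol j
  rw [fourTerm_zero, fourTerm_zero, twoTerm, twoTerm, map_add, map_add, zeta_symm_single,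
    zeta_symm_single, zeta_symm_single, hcol, neg_neg, hQ, Matrix.col_apply, Pi.neg_apply,
    Matrix.col_apply, hji, add_comm (single (A.col i) _), Pi.zero_apply, zpow_zero, one_mul]
  congr 3 <;> norm_num <;> field_simp

theorem isNormalSolution_iff_of_forall_eq_or (hne : i ≠ j) (hI : ∀ k, k = i ∨ k = j) :
    IsNormalSolution A Q f ↔
      IsNormal A Q i (f i) ∧ IsNormal A Q j (f j) ∧ Shiftable Q i j (f i) (f j) := by
  refine ⟨fun hf => ⟨hf.normal i, hf.normal j, hf.shift i j hne⟩, fun ⟨hi, hj, hs⟩ =>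
    ⟨fun k => ?_, fun k l hkl => ?_⟩⟩
  · rcases hI k with rfl | rfl
    exacts [hi, hj]
  · rcases hI k with rfl | rfl <;> rcases hI l with rfl | rfl
    exacts [absurd rfl hkl, hs, shiftable_comm.1 hs, absurd rfl hkl]

theorem isNormalSolution_iff_of_rankTwo (hA : IsGCM A) (hQ : IsQFamily A Q d) (hne : i ≠ j)
    (hij : A i j = -2) (hji : A j i = -2) (hI : ∀ k, k = i ∨ k = j) :
    IsNormalSolution A Q f ↔
      ∃ c, c ≠ 0 ∧ f i = fourTerm A Q i 0 c ∧ f j = fourTerm A Q j 0 c := by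
  have hQij : Q i = Q j := hQ.eq_of_eq (hij.trans hji.symm) (by simp [hij])
  constructor
  · intro hf
    obtain ⟨γ, hfi, hfj⟩ := hf.exists_eq_twoTerm_add_single hA hQ hne hij hji hI
    obtain ⟨c, hc, rfl⟩ := exists_inv_mul_add_mul_inv_eq (Q i).ne_zero γ
    exact ⟨c, hc, by rw [hfi, fourTerm_zero], by rw [hfj, fourTerm_zero, hQij]⟩
  · rintro ⟨c, -, hfi, hfj⟩
    have hcol : A.col j = -A.col i := funext fun k => by
      rcases hI k with rfl | rfl <;> simp [hij, hji, hA.diag]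
    rw [isNormalSolution_iff_of_forall_eq_or hne hI, hfi, hfj]
    refine ⟨isNormal_fourTerm (Pi.zero_apply _) c, isNormal_fourTerm (Pi.zero_apply _) c, ?_⟩
    rw [Shiftable, zeta_symm_fourTerm_zero hA hcol hQij,
      zeta_symm_fourTerm_zero hA (by rw [hcol, neg_neg]) hQij.symm, mul_comm]

theorem apply_eq_apply_zero {α : Type*} {n : ℕ} {g : Fin (n + 1) → α}
    (h : ∀ i, g i = g (i + 1)) (i : Fin (n + 1)) : g i = g 0 := by
  induction i using Fin.induction with
  | zero => rfl
  | succ k ih => rw [← ih, h k.castSucc, Fin.coeSucc_eq_succ]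

theorem fin_ne_add_one {n : ℕ} (hn : 1 ≤ n) (i : Fin (n + 1)) : i ≠ i + 1 := by
  obtain ⟨n, rfl⟩ := Nat.exists_eq_add_of_le' hn
  exact (add_ne_left.2 one_ne_zero).symm

theorem fin_ne_add_two {n : ℕ} (hn : 2 ≤ n) (i : Fin (n + 1)) : i ≠ i + 1 + 1 := by
  obtain ⟨n, rfl⟩ := Nat.exists_eq_add_of_le' hn
  rw [add_assoc i 1 1]
  exact (add_ne_left.2 (by simp [Fin.ext_iff, Fin.val_add, Nat.mod_eq_of_lt])).symm

variable {n : ℕ} {e : Fin (n + 1) ≃ I}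

theorem cartanA_apply_succ_eq (hn : 1 ≤ n) (i : Fin (n + 1)) :
    cartanA n i (i + 1) = cartanA n (i + 1) i := by
  have h := fin_ne_add_one hn i
  simp [cartanA, h, h.symm, sub_sub, add_comm]

theorem cartanA_apply_succ_ne_zero (hn : 1 ≤ n) (i : Fin (n + 1)) : cartanA n i (i + 1) ≠ 0 := by
  have h := fin_ne_add_one hn i
  simp only [cartanA, Matrix.of_apply, h, if_false, if_true]
  split_ifs <;> norm_num

theorem IsQFamily.eq_of_cartanA (hn : 1 ≤ n) (hQ : IsQFamily A Q d)
    (he : IsNumbering A (cartanA n) e) (i : Fin (n + 1)) : Q (e i) = Q (e 0) :=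
  apply_eq_apply_zero (g := fun i => Q (e i)) (fun i => hQ.eq_of_eq
    (by rw [he, he, cartanA_apply_succ_eq hn])
    (by rw [he]; exact cartanA_apply_succ_ne_zero hn i)) i

variable [DecidableEq I]

theorem col_cartanA (he : IsNumbering A (cartanA n) e) (i : Fin (n + 1)) : A.col (e i) =
    2 • Pi.single (e i) 1 - Pi.single (e (i - 1)) 1 - Pi.single (e (i + 1)) 1 := by
  funext k
  obtain ⟨m, rfl⟩ := e.surjective k
  simp only [Matrix.col_apply, he m i, cartanA, Matrix.of_apply, Pi.sub_apply, Pi.smul_apply,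
    Pi.single_apply, e.injective.eq_iff, eq_sub_iff_add_eq, eq_comm (a := m + 1)]
  split_ifs <;> simp

theorem cartanA_apply_succ (hn : 2 ≤ n) (i : Fin (n + 1)) :
    cartanA n i (i + 1) = -1 ∧ cartanA n (i + 1) i = -1 := by
  have h1 := fin_ne_add_one (by lia) i
  have h2 := fin_ne_add_two hn i
  simp [cartanA, h1, h1.symm, h2]

theorem cartanA_apply_of_ne {i j : Fin (n + 1)} (hij : i ≠ j) (h : j ≠ i + 1) (h' : i ≠ j + 1) :
    cartanA n i j = 0 := by
  simp [cartanA, hij, h, h']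

/-- The exponent vector of `z_i z_{i+1}` in type `A_n^{(1)}`. -/
def cycVec (e : Fin (n + 1) ≃ I) (i : Fin (n + 1)) : I → ℤ :=
  Pi.single (e (i + 1)) 1 - Pi.single (e (i - 1)) 1

theorem cycVec_apply_of_ne {i j : Fin (n + 1)} (h : j ≠ i + 1) (h' : i ≠ j + 1) :
    cycVec e i (e j) = 0 := by
  rw [cycVec, Pi.sub_apply, Pi.single_eq_of_ne (e.injective.ne h),
    Pi.single_eq_of_ne (e.injective.ne fun h => h' (by rw [h, sub_add_cancel])), sub_zero]

theorem cycVec_apply_self (hn : 1 ≤ n) (i : Fin (n + 1)) : cycVec e i (e i) = 0 :=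
  cycVec_apply_of_ne (fin_ne_add_one hn i) (fin_ne_add_one hn i)

theorem cycVec_apply_succ (hn : 2 ≤ n) (i : Fin (n + 1)) : cycVec e i (e (i + 1)) = 1 := by
  have h := fin_ne_add_two hn (i - 1)
  rw [sub_add_cancel] at h
  rw [cycVec, Pi.sub_apply, Pi.single_eq_same, Pi.single_eq_of_ne (e.injective.ne h.symm),
    sub_zero]

theorem cycVec_ne_zero (hn : 2 ≤ n) (i : Fin (n + 1)) : cycVec e i ≠ 0 := fun h => by
  simpa [h] using cycVec_apply_succ (e := e) hn i

theorem cycVec_sub_col_sub_col (he : IsNumbering A (cartanA n) e) (i : Fin (n + 1)) :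
    cycVec e i - A.col (e i) - A.col (e (i + 1)) = cycVec e (i + 1) := by
  rw [col_cartanA he, col_cartanA he, cycVec, cycVec, add_sub_cancel_right]
  abel

theorem IsNormalSolution.exists_eq_fourTerm_cycVec (hn : 2 ≤ n) (hA : IsGCM A)
    (hQ : IsQFamily A Q d) (he : IsNumbering A (cartanA n) e) (hf : IsNormalSolution A Q f) :
    ∃ c, c ≠ 0 ∧ ∀ i, f (e i) = fourTerm A Q (e i) (cycVec e i) c := by
  have hedge : ∀ i, ∃ c, c ≠ 0 ∧ f (e i) = fourTerm A Q (e i) (cycVec e i) c ∧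
      f (e (i + 1)) = fourTerm A Q (e (i + 1)) (cycVec e (i + 1)) c := fun i => by
    obtain ⟨c, hc, hi, hi'⟩ := hf.simple_edge hA hQ
      (e.injective.ne (fin_ne_add_one (by lia) i)) (by rw [he, (cartanA_apply_succ hn i).1])
      (by rw [he, (cartanA_apply_succ hn i).2])
    refine ⟨c, hc, hi.trans ?_, hi'.trans ?_⟩ <;> rw [col_cartanA he, cycVec] <;> congr 1
    · abel
    · rw [add_sub_cancel_right]
      abel
  choose c hc hi hi' using hedge
  have hcs : ∀ i, c i = c (i + 1) := fun i =>
    fourTerm_right_injective hA (cycVec_apply_self (by lia) _) (cycVec_ne_zero hn _)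
      ((hi' i).symm.trans (hi (i + 1)))
  exact ⟨c 0, hc 0, fun i => by rw [hi, apply_eq_apply_zero hcs]⟩

theorem isNormalSolution_of_eq_fourTerm_cycVec (hn : 2 ≤ n) (hA : IsGCM A)
    (hQ : IsQFamily A Q d) (he : IsNumbering A (cartanA n) e) {c : ℂ} (hc : c ≠ 0)
    (hf : ∀ i, f (e i) = fourTerm A Q (e i) (cycVec e i) c) : IsNormalSolution A Q f := by
  have hs : ∀ i, Shiftable Q (e i) (e (i + 1)) (f (e i)) (f (e (i + 1))) := fun i => by
    rw [hf, hf, ← cycVec_sub_col_sub_col he]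
    refine shiftable_fourTerm hA hQ (by rw [he, (cartanA_apply_succ hn i).1])
      ⟨hc, cycVec_apply_self (by lia) i, Or.inl ?_⟩
    rw [cycVec_apply_succ hn, he, (cartanA_apply_succ hn i).2, neg_neg]
  refine ⟨e.forall_congr_right.1 fun i => ?_,
    e.forall_congr_right.1 fun i => e.forall_congr_right.1 fun j hij => ?_⟩
  · exact hf i ▸ isNormal_fourTerm (cycVec_apply_self (by lia) i) c
  · by_cases hj : j = i + 1
    · exact hj ▸ hs i
    by_cases hi : i = j + 1
    · exact hi ▸ shiftable_comm.1 (hs j)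
    have hAij : A (e i) (e j) = 0 :=
      (he i j).trans (cartanA_apply_of_ne (ne_of_apply_ne e hij) hj hi)
    rw [hf, hf]
    exact shiftable_of_mem_xGrading_zero
      (fourTerm_mem_xGrading (hA.zero _ _ hAij) (cycVec_apply_of_ne hj hi) c)
      (fourTerm_mem_xGrading hAij (cycVec_apply_of_ne hi hj) c)

theorem isNormalSolution_iff_of_cartanA (hn : 1 ≤ n) (hA : IsGCM A) (hQ : IsQFamily A Q d)
    (he : IsNumbering A (cartanA n) e) :
    IsNormalSolution A Q f ↔
      ∃ c, c ≠ 0 ∧ ∀ i, f (e i) = fourTerm A Q (e i) (cycVec e i) c := by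
  rcases hn.eq_or_lt with rfl | hn2
  · have hI : ∀ k, k = e 0 ∨ k = e 1 := e.forall_congr_right.1 fun k => by
      rw [e.apply_eq_iff_eq, e.apply_eq_iff_eq]
      exact (Fin.forall_fin_two (p := fun k => k = 0 ∨ k = 1)).2 (by simp) k
    have hcyc : ∀ i, cycVec e i = 0 := fun i =>
      sub_eq_zero.2 (by rw [show i + 1 = i - 1 by revert i; decide])
    rw [isNormalSolution_iff_of_rankTwo hA hQ (e.injective.ne (zero_ne_one (α := Fin 2)))
      (he 0 1) (he 1 0) hI]
    simp only [hcyc]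
    exact exists_congr fun c => and_congr_right fun _ => (Fin.forall_fin_two
      (p := fun i => f (e i) = fourTerm A Q (e i) 0 c)).symm
  · exact ⟨fun hf => hf.exists_eq_fourTerm_cycVec hn2 hA hQ he,
      fun ⟨_, hc, hf⟩ => isNormalSolution_of_eq_fourTerm_cycVec hn2 hA hQ he hc hf⟩

theorem zA_eq_mono (e : Fin (n + 1) ≃ I) (i : Fin (n + 1)) :
    zA e i = mono (Pi.single (e i) 1 - Pi.single (e (i - 1)) 1) := by
  rw [zA, x, x, ← mono_neg, ← mono_add, neg_add_eq_sub]

theorem scaleFactor_smul_solA (hQ : IsQFamily A Q d) (he : IsNumbering A (cartanA n) e) (b : ℂˣ)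
    (i : Fin (n + 1)) : scaleFactor Q (e i) • solA Q e b i =
      fourTerm A Q (e i) (cycVec e i) (-((Q (e i) : ℂ) ^ 2 * (b : ℂ) ^ 2)) := by
  rw [solA, zA_eq_mono, zA_eq_mono, add_sub_cancel_right,
    hQ.scaleFactor_smul_brace_mul_brace ?_ rfl, cycVec, add_comm (Pi.single (e i) 1 - _),
    sub_add_sub_cancel]
  rw [col_cartanA he]
  abel

theorem isSolution_iff_of_cartanA [Fintype I] (hn : 1 ≤ n) (hA : IsGCM A) (hQ : IsQFamily A Q d)
    (he : IsNumbering A (cartanA n) e) (φ : I → Laurent I) :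
    IsSolution A Q φ ↔ ∃ b : ℂˣ, ∀ i, φ (e i) = solA Q e b i := by
  have hQe := hQ.eq_of_cartanA hn he
  have hq := (Q (e 0)).ne_zero
  rw [isSolution_iff hA hQ, isNormalSolution_iff_of_cartanA hn hA hQ he]
  constructor
  · rintro ⟨c, hc, hφ⟩
    obtain ⟨b, hb⟩ := IsAlgClosed.exists_pow_nat_eq (-c / (Q (e 0) : ℂ) ^ 2) two_pos
    have hb0 : b ≠ 0 := by
      rintro rfl
      rw [zero_pow two_ne_zero, eq_comm, div_eq_zero_iff, neg_eq_zero] at hb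
      exact hb.elim hc (pow_ne_zero _ hq)
    refine ⟨Units.mk0 b hb0, fun i => ?_⟩
    rw [← hQ.scaleFactor_smul_eq_iff (scaleFactor_smul_solA hQ he _ i), hφ i, hQe,
      Units.val_mk0, hb]
    congr 1
    field_simp
  · rintro ⟨b, hb⟩
    exact ⟨-((Q (e 0) : ℂ) ^ 2 * (b : ℂ) ^ 2), by simp,
      fun i => by rw [hb, scaleFactor_smul_solA hQ he, hQe]⟩

end cyclic

/-! ### Paths with double edges at both ends -/

section doubleEnd

variable {I : Type*}

open AddMonoidAlgebra

variable {A : Matrix I I ℤ} {Q : I → ℂˣ} {d : I → ℚ} {i j k : I} {f : I → Laurent I} {c : ℂ}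

theorem ne_zero_of_sq_eq {u : ℂˣ} (hc : c ^ 2 = (u : ℂ) ^ 2) : c ≠ 0 := by
  rintro rfl
  exact pow_ne_zero 2 u.ne_zero (by rw [← hc, zero_pow two_ne_zero])

theorem fourTerm_neg_of_sq_eq (hc : c ^ 2 = (Q i : ℂ) ^ 2) (v : I → ℤ) :
    fourTerm A Q i (-v) c = fourTerm A Q i v c := by
  rw [fourTerm_neg, ← hc, sq, mul_inv_cancel_right₀ (ne_zero_of_sq_eq hc)]

theorem IsQFamily.eq_sq_of_eq (hQ : IsQFamily A Q d) (hij : A i j = -1) (hji : A j i = -2) :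
    (Q i : ℂ) = (Q j : ℂ) ^ 2 := by
  have h := hQ.zpow_eq j i
  rw [hij, hji, zpow_neg, zpow_neg, zpow_one, inv_inj] at h
  exact_mod_cast h

/-- The nodes `i` and `j` are joined by a double edge of the Dynkin diagram. -/
def IsDoubleEdge (A : Matrix I I ℤ) (i j : I) : Prop :=
  (A i j = -1 ∧ A j i = -2) ∨ (A i j = -2 ∧ A j i = -1)

/-- The node `i` is a leaf of the Dynkin diagram, joined by a double edge to the node `j`, whose
only other neighbour is `k`. -/
structure IsDoubleEnd (A : Matrix I I ℤ) (i j k : I) : Prop where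
  ne_ij : i ≠ j
  ne_ik : i ≠ k
  ne_jk : j ≠ k
  leaf : ∀ m, m ≠ i → m ≠ j → A m i = 0
  two : ∀ m, m ≠ i → m ≠ j → m ≠ k → A m j = 0
  next : A k j ≠ 0
  double : IsDoubleEdge A i j

/-- The normal form of a solution at a leaf `i` joined to the node `j` by a double edge. -/
def endTerm (A : Matrix I I ℤ) (Q : I → ℂˣ) (i j : I) (c : ℂ) : Laurent I :=
  if A i j = -2 then twoTerm A Q i else fourTerm A Q i 0 c

theorem endTerm_of_eq_neg_one (hij : A i j = -1) :
    endTerm A Q i j c = fourTerm A Q i 0 c :=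
  if_neg (by rw [hij]; norm_num)

theorem endTerm_of_eq_neg_two (hij : A i j = -2) : endTerm A Q i j c = twoTerm A Q i :=
  if_pos hij

theorem isNormal_endTerm (i j : I) (c : ℂ) : IsNormal A Q i (endTerm A Q i j c) := by
  rw [endTerm]
  split_ifs
  · exact isNormal_twoTerm
  · exact isNormal_fourTerm (Pi.zero_apply _) c

theorem endTerm_mem_xGrading (hk : A k i = 0) : endTerm A Q i j c ∈ xGrading k 0 := by
  rw [endTerm]
  split_ifs
  · exact twoTerm_mem_xGrading hk
  · exact fourTerm_mem_xGrading hk (Pi.zero_apply _) c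

variable [DecidableEq I]

theorem col_eq_of_forall_ne (hA : IsGCM A) (hij : i ≠ j) (hik : i ≠ k) (hjk : j ≠ k)
    (h : ∀ m, m ≠ i → m ≠ j → m ≠ k → A m j = 0) :
    A.col j = A i j • Pi.single i 1 + 2 • Pi.single j 1 + A k j • Pi.single k 1 := by
  funext m
  by_cases hi : m = i
  · subst hi
    simp [hij, hik]
  by_cases hj : m = j
  · subst hj
    simp [hi, hjk, hA.diag]
  by_cases hk : m = k
  · subst hk
    simp [hi, hj]
  · simp [hi, hj, hk, h m hi hj hk]

theorem IsDoubleEnd.col_leaf (hA : IsGCM A) (h : IsDoubleEnd A i j k) :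
    A.col i = 2 • Pi.single i 1 + A j i • Pi.single j 1 := by
  rw [col_eq_of_forall_ne hA h.ne_ij.symm h.ne_jk h.ne_ik fun m hj hi _ => h.leaf m hi hj,
    h.leaf k h.ne_ik.symm h.ne_jk.symm, zero_smul, add_zero, add_comm]

theorem IsDoubleEnd.col_next (hA : IsGCM A) (h : IsDoubleEnd A i j k) :
    A.col j = A i j • Pi.single i 1 + 2 • Pi.single j 1 + A k j • Pi.single k 1 :=
  col_eq_of_forall_ne hA h.ne_ij h.ne_ik h.ne_jk h.two

theorem IsDoubleEnd.exists_eq_fourTerm_of_neg_one (hA : IsGCM A) (hQ : IsQFamily A Q d)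
    (h : IsDoubleEnd A i j k) (hij : A i j = -1) (hji : A j i = -2)
    (hf : IsNormalSolution A Q f) :
    ∃ c, c ^ 2 = (Q j : ℂ) ^ 2 ∧ f i = fourTerm A Q i 0 c ∧
      f j = fourTerm A Q j (A i j • Pi.single i 1 - A k j • Pi.single k 1) c := by
  obtain ⟨v, c, hv, hfi, hvk, ⟨hvj, hfj⟩ | ⟨hcol, -⟩⟩ := hf.exists_isEdgeMonomial hA hQ h.ne_ij hij
  · obtain ⟨rfl, hc⟩ := hv.target.resolve_left (by lia)
    refine ⟨c, by rw [hc, hQ.eq_sq_of_eq hij hji], hfi, ?_⟩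
    rw [hfj, h.col_leaf hA, h.col_next hA, hij, hji]
    congr 1
    module
  · have hk := congrFun hcol k
    rw [Pi.sub_apply, hvk k h.ne_ik.symm h.ne_jk.symm, Matrix.col_apply, sub_self] at hk
    exact absurd ((smul_eq_zero.1 hk.symm).resolve_left two_ne_zero) h.next

theorem IsDoubleEnd.eq_twoTerm_of_neg_two (hA : IsGCM A) (hQ : IsQFamily A Q d)
    (h : IsDoubleEnd A i j k) (hij : A i j = -2) (hji : A j i = -1)
    (hf : IsNormalSolution A Q f) :
    f i = twoTerm A Q i ∧
      f j = fourTerm A Q j (A i j • Pi.single i 1 - A k j • Pi.single k 1) (Q j) := by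
  obtain ⟨v, c, hv, hfj, hvk, hfi⟩ := hf.exists_isEdgeMonomial hA hQ h.ne_ij.symm hji
  have hvi : v i = 2 := by
    refine (hv.target.resolve_right fun h0 => h.next ?_).trans (by rw [hij, neg_neg])
    rw [← hvk k h.ne_jk.symm h.ne_ik.symm, h0.1, Pi.zero_apply]
  obtain ⟨hcol, hc, hfi⟩ := hfi.resolve_left (by lia)
  have hv : v = -(A i j • Pi.single i 1 - A k j • Pi.single k 1) := by
    rw [sub_eq_iff_eq_add.1 hcol, h.col_leaf hA, h.col_next hA, hij, hji]
    module
  have hcj : c = Q j := by rw [hc, hQ.eq_sq_of_eq hji hij]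
  exact ⟨hfi, by rw [hfj, hv, hcj, fourTerm_neg_of_sq_eq rfl]⟩

theorem IsDoubleEnd.exists_eq_endTerm (hA : IsGCM A) (hQ : IsQFamily A Q d)
    (h : IsDoubleEnd A i j k) (hf : IsNormalSolution A Q f) :
    ∃ c, c ^ 2 = (Q j : ℂ) ^ 2 ∧ (A i j = -2 → c = Q j) ∧ f i = endTerm A Q i j c ∧
      f j = fourTerm A Q j (A i j • Pi.single i 1 - A k j • Pi.single k 1) c := by
  rcases h.double with ⟨hij, hji⟩ | ⟨hij, hji⟩
  · obtain ⟨c, hc, hfi, hfj⟩ := h.exists_eq_fourTerm_of_neg_one hA hQ hij hji hf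
    exact ⟨c, hc, fun h2 => by lia, by rw [hfi, endTerm_of_eq_neg_one hij], hfj⟩
  · obtain ⟨hfi, hfj⟩ := h.eq_twoTerm_of_neg_two hA hQ hij hji hf
    exact ⟨Q j, rfl, fun _ => rfl, by rw [hfi, endTerm_of_eq_neg_two hij], hfj⟩

theorem IsDoubleEnd.shiftable_endTerm (hA : IsGCM A) (hQ : IsQFamily A Q d)
    (h : IsDoubleEnd A i j k) (hc : c ^ 2 = (Q j : ℂ) ^ 2) (hc' : A i j = -2 → c = Q j) :
    Shiftable Q i j (endTerm A Q i j c)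
      (fourTerm A Q j (A i j • Pi.single i 1 - A k j • Pi.single k 1) c) := by
  have hc0 := ne_zero_of_sq_eq hc
  rcases h.double with ⟨hij, hji⟩ | ⟨hij, hji⟩
  · rw [endTerm_of_eq_neg_one hij]
    convert shiftable_fourTerm hA hQ hij ⟨hc0, Pi.zero_apply i,
      Or.inr ⟨rfl, by rw [hc, hQ.eq_sq_of_eq hij hji]⟩⟩ using 2
    rw [h.col_leaf hA, h.col_next hA, hij, hji]
    module
  · rw [endTerm_of_eq_neg_two hij, ← fourTerm_neg_of_sq_eq hc, shiftable_comm]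
    refine shiftable_twoTerm hA hQ hji ⟨hc0, ?_, Or.inl ?_⟩ ?_ ?_
    · simp [h.ne_ij.symm, h.ne_jk]
    · simp [h.ne_ik, hij]
    · rw [h.col_leaf hA, h.col_next hA, hij, hji]
      module
    · rw [hc' hij, hQ.eq_sq_of_eq hji hij]

end doubleEnd

section doublePath

variable {I : Type*}

open AddMonoidAlgebra

variable {A : Matrix I I ℤ} {Q : I → ℂˣ} {d : I → ℚ} {f : I → Laurent I} {c : ℂ}
  {n k m : ℕ} {N : ℕ → I}

/-- The Dynkin diagram of `A` is a path through the nodes `N 0, …, N n` whose interior edges are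
simple; nothing is said about the entries of `A` belonging to its two end edges. -/
structure IsPathDiagram (A : Matrix I I ℤ) (n : ℕ) (N : ℕ → I) : Prop where
  two_le : 2 ≤ n
  surj : ∀ i, ∃ k ≤ n, N k = i
  inj : ∀ k ≤ n, ∀ m ≤ n, N k = N m → k = m
  edge : ∀ k, 0 < k → k + 1 < n → A (N k) (N (k + 1)) = -1 ∧ A (N (k + 1)) (N k) = -1
  far : ∀ k m, k + 1 < m → m ≤ n → A (N k) (N m) = 0 ∧ A (N m) (N k) = 0

/-- The Dynkin diagram of `A` is a path through the nodes `N 0, …, N n` with simple interior edges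
and with double edges at both ends. -/
structure IsDoublePath (A : Matrix I I ℤ) (n : ℕ) (N : ℕ → I) : Prop extends
    IsPathDiagram A n N where
  left : IsDoubleEdge A (N 0) (N 1)
  right : IsDoubleEdge A (N n) (N (n - 1))

theorem IsPathDiagram.ne (h : IsPathDiagram A n N) (hk : k ≤ n) (hm : m ≤ n) (hkm : k ≠ m) :
    N k ≠ N m :=
  fun he => hkm (h.inj k hk m hm he)

theorem IsPathDiagram.apply_eq_zero (h : IsPathDiagram A n N) (hk : k ≤ n) (hm : m ≤ n)
    (hmk : m ≠ k) (h1 : m + 1 ≠ k) (h2 : m ≠ k + 1) : A (N m) (N k) = 0 := by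
  rcases hmk.lt_or_gt with hlt | hlt
  · exact (h.far m k (by lia) hk).1
  · exact (h.far k m (by lia) hm).2

theorem IsPathDiagram.reverse (h : IsPathDiagram A n N) :
    IsPathDiagram A n fun k => N (n - k) where
  two_le := h.two_le
  surj i := by
    obtain ⟨k, hk, rfl⟩ := h.surj i
    exact ⟨n - k, Nat.sub_le n k, by rw [Nat.sub_sub_self hk]⟩
  inj k hk m hm he := by
    have := h.inj _ (Nat.sub_le n k) _ (Nat.sub_le n m) he
    lia
  edge k hk hkn := by
    have he := h.edge (n - (k + 1)) (by lia) (by lia)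
    rw [show n - (k + 1) + 1 = n - k by lia] at he
    exact he.symm
  far k m hkm hm := (h.far (n - m) (n - k) (by lia) (by lia)).symm

theorem IsDoublePath.adj (h : IsDoublePath A n N) (hk : k < n) :
    A (N (k + 1)) (N k) ≠ 0 ∧ A (N k) (N (k + 1)) ≠ 0 := by
  rcases Nat.eq_zero_or_pos k with rfl | h0
  · rcases h.left with h1 | h1 <;> simp [h1]
  rcases (Nat.succ_le_of_lt hk).eq_or_lt with rfl | h1
  · rcases h.right with h1 | h1 <;> rw [Nat.succ_sub_one] at h1 <;> simp [h1]
  · simp [h.edge k h0 h1]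

theorem IsDoublePath.leftEnd (h : IsDoublePath A n N) : IsDoubleEnd A (N 0) (N 1) (N 2) := by
  have hn := h.two_le
  refine ⟨h.ne (by lia) (by lia) (by lia), h.ne (by lia) (by lia) (by lia),
    h.ne (by lia) (by lia) (by lia), fun m h0 h1 => ?_, fun m h0 h1 h2 => ?_,
    (h.adj (by lia)).1, h.left⟩
  · obtain ⟨k, hk, rfl⟩ := h.surj m
    have := ne_of_apply_ne N h0
    have := ne_of_apply_ne N h1
    exact (h.far 0 k (by lia) hk).2
  · obtain ⟨k, hk, rfl⟩ := h.surj m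
    have := ne_of_apply_ne N h0
    have := ne_of_apply_ne N h1
    have := ne_of_apply_ne N h2
    exact (h.far 1 k (by lia) hk).2

theorem IsDoublePath.reverse (h : IsDoublePath A n N) : IsDoublePath A n fun k => N (n - k) where
  toIsPathDiagram := h.toIsPathDiagram.reverse
  left := h.right
  right := by
    have hn := h.two_le
    rw [Nat.sub_self, Nat.sub_sub_self (by lia)]
    exact h.left

theorem IsDoublePath.rightEnd (h : IsDoublePath A n N) :
    IsDoubleEnd A (N n) (N (n - 1)) (N (n - 2)) :=
  h.reverse.leftEnd

theorem IsDoublePath.q_eq (h : IsDoublePath A n N) (hQ : IsQFamily A Q d) (hk : 0 < k)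
    (hkn : k < n) : Q (N k) = Q (N 1) := by
  induction k, hk using Nat.le_induction with
  | base => rfl
  | succ k hk ih =>
    have he := h.edge k hk hkn
    rw [← ih (by lia), hQ.eq_of_eq (he.2.trans he.1.symm) (by rw [he.2]; norm_num)]

variable [DecidableEq I]

/-- The exponent vector of `z_k z_{k+1}` for a path with double edges at both ends. -/
def pathVec (A : Matrix I I ℤ) (N : ℕ → I) (k : ℕ) : I → ℤ :=
  A (N (k - 1)) (N k) • Pi.single (N (k - 1)) 1 - A (N (k + 1)) (N k) • Pi.single (N (k + 1)) 1

theorem IsDoublePath.col_eq (hA : IsGCM A) (h : IsDoublePath A n N) (hk : 0 < k) (hkn : k < n) :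
    A.col (N k) = A (N (k - 1)) (N k) • Pi.single (N (k - 1)) 1 + 2 • Pi.single (N k) 1 +
      A (N (k + 1)) (N k) • Pi.single (N (k + 1)) 1 := by
  refine col_eq_of_forall_ne hA (h.ne (by lia) (by lia) (by lia))
    (h.ne (by lia) (by lia) (by lia)) (h.ne (by lia) (by lia) (by lia)) fun i h0 h1 h2 => ?_
  obtain ⟨m, hm, rfl⟩ := h.surj i
  have := ne_of_apply_ne N h0
  exact h.apply_eq_zero hkn.le hm (ne_of_apply_ne N h1) (by lia) (ne_of_apply_ne N h2)

theorem IsDoublePath.pathVec_apply_eq_zero (h : IsDoublePath A n N) (hkn : k < n)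
    (hm : m ≤ n) (h1 : m ≠ k - 1) (h2 : m ≠ k + 1) : pathVec A N k (N m) = 0 := by
  simp [pathVec, h.ne hm (by lia) h1, h.ne hm (by lia) h2]

theorem IsDoublePath.pathVec_apply_self (h : IsDoublePath A n N) (hk : 0 < k) (hkn : k < n) :
    pathVec A N k (N k) = 0 :=
  h.pathVec_apply_eq_zero hkn hkn.le (by lia) (by lia)

theorem IsDoublePath.pathVec_apply_succ (h : IsDoublePath A n N) (hkn : k < n) :
    pathVec A N k (N (k + 1)) = -A (N (k + 1)) (N k) := by
  simp [pathVec, h.ne (Nat.succ_le_of_lt hkn) (show k - 1 ≤ n by lia) (by lia)]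

theorem IsDoublePath.pathVec_ne_zero (h : IsDoublePath A n N) (hkn : k < n) :
    pathVec A N k ≠ 0 := fun h0 => (h.adj hkn).1 <| by
  rw [← neg_eq_zero, ← h.pathVec_apply_succ hkn, h0, Pi.zero_apply]

theorem IsDoublePath.pathVec_succ (hA : IsGCM A) (h : IsDoublePath A n N) (hk : 0 < k)
    (hkn : k + 1 < n) :
    pathVec A N (k + 1) = pathVec A N k - A.col (N k) - A.col (N (k + 1)) := by
  have he := h.edge k hk hkn
  rw [h.col_eq hA hk (by lia), h.col_eq hA (by lia) hkn, pathVec, pathVec, Nat.add_sub_cancel,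
    he.1, he.2]
  module

theorem IsDoublePath.neg_pathVec_pred (h : IsDoublePath A n N) :
    -pathVec A N (n - 1) = A (N n) (N (n - 1)) • (Pi.single (N n) 1 : I → ℤ) -
      A (N (n - 2)) (N (n - 1)) • Pi.single (N (n - 2)) 1 := by
  have hn := h.two_le
  rw [pathVec, Nat.sub_add_cancel (by lia), Nat.sub_sub, neg_sub]

/-- The conditions at the two ends of the path on the constant `c` of a normal solution. -/
structure IsPathParameter (A : Matrix I I ℤ) (Q : I → ℂˣ) (n : ℕ) (N : ℕ → I) (c : ℂ) :
    Prop where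
  sq_eq : c ^ 2 = (Q (N 1) : ℂ) ^ 2
  eq_of_left : A (N 0) (N 1) = -2 → c = Q (N 1)
  eq_of_right : A (N n) (N (n - 1)) = -2 → c = Q (N 1)

/-- The component at the node `N k` of the normal solution with constant `c`. -/
def pathTerm (A : Matrix I I ℤ) (Q : I → ℂˣ) (n : ℕ) (N : ℕ → I) (c : ℂ) (k : ℕ) : Laurent I :=
  if k = 0 then endTerm A Q (N 0) (N 1) c
  else if k = n then endTerm A Q (N n) (N (n - 1)) c
  else fourTerm A Q (N k) (pathVec A N k) c

theorem pathTerm_zero : pathTerm A Q n N c 0 = endTerm A Q (N 0) (N 1) c :=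
  if_pos rfl

theorem pathTerm_last (hn : n ≠ 0) :
    pathTerm A Q n N c n = endTerm A Q (N n) (N (n - 1)) c := by
  rw [pathTerm, if_neg hn, if_pos rfl]

theorem pathTerm_of_pos_of_lt (hk : 0 < k) (hkn : k < n) :
    pathTerm A Q n N c k = fourTerm A Q (N k) (pathVec A N k) c := by
  rw [pathTerm, if_neg hk.ne', if_neg hkn.ne]

theorem IsDoublePath.eq_fourTerm_succ (hA : IsGCM A) (hQ : IsQFamily A Q d)
    (h : IsDoublePath A n N) (hf : IsNormalSolution A Q f) (hk : 0 < k) (hkn : k + 1 < n)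
    (hfk : f (N k) = fourTerm A Q (N k) (pathVec A N k) c) :
    f (N (k + 1)) = fourTerm A Q (N (k + 1)) (pathVec A N (k + 1)) c := by
  have he := h.edge k hk hkn
  obtain ⟨c', -, h1, h2⟩ := hf.simple_edge hA hQ (h.ne (by lia) (by lia) (by lia)) he.1 he.2
  have hv : A.col (N k) - 2 • Pi.single (N k) 1 + 2 • Pi.single (N (k + 1)) 1 =
      pathVec A N k := by
    rw [h.col_eq hA hk (by lia), pathVec, he.2]
    module
  have hw : 2 • Pi.single (N (k + 1)) 1 - 2 • Pi.single (N k) 1 - A.col (N (k + 1)) =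
      pathVec A N (k + 1) := by
    rw [h.col_eq hA (by lia) hkn, pathVec, Nat.add_sub_cancel, he.1]
    module
  rw [hv, hfk] at h1
  rw [h2, hw, ← fourTerm_right_injective hA (h.pathVec_apply_self hk (by lia))
    (h.pathVec_ne_zero (by lia)) h1]

theorem IsDoublePath.exists_eq_pathTerm (hA : IsGCM A) (hQ : IsQFamily A Q d)
    (h : IsDoublePath A n N) (hf : IsNormalSolution A Q f) :
    ∃ c, IsPathParameter A Q n N c ∧ ∀ k ≤ n, f (N k) = pathTerm A Q n N c k := by
  have hn := h.two_le
  have hQn : Q (N (n - 1)) = Q (N 1) := h.q_eq hQ (by lia) (by lia)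
  obtain ⟨c, hc, hc', hf0, hf1⟩ := h.leftEnd.exists_eq_endTerm hA hQ hf
  obtain ⟨b, hb, hb', hfn, hfn1⟩ := h.rightEnd.exists_eq_endTerm hA hQ hf
  have hinner : ∀ k, 0 < k → k < n → f (N k) = fourTerm A Q (N k) (pathVec A N k) c := by
    intro k hk
    induction k, hk using Nat.le_induction with
    | base => exact fun _ => hf1
    | succ k hk ih => exact fun hkn => h.eq_fourTerm_succ hA hQ hf hk hkn (ih (by lia))
  have hbc : b = c := by
    rw [← h.neg_pathVec_pred, fourTerm_neg_of_sq_eq hb, hinner _ (by lia) (by lia)] at hfn1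
    exact (fourTerm_right_injective hA (h.pathVec_apply_self (by lia) (by lia))
      (h.pathVec_ne_zero (by lia)) hfn1).symm
  subst hbc
  refine ⟨b, ⟨hc, hc', fun h2 => (hb' h2).trans (by rw [hQn])⟩, fun k hk => ?_⟩
  rcases Nat.eq_zero_or_pos k with rfl | h0
  · rw [hf0, pathTerm_zero]
  rcases hk.eq_or_lt with rfl | hkn
  · rw [hfn, pathTerm_last h0.ne']
  · rw [hinner k h0 hkn, pathTerm_of_pos_of_lt h0 hkn]

theorem IsDoublePath.isNormal_pathTerm (h : IsDoublePath A n N) (hk : k ≤ n) :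
    IsNormal A Q (N k) (pathTerm A Q n N c k) := by
  rw [pathTerm]
  split_ifs with h0 hkn
  · exact h0 ▸ isNormal_endTerm _ _ _
  · exact hkn ▸ isNormal_endTerm _ _ _
  · exact isNormal_fourTerm (h.pathVec_apply_self (by lia) (by lia)) c

theorem IsDoublePath.pathTerm_mem_xGrading (h : IsDoublePath A n N) (hk : k ≤ n) (hm : m ≤ n)
    (hmk : m ≠ k) (h1 : m + 1 ≠ k) (h2 : m ≠ k + 1) :
    pathTerm A Q n N c k ∈ xGrading (N m) 0 := by
  have hAmk := h.apply_eq_zero hk hm hmk h1 h2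
  rw [pathTerm]
  split_ifs with h0 hkn
  · subst h0
    exact endTerm_mem_xGrading hAmk
  · subst hkn
    exact endTerm_mem_xGrading hAmk
  · exact fourTerm_mem_xGrading hAmk
      (h.pathVec_apply_eq_zero (by lia) hm (by lia) h2) c

theorem IsDoublePath.shiftable_pathTerm_succ (hA : IsGCM A) (hQ : IsQFamily A Q d)
    (h : IsDoublePath A n N) (hc : IsPathParameter A Q n N c) (hk : k < n) :
    Shiftable Q (N k) (N (k + 1)) (pathTerm A Q n N c k) (pathTerm A Q n N c (k + 1)) := by
  have hn := h.two_le
  rcases Nat.eq_zero_or_pos k with rfl | h0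
  · rw [pathTerm_zero, pathTerm_of_pos_of_lt (by lia) (by lia)]
    exact h.leftEnd.shiftable_endTerm hA hQ hc.sq_eq hc.eq_of_left
  rcases (Nat.succ_le_of_lt hk).eq_or_lt with rfl | hkn
  · have hQk : Q (N k) = Q (N 1) := h.q_eq hQ h0 hk
    have hsq : c ^ 2 = (Q (N k) : ℂ) ^ 2 := by rw [hc.sq_eq, hQk]
    rw [pathTerm_of_pos_of_lt h0 hk, pathTerm_last (by lia), shiftable_comm,
      ← fourTerm_neg_of_sq_eq hsq, ← Nat.succ_sub_one k, h.neg_pathVec_pred]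
    exact h.rightEnd.shiftable_endTerm hA hQ hsq fun h2 => (hc.eq_of_right h2).trans
      (by rw [Nat.succ_sub_one, hQk])
  · have he := h.edge k h0 hkn
    rw [pathTerm_of_pos_of_lt h0 hk, pathTerm_of_pos_of_lt (by lia) hkn,
      h.pathVec_succ hA h0 hkn]
    exact shiftable_fourTerm hA hQ he.1 ⟨ne_zero_of_sq_eq hc.sq_eq, h.pathVec_apply_self h0 hk,
      Or.inl (h.pathVec_apply_succ hk)⟩

theorem IsDoublePath.shiftable_pathTerm_of_lt (hA : IsGCM A) (hQ : IsQFamily A Q d)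
    (h : IsDoublePath A n N) (hc : IsPathParameter A Q n N c) (hkm : k < m) (hm : m ≤ n) :
    Shiftable Q (N k) (N m) (pathTerm A Q n N c k) (pathTerm A Q n N c m) := by
  rcases (Nat.succ_le_of_lt hkm).eq_or_lt with rfl | hlt
  · exact h.shiftable_pathTerm_succ hA hQ hc hm
  · exact shiftable_of_mem_xGrading_zero
      (h.pathTerm_mem_xGrading (by lia) hm (by lia) (by lia) (by lia))
      (h.pathTerm_mem_xGrading hm (by lia) (by lia) (by lia) (by lia))

theorem IsDoublePath.isNormalSolution_iff (hA : IsGCM A) (hQ : IsQFamily A Q d)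
    (h : IsDoublePath A n N) :
    IsNormalSolution A Q f ↔
      ∃ c, IsPathParameter A Q n N c ∧ ∀ k ≤ n, f (N k) = pathTerm A Q n N c k := by
  refine ⟨h.exists_eq_pathTerm hA hQ, fun ⟨c, hc, hf⟩ => ⟨fun i => ?_, fun i j hij => ?_⟩⟩
  · obtain ⟨k, hk, rfl⟩ := h.surj i
    rw [hf k hk]
    exact h.isNormal_pathTerm hk
  · obtain ⟨k, hk, rfl⟩ := h.surj i
    obtain ⟨m, hm, rfl⟩ := h.surj j
    rw [hf k hk, hf m hm]
    rcases (ne_of_apply_ne N hij).lt_or_gt with hlt | hlt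
    · exact h.shiftable_pathTerm_of_lt hA hQ hc hlt hm
    · exact shiftable_comm.1 (h.shiftable_pathTerm_of_lt hA hQ hc hlt hk)

end doublePath

section pathLabels

variable {I : Type*} {A : Matrix I I ℤ} {n : ℕ} {N : ℕ → I} {a a' : I → ℕ} {ħ : ℂ}

theorem IsPathDiagram.sum_row_first [Fintype I] {R : Type*} [Ring R] (hA : IsGCM A)
    (h : IsPathDiagram A n N) (u : I → R) :
    ∑ j, (A (N 0) j : R) * u j = 2 * u (N 0) + A (N 0) (N 1) * u (N 1) := by
  have hn := h.two_le
  rw [Fintype.sum_eq_add (N 0) (N 1) (h.ne (by lia) (by lia) (by lia)) fun j hj => ?_, hA.diag,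
    Int.cast_ofNat]
  obtain ⟨m, hm, rfl⟩ := h.surj j
  have := ne_of_apply_ne N hj.1
  have := ne_of_apply_ne N hj.2
  rw [h.apply_eq_zero hm n.zero_le (by lia) (by lia) (by lia), Int.cast_zero, zero_mul]

theorem IsPathDiagram.sum_row [Fintype I] {R : Type*} [Ring R] (hA : IsGCM A)
    (h : IsPathDiagram A n N) {k : ℕ} (hk : 0 < k) (hkn : k < n) (u : I → R) :
    ∑ j, (A (N k) j : R) * u j = A (N k) (N (k - 1)) * u (N (k - 1)) + 2 * u (N k) +
      A (N k) (N (k + 1)) * u (N (k + 1)) := by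
  classical
  rw [← Finset.sum_subset (Finset.subset_univ {N (k - 1), N k, N (k + 1)}),
    Finset.sum_insert, Finset.sum_pair, hA.diag, add_assoc, Int.cast_ofNat]
  · exact h.ne (by lia) (by lia) (by lia)
  · simp [h.ne (show k - 1 ≤ n by lia) hkn.le (by lia),
      h.ne (show k - 1 ≤ n by lia) (Nat.succ_le_of_lt hkn) (by lia)]
  · intro j _ hj
    obtain ⟨m, hm, rfl⟩ := h.surj j
    simp only [Finset.mem_insert, Finset.mem_singleton, not_or] at hj
    have := ne_of_apply_ne N hj.1
    rw [h.apply_eq_zero hm hkn.le (ne_of_apply_ne N hj.2.1).symm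
      (ne_of_apply_ne N hj.2.2).symm (by lia), Int.cast_zero, zero_mul]

theorem IsPathDiagram.forall_of_first_of_last_of_interior (h : IsPathDiagram A n N) {P : I → Prop}
    (hfirst : P (N 0)) (hlast : P (N n)) (hinner : ∀ k, 0 < k → k < n → P (N k)) (i : I) : P i := by
  obtain ⟨k, hk, rfl⟩ := h.surj i
  rcases Nat.eq_zero_or_pos k with rfl | h0
  · exact hfirst
  rcases hk.eq_or_lt with rfl | hkn
  · exact hlast
  · exact hinner k h0 hkn

theorem IsDoublePath.transpose (h : IsDoublePath A n N) : IsDoublePath A.transpose n N where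
  two_le := h.two_le
  surj := h.surj
  inj := h.inj
  edge k hk hkn := (h.edge k hk hkn).symm
  far k m hkm hm := (h.far k m hkm hm).symm
  left := h.left.symm.imp And.symm And.symm
  right := h.right.symm.imp And.symm And.symm

variable [Fintype I] {u : I → ℤ}

theorem IsPathDiagram.null_first (hA : IsGCM A) (h : IsPathDiagram A n N)
    (hu : ∀ i, ∑ j, A i j * u j = 0) : 2 * u (N 0) = -A (N 0) (N 1) * u (N 1) := by
  have hrow := (h.sum_row_first hA u).symm.trans (hu (N 0))
  rw [Int.cast_id] at hrow
  linarith

theorem IsDoublePath.null_interior (hA : IsGCM A) (h : IsDoublePath A n N)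
    (hu : ∀ i, ∑ j, A i j * u j = 0) {k : ℕ} (hk : 0 < k) (hkn : k < n) :
    u (N k) = u (N 1) := by
  suffices u (N k) = u (N 1) ∧ A (N k) (N (k + 1)) * u (N (k + 1)) = -u (N k) from this.1
  induction k, hk using Nat.le_induction with
  | base =>
    have hfirst := h.null_first hA hu
    have hrow := (h.sum_row hA one_pos hkn u).symm.trans (hu (N 1))
    rw [Nat.sub_self, Int.cast_id, Int.cast_id] at hrow
    refine ⟨rfl, ?_⟩
    change A (N 1) (N (1 + 1)) * u (N (1 + 1)) = -u (N 1)
    rcases h.left with hl | hl <;> rw [hl.1] at hfirst <;> rw [hl.2] at hrow <;> linarith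
  | succ k hk ih =>
    obtain ⟨hconst, hnext⟩ := ih (by lia)
    have hrow := (h.sum_row hA (by lia) hkn u).symm.trans (hu (N (k + 1)))
    have he := h.edge k hk hkn
    rw [Nat.add_sub_cancel, Int.cast_id, Int.cast_id, he.2] at hrow
    rw [he.1] at hnext
    exact ⟨by linarith, by linarith⟩

theorem IsDoublePath.null_last (hA : IsGCM A) (h : IsDoublePath A n N)
    (hu : ∀ i, ∑ j, A i j * u j = 0) :
    2 * u (N n) = -A (N n) (N (n - 1)) * u (N 1) := by
  have hn := h.two_le
  rw [← h.null_interior hA hu (k := n - 1) (by lia) (by lia)]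
  exact h.reverse.null_first hA hu

theorem IsLabels.eq_one_of_forall_dvd (ha : IsLabels A a) {i : I} (h : ∀ j, a i ∣ a j) :
    a i = 1 := by
  have hdvd := Finset.dvd_gcd (s := Finset.univ) (f := a) fun j _ => h j
  rwa [ha.coprime, Nat.dvd_one] at hdvd

theorem IsDoublePath.label_first_of_neg_one (hA : IsGCM A) (h : IsDoublePath A n N)
    (ha : IsLabels A a) (h0 : A (N 0) (N 1) = -1) : a (N 0) = 1 := by
  have hfirst := h.null_first hA ha.null
  have hlast := h.null_last hA ha.null
  rw [h0] at hfirst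
  refine ha.eq_one_of_forall_dvd <| h.forall_of_first_of_last_of_interior dvd_rfl ?_
    fun k hk hkn => ?_
  · rcases h.right with hr | hr <;> rw [hr.1] at hlast
    · exact dvd_of_eq (by lia)
    · exact ⟨2, by lia⟩
  · have := h.null_interior hA ha.null hk hkn
    exact ⟨2, by lia⟩

theorem IsDoublePath.label_first_of_neg_two_of_neg_two (hA : IsGCM A) (h : IsDoublePath A n N)
    (ha : IsLabels A a) (h0 : A (N 0) (N 1) = -2) (hn : A (N n) (N (n - 1)) = -2) :
    a (N 0) = 1 := by
  have hfirst := h.null_first hA ha.null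
  have hlast := h.null_last hA ha.null
  rw [h0] at hfirst
  rw [hn] at hlast
  refine ha.eq_one_of_forall_dvd <| h.forall_of_first_of_last_of_interior dvd_rfl
    (dvd_of_eq (by lia)) fun k hk hkn => ?_
  have := h.null_interior hA ha.null hk hkn
  exact dvd_of_eq (by lia)

theorem IsDoublePath.label_first_of_neg_two_of_neg_one (hA : IsGCM A) (h : IsDoublePath A n N)
    (ha : IsLabels A a) (h0 : A (N 0) (N 1) = -2) (hn : A (N n) (N (n - 1)) = -1) :
    a (N 0) = 2 := by
  have hfirst := h.null_first hA ha.null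
  have hlast := h.null_last hA ha.null
  have hone : a (N n) = 1 := h.reverse.label_first_of_neg_one hA ha hn
  rw [h0] at hfirst
  rw [hn, hone] at hlast
  lia

theorem IsDoublePath.qi_second_of_neg_one_of_neg_one (hA : IsGCM A) (h : IsDoublePath A n N)
    (ha : IsLabels A a) (ha' : IsLabels A.transpose a') (h0 : A (N 0) (N 1) = -1)
    (hn : A (N n) (N (n - 1)) = -1) : qi ħ a a' (N 1) = qpow ħ (1 / 2) := by
  have h0' : A (N 1) (N 0) = -2 := by rcases h.left with hl | hl <;> lia
  have hn' : A (N (n - 1)) (N n) = -2 := by rcases h.right with hr | hr <;> lia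
  have hfirst := h.null_first hA ha.null
  have hfirst' := h.transpose.null_first hA.transpose ha'.null
  rw [h0, h.label_first_of_neg_one hA ha h0] at hfirst
  rw [Matrix.transpose_apply, h0',
    h.transpose.label_first_of_neg_two_of_neg_two hA.transpose ha' h0' hn'] at hfirst'
  rw [qi, show a (N 1) = 2 by lia, show a' (N 1) = 1 by lia]
  norm_num

theorem IsDoublePath.qi_of_neg_one_of_neg_two (hA : IsGCM A) (h : IsDoublePath A n N)
    (ha : IsLabels A a) (ha' : IsLabels A.transpose a') (h0 : A (N 0) (N 1) = -1)
    (hn : A (N n) (N (n - 1)) = -2) :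
    qi ħ a a' (N 0) = qpow ħ 2 ∧ qi ħ a a' (N 1) = qpow ħ 1 ∧
      qi ħ a a' (N n) = qpow ħ (1 / 2) := by
  have h0' : A (N 1) (N 0) = -2 := by rcases h.left with hl | hl <;> lia
  have hn' : A (N (n - 1)) (N n) = -1 := by rcases h.right with hr | hr <;> lia
  have hone := h.label_first_of_neg_one hA ha h0
  have htwo := h.transpose.label_first_of_neg_two_of_neg_one hA.transpose ha' h0' hn'
  have hfirst := h.null_first hA ha.null
  have hfirst' := h.transpose.null_first hA.transpose ha'.null
  have hlast := h.null_last hA ha.null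
  have hlast' := h.transpose.null_last hA.transpose ha'.null
  rw [h0] at hfirst
  rw [Matrix.transpose_apply, h0'] at hfirst'
  rw [hn] at hlast
  rw [Matrix.transpose_apply, hn'] at hlast'
  rw [qi, qi, qi, hone, htwo, show a (N 1) = 2 by lia, show a' (N 1) = 2 by lia,
    show a (N n) = 2 by lia, show a' (N n) = 1 by lia]
  norm_num

theorem IsDoublePath.qi_of_neg_two_of_neg_two (hA : IsGCM A) (h : IsDoublePath A n N)
    (ha : IsLabels A a) (ha' : IsLabels A.transpose a') (h0 : A (N 0) (N 1) = -2)
    (hn : A (N n) (N (n - 1)) = -2) :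
    qi ħ a a' (N 0) = qpow ħ 1 ∧ qi ħ a a' (N 1) = qpow ħ 2 ∧ qi ħ a a' (N n) = qpow ħ 1 := by
  have h0' : A (N 1) (N 0) = -1 := by rcases h.left with hl | hl <;> lia
  have hn' : A (N (n - 1)) (N n) = -1 := by rcases h.right with hr | hr <;> lia
  have hone := h.label_first_of_neg_two_of_neg_two hA ha h0 hn
  have hone' := h.transpose.label_first_of_neg_one hA.transpose ha' h0'
  have hfirst := h.null_first hA ha.null
  have hfirst' := h.transpose.null_first hA.transpose ha'.null
  have hlast := h.null_last hA ha.null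
  have hlast' := h.transpose.null_last hA.transpose ha'.null
  rw [h0] at hfirst
  rw [Matrix.transpose_apply, h0'] at hfirst'
  rw [hn] at hlast
  rw [Matrix.transpose_apply, hn'] at hlast'
  rw [qi, qi, qi, hone, hone', show a (N 1) = 1 by lia, show a' (N 1) = 2 by lia,
    show a (N n) = 1 by lia, show a' (N n) = 1 by lia]
  norm_num

end pathLabels

section pathMonomials

variable {I : Type*} [DecidableEq I] {A : Matrix I I ℤ} {Q : I → ℂˣ} {d : I → ℚ} {n k : ℕ}
  {N : ℕ → I}

/-- The exponent vector of `z_k` for a path with double edges at both ends. -/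
def pathZ (A : Matrix I I ℤ) (n : ℕ) (N : ℕ → I) (k : ℕ) : I → ℤ :=
  (if k = n then -A (N n) (N (n - 1)) else 1) • Pi.single (N k) 1 -
    (if k = 1 then -A (N 0) (N 1) else 1) • Pi.single (N (k - 1)) 1

theorem IsDoublePath.pathZ_of_lt (h : IsDoublePath A n N) (hk : 0 < k) (hkn : k < n) :
    pathZ A n N k = Pi.single (N k) 1 + A (N (k - 1)) (N k) • Pi.single (N (k - 1)) 1 := by
  rw [pathZ, if_neg hkn.ne, one_smul, sub_eq_add_neg, ← neg_smul]
  congr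
  split_ifs with h1
  · rw [h1, neg_neg]
  · have he := (h.edge (k - 1) (by lia) (by lia)).1
    rw [Nat.sub_add_cancel hk] at he
    rw [he]

theorem IsDoublePath.pathZ_succ (h : IsDoublePath A n N) (hk : 0 < k) (hkn : k < n) :
    pathZ A n N (k + 1) =
      -A (N (k + 1)) (N k) • Pi.single (N (k + 1)) 1 - Pi.single (N k) 1 := by
  rw [pathZ, if_neg (show k + 1 ≠ 1 by lia), one_smul, Nat.add_sub_cancel]
  congr
  split_ifs with h1
  · rw [← h1, Nat.add_sub_cancel]
  · rw [(h.edge k hk (by lia)).2, neg_neg]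

theorem IsDoublePath.pathZ_sub_pathZ_succ (hA : IsGCM A) (h : IsDoublePath A n N) (hk : 0 < k)
    (hkn : k < n) : pathZ A n N k - pathZ A n N (k + 1) = A.col (N k) := by
  rw [h.pathZ_of_lt hk hkn, h.pathZ_succ hk hkn, h.col_eq hA hk hkn]
  module

theorem IsDoublePath.pathZ_add_pathZ_succ (h : IsDoublePath A n N) (hk : 0 < k) (hkn : k < n) :
    pathZ A n N k + pathZ A n N (k + 1) = pathVec A N k := by
  rw [h.pathZ_of_lt hk hkn, h.pathZ_succ hk hkn, pathVec]
  module

theorem IsDoublePath.col_first (hA : IsGCM A) (h : IsDoublePath A n N) :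
    A.col (N 0) = A (N 1) (N 0) • pathZ A n N 1 := by
  have hn := h.two_le
  rw [h.leftEnd.col_leaf hA, h.pathZ_of_lt one_pos (by lia), Nat.sub_self]
  rcases h.left with hl | hl <;> rw [hl.1, hl.2] <;> module

theorem IsDoublePath.col_last (hA : IsGCM A) (h : IsDoublePath A n N) :
    A.col (N n) = -A (N (n - 1)) (N n) • pathZ A n N n := by
  have hn := h.two_le
  rw [h.rightEnd.col_leaf hA, pathZ, if_pos rfl, if_neg (by lia), one_smul]
  rcases h.right with hr | hr <;> rw [hr.1, hr.2] <;> module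

theorem IsDoublePath.scaleFactor_smul_interior (hA : IsGCM A) (hQ : IsQFamily A Q d)
    (h : IsDoublePath A n N) (hk : 0 < k) (hkn : k < n) {a b : ℂˣ} {c : ℂ}
    (hab : a = Q (N 1) * b) (hc : c = -((Q (N 1) : ℂ) ^ 2 * (b : ℂ) ^ 2)) :
    scaleFactor Q (N k) • (brace (Q (N k)) (scal a * mono (pathZ A n N k)) *
      brace (Q (N k)) (scal b * mono (pathZ A n N (k + 1)))) = pathTerm A Q n N c k := by
  rw [← h.q_eq hQ hk hkn] at hab hc
  rw [hQ.scaleFactor_smul_brace_mul_brace (h.pathZ_sub_pathZ_succ hA hk hkn) hab,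
    h.pathZ_add_pathZ_succ hk hkn, pathTerm_of_pos_of_lt hk hkn, hc]

omit [DecidableEq I] in
theorem fourTerm_zero_eq_of_mul_eq {i : I} {c c' : ℂ} (h : c * c' = (Q i : ℂ) ^ 2) :
    fourTerm A Q i 0 c = fourTerm A Q i 0 c' := by
  have hc' : c' ≠ 0 := right_ne_zero_of_mul (h ▸ pow_ne_zero 2 (Q i).ne_zero)
  rw [← mul_inv_cancel_right₀ hc' c, h, ← fourTerm_neg, neg_zero]

end pathMonomials

section tridiag

variable {I : Type*} {A : Matrix I I ℤ} {Q : I → ℂˣ} {d : I → ℚ} {n k m : ℕ}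
  {e : Fin (n + 1) ≃ I} {u l : ℕ → ℤ}

/-- The nodes in the order given by a numbering. -/
def nodes (e : Fin (n + 1) ≃ I) (k : ℕ) : I := e (Fin.ofNat (n + 1) k)

theorem fin_val_ofNat (hk : k ≤ n) : (Fin.ofNat (n + 1) k).val = k :=
  Nat.mod_eq_of_lt (Nat.lt_succ_of_le hk)

theorem nodes_val (e : Fin (n + 1) ≃ I) (i : Fin (n + 1)) : nodes e i.val = e i := by
  rw [nodes, Fin.ofNat_val_eq_self]

theorem forall_eq_iff_of_scaleFactor_smul_eq (hQ : IsQFamily A Q d) {φ : I → Laurent I}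
    {sol : Fin (n + 1) → Laurent I} {g : ℕ → Laurent I}
    (h : ∀ k ≤ n, scaleFactor Q (nodes e k) • sol (Fin.ofNat (n + 1) k) = g k) :
    (∀ i, φ (e i) = sol i) ↔ ∀ k ≤ n, scaleFactor Q (nodes e k) • φ (nodes e k) = g k := by
  refine ⟨fun hφ k hk => (hQ.scaleFactor_smul_eq_iff (h k hk)).2 (hφ _), fun hφ i => ?_⟩
  rw [← nodes_val, (hQ.scaleFactor_smul_eq_iff (h i i.is_le)).1 (hφ i i.is_le),
    Fin.ofNat_val_eq_self]

section numbering

variable (he : IsNumbering A (tridiag n u l) e)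
include he

theorem IsNumbering.apply_nodes (hk : k ≤ n) (hm : m ≤ n) : A (nodes e k) (nodes e m) =
    if k = m then 2 else if m = k + 1 then u k else if k = m + 1 then l m else 0 := by
  rw [nodes, nodes, he, tridiag, Matrix.of_apply, fin_val_ofNat hk, fin_val_ofNat hm]
  simp only [Fin.ext_iff, fin_val_ofNat hk, fin_val_ofNat hm]

theorem IsNumbering.apply_nodes_succ (hk : k < n) :
    A (nodes e k) (nodes e (k + 1)) = u k := by
  rw [he.apply_nodes hk.le hk, if_neg (by lia), if_pos rfl]

theorem IsNumbering.apply_succ_nodes (hk : k < n) :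
    A (nodes e (k + 1)) (nodes e k) = l k := by
  rw [he.apply_nodes hk hk.le, if_neg (by lia), if_neg (by lia), if_pos rfl]

theorem IsNumbering.apply_nodes_last (hn : 0 < n) :
    A (nodes e n) (nodes e (n - 1)) = l (n - 1) := by
  have h := he.apply_succ_nodes (Nat.sub_lt hn one_pos)
  rwa [Nat.sub_one_add_one hn.ne'] at h

theorem IsNumbering.isDoublePath (hn : 2 ≤ n)
    (hul : ∀ k, 0 < k → k + 1 < n → u k = -1 ∧ l k = -1)
    (hleft : (u 0 = -1 ∧ l 0 = -2) ∨ (u 0 = -2 ∧ l 0 = -1))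
    (hright : (l (n - 1) = -1 ∧ u (n - 1) = -2) ∨ (l (n - 1) = -2 ∧ u (n - 1) = -1)) :
    IsDoublePath A n (nodes e) where
  two_le := hn
  surj i := ⟨e.symm i, (e.symm i).is_le, by rw [nodes_val, Equiv.apply_symm_apply]⟩
  inj k hk m hm h := by
    have hval := congrArg Fin.val (e.injective h)
    rwa [fin_val_ofNat hk, fin_val_ofNat hm] at hval
  edge k h0 h1 := by
    rw [he.apply_nodes_succ (by lia), he.apply_succ_nodes (by lia)]
    exact hul k h0 h1
  far k m h1 hm := by
    rw [he.apply_nodes (by lia) hm, he.apply_nodes hm (by lia)]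
    constructor <;> rw [if_neg (by lia), if_neg (by lia), if_neg (by lia)]
  left := by
    rw [IsDoubleEdge, he.apply_nodes_succ (k := 0) (by lia),
      he.apply_succ_nodes (k := 0) (by lia)]
    exact hleft
  right := by
    have hu := he.apply_nodes_succ (k := n - 1) (by lia)
    rw [Nat.sub_add_cancel (by lia)] at hu
    rw [IsDoubleEdge, hu, he.apply_nodes_last (by lia)]
    exact hright

end numbering

variable [DecidableEq I]

theorem X_eq_mono (e : Fin (n + 1) ≃ I) (k : ℕ) : X e k = mono (Pi.single (nodes e k) 1) := rfl

theorem inv_X_pow_mul_X_pow (e : Fin (n + 1) ≃ I) (k m r s : ℕ) :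
    (X e k ^ r)⁻¹ * X e m ^ s =
      mono ((s : ℤ) • Pi.single (nodes e m) 1 - (r : ℤ) • Pi.single (nodes e k) 1) := by
  rw [X_eq_mono, X_eq_mono, sub_eq_add_neg, mono_add, mono_neg, mono_zsmul, mono_zsmul,
    zpow_natCast, zpow_natCast, mul_comm]

end tridiag

/-! ### The types `C_n^{(1)}`, `A_{2n}^{(2)}` and `D_{n+1}^{(2)}` -/

section constants

theorem im_sq : (im : ℂ) ^ 2 = -1 := Complex.I_sq

theorem val_qpow_mul (ħ : ℂ) (s t : ℚ) : (qpow ħ s : ℂ) * qpow ħ t = qpow ħ (s + t) := by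
  rw [qpow_add, Units.val_mul]

theorem val_qpow_pow (ħ : ℂ) (s : ℚ) (m : ℕ) : (qpow ħ s : ℂ) ^ m = qpow ħ (s * m) := by
  rw [← qpow_pow, Units.val_pow_eq_pow_val]

end constants

section cartanC

variable {I : Type*} {A : Matrix I I ℤ} {n : ℕ} {e : Fin (n + 1) ≃ I}

theorem isDoublePath_of_cartanC (hn : 2 ≤ n) (he : IsNumbering A (cartanC n) e) :
    IsDoublePath A n (nodes e) :=
  IsNumbering.isDoublePath he hn
    (fun k _ _ => ⟨if_neg (by lia), if_neg (by lia)⟩) (Or.inl ⟨if_neg (by lia), if_pos rfl⟩)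
    (Or.inl ⟨if_neg (by lia), if_pos (by lia)⟩)

theorem ends_of_cartanC (hn : 2 ≤ n) (he : IsNumbering A (cartanC n) e) :
    A (nodes e 0) (nodes e 1) = -1 ∧ A (nodes e n) (nodes e (n - 1)) = -1 :=
  ⟨(IsNumbering.apply_nodes_succ he (k := 0) (by lia)).trans (if_neg (by lia)),
    (IsNumbering.apply_nodes_last he (by lia)).trans (if_neg (by lia))⟩

theorem sq_eq_sq_iff_exists_eq_neg {p r : ℂˣ} (hr : (p : ℂ) * (r : ℂ) ^ 2 = 1) {c : ℂ} :
    c ^ 2 = (p : ℂ) ^ 2 ↔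
      ∃ b : ℂˣ, (b = r ∨ b = im * r) ∧ c = -((p : ℂ) ^ 2 * (b : ℂ) ^ 2) := by
  have hI := im_sq
  rw [sq_eq_sq_iff_eq_or_eq_neg]
  simp only [or_and_right, exists_or, exists_eq_left, Units.val_mul, or_comm (a := c = p)]
  refine or_congr (Eq.congr_right ?_) (Eq.congr_right ?_)
  · linear_combination (p : ℂ) * hr
  · linear_combination (p : ℂ) ^ 2 * (r : ℂ) ^ 2 * hI - (p : ℂ) * hr

variable [DecidableEq I] {Q : I → ℂˣ} {d : I → ℚ} {k : ℕ}

theorem zC_eq_mono (hn : 2 ≤ n) (he : IsNumbering A (cartanC n) e) (k : ℕ) :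
    zC e k = mono (pathZ A n (nodes e) k) := by
  have hX := inv_X_pow_mul_X_pow e (k - 1) k 1 1
  rw [pow_one, pow_one] at hX
  rw [zC, hX, pathZ, (ends_of_cartanC hn he).1, (ends_of_cartanC hn he).2, neg_neg, ite_self,
    ite_self, Nat.cast_one]

theorem scaleFactor_smul_solC (hA : IsGCM A) (hQ : IsQFamily A Q d) (hn : 2 ≤ n)
    (he : IsNumbering A (cartanC n) e) {b : ℂˣ} {c : ℂ}
    (hc : c ^ 2 = (Q (nodes e 1) : ℂ) ^ 2) (hcb : c = -((Q (nodes e 1) : ℂ) ^ 2 * (b : ℂ) ^ 2))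
    (hk : k ≤ n) :
    scaleFactor Q (nodes e k) • solC Q e b (Fin.ofNat (n + 1) k) =
      pathTerm A Q n (nodes e) c k := by
  have h := isDoublePath_of_cartanC hn he
  obtain ⟨h0, hlast⟩ := ends_of_cartanC hn he
  have hend : ∀ i, fourTerm A Q i 0 (-((Q i : ℂ) ^ 2 * (b : ℂ) ^ 2)) = fourTerm A Q i 0 c :=
    fun i => by
      have hbc : -((b : ℂ) ^ 2 * c) = 1 :=
        mul_left_cancel₀ (pow_ne_zero 2 (Q (nodes e 1)).ne_zero)
          (by linear_combination hc - c * hcb)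
      exact fourTerm_zero_eq_of_mul_eq (by linear_combination (Q i : ℂ) ^ 2 * hbc)
  rw [solC, fin_val_ofNat hk, ← nodes]
  simp only [zC_eq_mono hn he, ← mono_neg]
  rcases Nat.eq_zero_or_pos k with rfl | hk0
  · have hl : A (nodes e 1) (nodes e 0) = -2 := by rcases h.left with hl | hl <;> lia
    rw [if_pos rfl, hQ.scaleFactor_smul_brace_mul_brace (by rw [h.col_first hA, hl]; module) rfl,
      neg_add_cancel, hend, pathTerm_zero, endTerm_of_eq_neg_one h0]
  rcases hk.eq_or_lt with rfl | hkn
  · have hr : A (nodes e (k - 1)) (nodes e k) = -2 := by rcases h.right with hr | hr <;> lia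
    rw [if_neg hk0.ne', if_pos rfl,
      hQ.scaleFactor_smul_brace_mul_brace (by rw [h.col_last hA, hr]; module) rfl,
      add_neg_cancel, hend, pathTerm_last hk0.ne', endTerm_of_eq_neg_one hlast]
  · rw [if_neg hk0.ne', if_neg hkn.ne]
    exact h.scaleFactor_smul_interior hA hQ hk0 hkn (by rw [h.q_eq hQ hk0 hkn]) hcb

theorem isSolution_iff_of_cartanC [Fintype I] (hA : IsAffineCartan A) {a a' : I → ℕ}
    (ha : IsLabels A a) (ha' : IsLabels A.transpose a') {ħ : ℂ}
    (hq : ∀ m : ℕ, 0 < m → Complex.exp ħ ^ m ≠ 1) (hn : 2 ≤ n)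
    (he : IsNumbering A (cartanC n) e) (φ : I → Laurent I) :
    IsSolution A (qi ħ a a') φ ↔ ∃ b : ℂˣ, (b = qpow ħ (-1 / 4) ∨ b = im * qpow ħ (-1 / 4)) ∧
      ∀ i, φ (e i) = solC (qi ħ a a') e b i := by
  have hQ := isQFamily_qi hA ha ha' hq
  have h := isDoublePath_of_cartanC hn he
  obtain ⟨h0, hlast⟩ := ends_of_cartanC hn he
  have hr : (qi ħ a a' (nodes e 1) : ℂ) * (qpow ħ (-1 / 4) : ℂ) ^ 2 = 1 := by
    rw [h.qi_second_of_neg_one_of_neg_one hA.gcm ha ha' h0 hlast, val_qpow_pow, val_qpow_mul]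
    norm_num [qpow_zero]
  have hpar : ∀ c, IsPathParameter A (qi ħ a a') n (nodes e) c ↔
      c ^ 2 = (qi ħ a a' (nodes e 1) : ℂ) ^ 2 := fun c =>
    ⟨fun hc => hc.sq_eq, fun hc => ⟨hc, fun h2 => by lia, fun h2 => by lia⟩⟩
  rw [isSolution_iff hA.gcm hQ, h.isNormalSolution_iff hA.gcm hQ]
  simp only [hpar]
  constructor
  · rintro ⟨c, hc, hφ⟩
    obtain ⟨b, hb, hcb⟩ := (sq_eq_sq_iff_exists_eq_neg hr).1 hc
    exact ⟨b, hb, (forall_eq_iff_of_scaleFactor_smul_eq hQ fun _ =>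
      scaleFactor_smul_solC hA.gcm hQ hn he hc hcb).2 hφ⟩
  · rintro ⟨b, hb, hφ⟩
    have hc := (sq_eq_sq_iff_exists_eq_neg hr).2 ⟨b, hb, rfl⟩
    exact ⟨_, hc, (forall_eq_iff_of_scaleFactor_smul_eq hQ fun _ =>
      scaleFactor_smul_solC hA.gcm hQ hn he hc rfl).1 hφ⟩

end cartanC

section twistedSolutions

variable {I : Type*} {A : Matrix I I ℤ} {n k : ℕ} {e : Fin (n + 1) ≃ I} {Q : I → ℂˣ}
  {d : I → ℚ} {ħ : ℂ}

theorem neg_im_inv : -im⁻¹ = im := by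
  ext1
  simp [im]

theorem neg_sq_mul_im_mul_qpow_sq (ħ : ℂ) (r s : ℚ) :
    -((qpow ħ r : ℂ) ^ 2 * ((im * qpow ħ s : ℂˣ) : ℂ) ^ 2) = qpow ħ (r * 2 + s * 2) := by
  rw [Units.val_mul, mul_pow, im_sq, val_qpow_pow, val_qpow_pow, neg_one_mul, mul_neg, neg_neg,
    val_qpow_mul, Nat.cast_ofNat]

theorem qpow_mul_im_mul_qpow (ħ : ℂ) (r s : ℚ) :
    qpow ħ r * (im * qpow ħ s) = im * qpow ħ (r + s) := by
  rw [mul_left_comm, ← qpow_add]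

theorem IsQFamily.scaleFactor_smul_brace_mul_brace_same (hQ : IsQFamily A Q d) {i : I}
    {z : I → ℤ} (hz : A.col i = (-2 : ℤ) • z) (hi : Q i = qpow ħ 2) :
    scaleFactor Q i • (brace (Q i) (scal (im * qpow ħ (-3 / 2)) * mono z) *
      brace (Q i) (scal (im * qpow ħ (-1 / 2)) * mono z)) = fourTerm A Q i 0 (qpow ħ 1) := by
  have hinv : -(im * qpow ħ (-3 / 2))⁻¹ = Q i * (im * qpow ħ (-1 / 2)) := by
    rw [mul_inv, ← neg_mul, neg_im_inv, ← qpow_neg, hi, qpow_mul_im_mul_qpow]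
    norm_num
  rw [brace_scal_mono_neg _ (im * qpow ħ (-3 / 2)), hinv,
    hQ.scaleFactor_smul_brace_mul_brace (by rw [hz]; module) rfl, neg_add_cancel, hi,
    neg_sq_mul_im_mul_qpow_sq]
  refine fourTerm_zero_eq_of_mul_eq ?_
  rw [hi, val_qpow_mul, val_qpow_pow]
  norm_num

theorem isDoublePath_of_cartanA2 (hn : 2 ≤ n) (he : IsNumbering A (cartanA2 n) e) :
    IsDoublePath A n (nodes e) := by
  refine IsNumbering.isDoublePath he hn (fun k hk hkn => ⟨rfl, ?_⟩) (Or.inl ⟨rfl, ?_⟩)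
    (Or.inr ⟨?_, rfl⟩)
  · rw [if_neg hk.ne', if_neg hkn.ne, mul_one]
  · rw [if_pos rfl, if_neg (by lia), mul_one]
  · rw [if_neg (by lia), if_pos (by lia), one_mul]

theorem ends_of_cartanA2 (hn : 2 ≤ n) (he : IsNumbering A (cartanA2 n) e) :
    A (nodes e 0) (nodes e 1) = -1 ∧ A (nodes e n) (nodes e (n - 1)) = -2 := by
  refine ⟨IsNumbering.apply_nodes_succ (u := fun _ => -1) he (k := 0) (by lia), ?_⟩
  rw [IsNumbering.apply_nodes_last he (by lia), if_neg (by lia), if_pos (by lia), one_mul]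

theorem isDoublePath_of_cartanD2 (hn : 2 ≤ n) (he : IsNumbering A (cartanD2 n) e) :
    IsDoublePath A n (nodes e) :=
  IsNumbering.isDoublePath he hn
    (fun k _ _ => ⟨if_neg (by lia), if_neg (by lia)⟩) (Or.inr ⟨if_pos rfl, if_neg (by lia)⟩)
    (Or.inr ⟨if_pos (by lia), if_neg (by lia)⟩)

theorem ends_of_cartanD2 (hn : 2 ≤ n) (he : IsNumbering A (cartanD2 n) e) :
    A (nodes e 0) (nodes e 1) = -2 ∧ A (nodes e n) (nodes e (n - 1)) = -2 :=
  ⟨(IsNumbering.apply_nodes_succ he (k := 0) (by lia)).trans (if_pos rfl),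
    (IsNumbering.apply_nodes_last he (by lia)).trans (if_pos (by lia))⟩

variable [DecidableEq I]

theorem IsDoublePath.isNormalSolution_iff_of_neg_two (hA : IsGCM A) (hQ : IsQFamily A Q d)
    {N : ℕ → I} (h : IsDoublePath A n N) (hn : A (N n) (N (n - 1)) = -2) {f : I → Laurent I} :
    IsNormalSolution A Q f ↔ ∀ k ≤ n, f (N k) = pathTerm A Q n N (Q (N 1)) k := by
  rw [h.isNormalSolution_iff hA hQ]
  refine ⟨fun ⟨c, hc, hf⟩ => ?_, fun hf => ⟨_, ⟨rfl, fun _ => rfl, fun _ => rfl⟩, hf⟩⟩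
  rwa [hc.eq_of_right hn] at hf

theorem zA2_eq_mono (hn : 2 ≤ n) (he : IsNumbering A (cartanA2 n) e) (k : ℕ) :
    zA2 e k = mono (pathZ A n (nodes e) k) := by
  have hX := inv_X_pow_mul_X_pow e (k - 1) k 1 (if k = n then 2 else 1)
  rw [pow_one] at hX
  rw [zA2, hX, pathZ, (ends_of_cartanA2 hn he).1, (ends_of_cartanA2 hn he).2]
  simp only [neg_neg, ite_self, Nat.cast_ite, Nat.cast_ofNat, Nat.cast_one]

theorem zD2_eq_mono (hn : 2 ≤ n) (he : IsNumbering A (cartanD2 n) e) (k : ℕ) :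
    zD2 e k = mono (pathZ A n (nodes e) k) := by
  rw [zD2, inv_X_pow_mul_X_pow, pathZ, (ends_of_cartanD2 hn he).1, (ends_of_cartanD2 hn he).2]
  simp only [neg_neg, Nat.cast_ite, Nat.cast_ofNat, Nat.cast_one]

theorem scaleFactor_smul_solA2 (hA : IsGCM A) (hQ : IsQFamily A Q d) (hn : 2 ≤ n)
    (he : IsNumbering A (cartanA2 n) e) (hQ0 : Q (nodes e 0) = qpow ħ 2)
    (hQ1 : Q (nodes e 1) = qpow ħ 1) (hQn : Q (nodes e n) = qpow ħ (1 / 2)) (hk : k ≤ n) :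
    scaleFactor Q (nodes e k) • solA2 ħ Q e (Fin.ofNat (n + 1) k) =
      pathTerm A Q n (nodes e) (Q (nodes e 1)) k := by
  have h := isDoublePath_of_cartanA2 hn he
  obtain ⟨h0, hlast⟩ := ends_of_cartanA2 hn he
  rw [solA2, fin_val_ofNat hk, ← nodes]
  simp only [zA2_eq_mono hn he]
  rcases Nat.eq_zero_or_pos k with rfl | hk0
  · have hl : A (nodes e 1) (nodes e 0) = -2 := by rcases h.left with hl | hl <;> lia
    rw [if_pos rfl, hQ.scaleFactor_smul_brace_mul_brace_same (by rw [h.col_first hA, hl]) hQ0,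
      pathTerm_zero, endTerm_of_eq_neg_one h0, hQ1]
  rcases hk.eq_or_lt with rfl | hkn
  · have hr : A (nodes e (k - 1)) (nodes e k) = -1 := by rcases h.right with hr | hr <;> lia
    rw [if_neg hk0.ne', if_pos rfl, pathTerm_last hk0.ne', endTerm_of_eq_neg_two hlast]
    exact hQ.scaleFactor_smul_I_smul_brace
      (Or.inl ⟨by rw [h.col_last hA, hr, neg_neg, one_smul], by rw [hQn]; rfl⟩)
  · rw [if_neg hk0.ne', if_neg hkn.ne]
    refine h.scaleFactor_smul_interior hA hQ hk0 hkn ?_ ?_ <;> rw [hQ1]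
    · rw [qpow_mul_im_mul_qpow]
      norm_num
    · rw [neg_sq_mul_im_mul_qpow_sq]
      norm_num

theorem scaleFactor_smul_solD2 (hA : IsGCM A) (hQ : IsQFamily A Q d) (hn : 2 ≤ n)
    (he : IsNumbering A (cartanD2 n) e) (hQ0 : Q (nodes e 0) = qpow ħ 1)
    (hQ1 : Q (nodes e 1) = qpow ħ 2) (hQn : Q (nodes e n) = qpow ħ 1) (hk : k ≤ n) :
    scaleFactor Q (nodes e k) • solD2 ħ Q e (Fin.ofNat (n + 1) k) =
      pathTerm A Q n (nodes e) (Q (nodes e 1)) k := by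
  have h := isDoublePath_of_cartanD2 hn he
  obtain ⟨h0, hlast⟩ := ends_of_cartanD2 hn he
  rw [solD2, fin_val_ofNat hk, ← nodes]
  simp only [zD2_eq_mono hn he]
  rcases Nat.eq_zero_or_pos k with rfl | hk0
  · have hl : A (nodes e 1) (nodes e 0) = -1 := by rcases h.left with hl | hl <;> lia
    rw [if_pos rfl, pathTerm_zero, endTerm_of_eq_neg_two h0]
    refine hQ.scaleFactor_smul_I_smul_brace (Or.inr ⟨?_, ?_⟩)
    · rw [h.col_first hA, hl, neg_one_smul, neg_neg]
    · rw [hQ0, Units.val_mul, qpow_neg, Units.val_inv_eq_inv_val]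
      rfl
  rcases hk.eq_or_lt with rfl | hkn
  · have hr : A (nodes e (k - 1)) (nodes e k) = -1 := by rcases h.right with hr | hr <;> lia
    rw [if_neg hk0.ne', if_pos rfl, pathTerm_last hk0.ne', endTerm_of_eq_neg_two hlast]
    exact hQ.scaleFactor_smul_I_smul_brace
      (Or.inl ⟨by rw [h.col_last hA, hr, neg_neg, one_smul], by rw [hQn]; rfl⟩)
  · rw [if_neg hk0.ne', if_neg hkn.ne]
    refine h.scaleFactor_smul_interior hA hQ hk0 hkn ?_ ?_ <;> rw [hQ1]
    · rw [qpow_mul_im_mul_qpow]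
      norm_num
    · rw [neg_sq_mul_im_mul_qpow_sq]
      norm_num

section labels

variable [Fintype I] {a a' : I → ℕ}

theorem isSolution_iff_of_cartanA2_of_two_le (hA : IsAffineCartan A) (ha : IsLabels A a)
    (ha' : IsLabels A.transpose a') (hq : ∀ m : ℕ, 0 < m → Complex.exp ħ ^ m ≠ 1) (hn : 2 ≤ n)
    (he : IsNumbering A (cartanA2 n) e) (φ : I → Laurent I) :
    IsSolution A (qi ħ a a') φ ↔ ∀ i, φ (e i) = solA2 ħ (qi ħ a a') e i := by
  have hQ := isQFamily_qi hA ha ha' hq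
  have h := isDoublePath_of_cartanA2 hn he
  obtain ⟨h0, hlast⟩ := ends_of_cartanA2 hn he
  obtain ⟨hQ0, hQ1, hQn⟩ := h.qi_of_neg_one_of_neg_two (ħ := ħ) hA.gcm ha ha' h0 hlast
  rw [isSolution_iff hA.gcm hQ, h.isNormalSolution_iff_of_neg_two hA.gcm hQ hlast]
  exact (forall_eq_iff_of_scaleFactor_smul_eq hQ fun _ =>
    scaleFactor_smul_solA2 hA.gcm hQ hn he hQ0 hQ1 hQn).symm

theorem isSolution_iff_of_cartanD2 (hA : IsAffineCartan A) (ha : IsLabels A a)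
    (ha' : IsLabels A.transpose a') (hq : ∀ m : ℕ, 0 < m → Complex.exp ħ ^ m ≠ 1) (hn : 2 ≤ n)
    (he : IsNumbering A (cartanD2 n) e) (φ : I → Laurent I) :
    IsSolution A (qi ħ a a') φ ↔ ∀ i, φ (e i) = solD2 ħ (qi ħ a a') e i := by
  have hQ := isQFamily_qi hA ha ha' hq
  have h := isDoublePath_of_cartanD2 hn he
  obtain ⟨h0, hlast⟩ := ends_of_cartanD2 hn he
  obtain ⟨hQ0, hQ1, hQn⟩ := h.qi_of_neg_two_of_neg_two (ħ := ħ) hA.gcm ha ha' h0 hlast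
  rw [isSolution_iff hA.gcm hQ, h.isNormalSolution_iff_of_neg_two hA.gcm hQ hlast]
  exact (forall_eq_iff_of_scaleFactor_smul_eq hQ fun _ =>
    scaleFactor_smul_solD2 hA.gcm hQ hn he hQ0 hQ1 hQn).symm

end labels

end twistedSolutions

section rankTwo

variable {I : Type*} {A : Matrix I I ℤ} {Q : I → ℂˣ} {d : I → ℚ} {i j : I}

theorem IsQFamily.eq_pow_four_of_eq (hQ : IsQFamily A Q d) (hij : A i j = -1) (hji : A j i = -4) :
    Q i = Q j ^ 4 := by
  have h := hQ.zpow_eq i j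
  rw [hij, hji, zpow_neg_one, zpow_neg, inv_inj] at h
  exact Units.ext h.symm

theorem isNormalSolution_iff_of_neg_one_of_neg_four (hA : IsGCM A) (hQ : IsQFamily A Q d)
    (hij : A i j = -1) (hji : A j i = -4) (hI : ∀ k, k = i ∨ k = j) {f : I → Laurent I} :
    IsNormalSolution A Q f ↔
      f i = fourTerm A Q i 0 ((Q j : ℂ) ^ 2) ∧ f j = twoTerm A Q j := by
  have hne : i ≠ j := by
    rintro rfl
    lia
  have hcol : A.col i = (-2 : ℤ) • A.col j := funext fun k => by
    rcases hI k with rfl | rfl <;> simp [hij, hji, hA.diag]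
  constructor
  · intro hf
    obtain ⟨v, c, hE, hfi, -, hj⟩ := hf.exists_isEdgeMonomial hA hQ hne hij
    rcases hj with ⟨hvj, -⟩ | ⟨hv, rfl, hfj⟩
    · rcases hE.target with htarget | ⟨rfl, -⟩
      · lia
      · rw [Pi.zero_apply] at hvj
        lia
    · have hv0 : v = 0 := by rw [sub_eq_iff_eq_add.1 hv, hcol]; module
      exact ⟨hv0 ▸ hfi, hfj⟩
  · rintro ⟨hfi, hfj⟩
    rw [isNormalSolution_iff_of_forall_eq_or hne hI, hfi, hfj]
    have hQij : ((Q j : ℂ) ^ 2) ^ 2 = Q i := by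
      rw [hQ.eq_pow_four_of_eq hij hji, Units.val_pow_eq_pow_val, ← pow_mul]
    exact ⟨isNormal_fourTerm (Pi.zero_apply _) _, isNormal_twoTerm, shiftable_twoTerm hA hQ hij
      ⟨pow_ne_zero 2 (Q j).ne_zero, Pi.zero_apply _, Or.inr ⟨rfl, hQij⟩⟩ (by rw [hcol]; module) rfl⟩

variable {e : Fin (1 + 1) ≃ I}

theorem forall_eq_nodes_or (e : Fin (1 + 1) ≃ I) (i : I) : i = nodes e 0 ∨ i = nodes e 1 := by
  obtain ⟨k, rfl⟩ := e.surjective i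
  fin_cases k
  exacts [Or.inl rfl, Or.inr rfl]

theorem entries_of_cartanA2_one (he : IsNumbering A (cartanA2 1) e) :
    A (nodes e 0) (nodes e 1) = -1 ∧ A (nodes e 1) (nodes e 0) = -4 :=
  ⟨he 0 1, he 1 0⟩

theorem qi_of_cartanA2_one [Fintype I] {a a' : I → ℕ} {ħ : ℂ} (hA : IsGCM A) (ha : IsLabels A a)
    (ha' : IsLabels A.transpose a') (he : IsNumbering A (cartanA2 1) e) :
    qi ħ a a' (nodes e 0) = qpow ħ 2 ∧ qi ħ a a' (nodes e 1) = qpow ħ (1 / 2) := by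
  obtain ⟨h01, -⟩ := entries_of_cartanA2_one he
  have hsum : ∀ g : I → ℤ, ∑ i, g i = g (nodes e 0) + g (nodes e 1) := fun g => by
    rw [← e.sum_comp, Fin.sum_univ_two]
    rfl
  have hnull := ha.null (nodes e 0)
  have hnull' := ha'.null (nodes e 1)
  simp only [hsum, Matrix.transpose_apply, hA.diag, h01] at hnull hnull'
  have h0 : a (nodes e 0) = 1 := ha.eq_one_of_forall_dvd fun j => by
    rcases forall_eq_nodes_or e j with rfl | rfl
    exacts [dvd_rfl, ⟨2, by lia⟩]
  have h1' : a' (nodes e 1) = 1 := ha'.eq_one_of_forall_dvd fun j => by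
    rcases forall_eq_nodes_or e j with rfl | rfl
    exacts [⟨2, by lia⟩, dvd_rfl]
  have h1 : a (nodes e 1) = 2 := by lia
  have h0' : a' (nodes e 0) = 2 := by lia
  rw [qi, qi, h0, h1, h0', h1']
  norm_num

variable [DecidableEq I]

theorem zA2_one_eq_mono (hA : IsGCM A) (he : IsNumbering A (cartanA2 1) e) :
    zA2 e 1 = mono (A.col (nodes e 1)) := by
  have hX := inv_X_pow_mul_X_pow e 0 1 1 2
  rw [pow_one] at hX
  rw [zA2, if_pos rfl, Nat.sub_self, hX]
  have hne : nodes e 0 ≠ nodes e 1 := e.injective.ne (zero_ne_one (α := Fin 2))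
  congr 1
  funext i
  rcases forall_eq_nodes_or e i with rfl | rfl
  · simp [hne, (entries_of_cartanA2_one he).1]
  · simp [hne.symm, hA.diag]

variable [Fintype I] {a a' : I → ℕ} {ħ : ℂ}

theorem isSolution_iff_of_cartanA2_one (hA : IsAffineCartan A) (ha : IsLabels A a)
    (ha' : IsLabels A.transpose a') (hq : ∀ m : ℕ, 0 < m → Complex.exp ħ ^ m ≠ 1)
    (he : IsNumbering A (cartanA2 1) e) (φ : I → Laurent I) :
    IsSolution A (qi ħ a a') φ ↔ ∀ i, φ (e i) = solA2 ħ (qi ħ a a') e i := by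
  have hQ := isQFamily_qi hA ha ha' hq
  obtain ⟨h01, h10⟩ := entries_of_cartanA2_one he
  obtain ⟨hq0, hq1⟩ := qi_of_cartanA2_one (ħ := ħ) hA.gcm ha ha' he
  have hz := zA2_one_eq_mono hA.gcm he
  have hcol : A.col (nodes e 0) = (-2 : ℤ) • A.col (nodes e 1) := funext fun k => by
    rcases forall_eq_nodes_or e k with rfl | rfl <;> simp [h01, h10, hA.gcm.diag]
  have hsq : (qi ħ a a' (nodes e 1) : ℂ) ^ 2 = qpow ħ 1 := by
    rw [hq1, val_qpow_pow]
    norm_num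
  have hsol0 : scaleFactor (qi ħ a a') (nodes e 0) • solA2 ħ (qi ħ a a') e 0 =
      fourTerm A (qi ħ a a') (nodes e 0) 0 (qpow ħ 1) := by
    rw [solA2, if_pos (show ((0 : Fin (1 + 1)) : ℕ) = 0 from rfl), hz]
    exact hQ.scaleFactor_smul_brace_mul_brace_same hcol hq0
  have hsol1 : scaleFactor (qi ħ a a') (nodes e 1) • solA2 ħ (qi ħ a a') e 1 =
      twoTerm A (qi ħ a a') (nodes e 1) := by
    rw [solA2, if_neg (by simp), if_pos (show ((1 : Fin (1 + 1)) : ℕ) = 1 from rfl), hz]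
    exact hQ.scaleFactor_smul_I_smul_brace (Or.inl ⟨rfl, by rw [hq1]; rfl⟩)
  rw [isSolution_iff hA.gcm hQ, isNormalSolution_iff_of_neg_one_of_neg_four hA.gcm hQ h01 h10
    (forall_eq_nodes_or e), hsq, hQ.scaleFactor_smul_eq_iff hsol0, hQ.scaleFactor_smul_eq_iff hsol1]
  exact (Fin.forall_fin_two (p := fun i => φ (e i) = solA2 ħ (qi ħ a a') e i)).symm

theorem isSolution_iff_of_cartanA2 {n : ℕ} {e : Fin (n + 1) ≃ I} (hA : IsAffineCartan A)
    (ha : IsLabels A a) (ha' : IsLabels A.transpose a')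
    (hq : ∀ m : ℕ, 0 < m → Complex.exp ħ ^ m ≠ 1) (hn : 1 ≤ n)
    (he : IsNumbering A (cartanA2 n) e) (φ : I → Laurent I) :
    IsSolution A (qi ħ a a') φ ↔ ∀ i, φ (e i) = solA2 ħ (qi ħ a a') e i := by
  rcases hn.eq_or_lt with rfl | hn
  exacts [isSolution_iff_of_cartanA2_one hA ha ha' hq he φ,
    isSolution_iff_of_cartanA2_of_two_le hA ha ha' hq hn he φ]

end rankTwo

/-! ### Classification of the diagrams with a solution -/

section localRules

variable {I : Type*} {A : Matrix I I ℤ} {Q : I → ℂˣ} {d : I → ℚ} {f : I → Laurent I}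
  {i j k m : I}

/-- In the Dynkin diagram of `A`, no node other than `j` is joined to the node `i`. -/
def IsLeaf (A : Matrix I I ℤ) (i j : I) : Prop := ∀ k, k ≠ i → k ≠ j → A k i = 0

/-- The local conditions which the existence of a solution imposes on the Dynkin diagram of `A`: on
an edge with an entry `-1`, and on a node with three neighbours. -/
structure IsLocallyAdmissible (A : Matrix I I ℤ) : Prop where
  edge : ∀ i j, i ≠ j → A i j = -1 →
    A j i = -1 ∨ (A j i = -2 ∧ (IsLeaf A i j ∨ IsLeaf A j i)) ∨ A j i = -4
  branch : ∀ i j k m, j ≠ i → k ≠ i → m ≠ i → j ≠ k → j ≠ m → k ≠ m → A i j = -1 → A i k = -1 →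
    A m i = 0

theorem IsGCM.ne_zero (hA : IsGCM A) (h : A i j ≠ 0) : A j i ≠ 0 := fun h' => h (hA.zero j i h')

theorem IsNormalSolution.edge (hA : IsGCM A) (hQ : IsQFamily A Q d) (hf : IsNormalSolution A Q f)
    (hne : i ≠ j) (hij : A i j = -1) :
    A j i = -1 ∨ (A j i = -2 ∧ (IsLeaf A i j ∨ IsLeaf A j i)) ∨ A j i = -4 := by
  obtain ⟨v, c, hE, -, hv, hj⟩ := hf.exists_isEdgeMonomial hA hQ hne hij
  have hleaf_i : v = 0 → IsLeaf A i j := fun h0 k hki hkj => by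
    rw [← hv k hki hkj, h0, Pi.zero_apply]
  have hleaf_j : v - A.col i = 2 • A.col j → IsLeaf A j i := fun h k hkj hki => by
    simpa [hv k hki hkj] using (congrFun h k).symm
  have hδ : v - A.col i = 2 • A.col j → v j - A j i = 4 := fun h => by
    simpa [hA.diag] using congrFun h j
  rcases hE.target with hvj | ⟨hv0, -⟩ <;> rcases hj with ⟨hj, -⟩ | ⟨hj, -⟩
  · exact Or.inl (by lia)
  · exact Or.inr (Or.inl ⟨by have := hδ hj; lia, Or.inr (hleaf_j hj)⟩)
  · rw [hv0, Pi.zero_apply] at hj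
    exact Or.inr (Or.inl ⟨by lia, Or.inl (hleaf_i hv0)⟩)
  · have h4 := hδ hj
    rw [hv0, Pi.zero_apply] at h4
    exact Or.inr (Or.inr (by lia))

theorem IsNormalSolution.exists_eq_fourTerm (hA : IsGCM A) (hQ : IsQFamily A Q d)
    (hf : IsNormalSolution A Q f) (hj : j ≠ i) (hk : k ≠ i) (hjk : j ≠ k) (hij : A i j = -1)
    (hki : A k i ≠ 0) :
    ∃ v c, c ≠ 0 ∧ v i = 0 ∧ f i = fourTerm A Q i v c ∧ v j = -A j i ∧
      ∀ l, l ≠ i → l ≠ j → v l = A l i := by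
  obtain ⟨v, c, hE, hfi, hv, -⟩ := hf.exists_isEdgeMonomial hA hQ hj.symm hij
  refine ⟨v, c, hE.ne_zero, hE.self, hfi, hE.target.resolve_right fun h => hki ?_, hv⟩
  rw [← hv k hk hjk.symm, h.1, Pi.zero_apply]

/-- The expansions of `f i` obtained from the edges to `j` and to `k` must agree up to inverting the
monomial; `j` decides the sign, and then every further neighbour violates it. -/
theorem IsNormalSolution.branch (hA : IsGCM A) (hQ : IsQFamily A Q d)
    (hf : IsNormalSolution A Q f) (hj : j ≠ i) (hk : k ≠ i) (hm : m ≠ i) (hjk : j ≠ k)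
    (hjm : j ≠ m) (hkm : k ≠ m) (hij : A i j = -1) (hik : A i k = -1) : A m i = 0 := by
  have hji : A j i ≠ 0 := hA.ne_zero (by rw [hij]; decide)
  have hki : A k i ≠ 0 := hA.ne_zero (by rw [hik]; decide)
  obtain ⟨v, c, hc, hvi, hfi, hvj, hv⟩ := hf.exists_eq_fourTerm hA hQ hj hk hjk hij hki
  obtain ⟨w, b, -, -, hfi', -, hw⟩ := hf.exists_eq_fourTerm hA hQ hk hj hjk.symm hik hji
  have hv0 : v ≠ 0 := fun h => hji <| by simpa [h] using hvj
  rcases fourTerm_left_injective hA hvi hv0 hc (hfi.symm.trans hfi') with h | h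
  · have hwj := hw j hj hjk
    rw [← h, hvj] at hwj
    lia
  · have hvm := hv m hm hjm.symm
    rw [h, Pi.neg_apply, hw m hm hkm.symm] at hvm
    lia

theorem IsNormalSolution.isLocallyAdmissible (hA : IsGCM A) (hQ : IsQFamily A Q d)
    (hf : IsNormalSolution A Q f) : IsLocallyAdmissible A where
  edge _ _ := hf.edge hA hQ
  branch _ _ _ _ := hf.branch hA hQ

end localRules

section nullVector

variable {I : Type*} {A : Matrix I I ℤ} {i j k : I}

theorem IsIndecomposable.mem_of_closed (h : IsIndecomposable A) {S : Set I} (hS : S.Nonempty)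
    (hc : ∀ i ∈ S, ∀ j, j ∉ S → A i j = 0) (i : I) : i ∈ S := by
  by_contra hi
  obtain ⟨k, hk, j, hj, hkj⟩ := h S hS ⟨i, hi⟩
  exact hkj (hc k hk j hj)

theorem IsGCM.neg_of_ne_zero (hA : IsGCM A) (hij : i ≠ j) (h : A i j ≠ 0) : (A i j : ℝ) < 0 :=
  Int.cast_lt_zero.2 ((hA.offDiag i j hij).lt_of_ne h)

variable [Fintype I] {u : I → ℝ}

theorem sum_neg_mul_le_two_mul (hA : IsGCM A) (hu : ∀ i, 0 < u i)
    (h0 : ∀ i, ∑ j, (A i j : ℝ) * u j = 0) {s : Finset I} (hs : i ∉ s) :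
    ∑ j ∈ s, -(A i j : ℝ) * u j ≤ 2 * u i := by
  classical
  have hsum := h0 i
  rw [← Finset.sum_sdiff (Finset.subset_univ (insert i s)), Finset.sum_insert hs, hA.diag] at hsum
  have hrest : ∑ j ∈ Finset.univ \ insert i s, (A i j : ℝ) * u j ≤ 0 := by
    refine Finset.sum_nonpos fun j hj => ?_
    rw [Finset.mem_sdiff, Finset.mem_insert, not_or] at hj
    exact mul_nonpos_of_nonpos_of_nonneg
      (Int.cast_nonpos.2 (hA.offDiag i j (Ne.symm hj.2.1))) (hu j).le
  simp only [neg_mul, Finset.sum_neg_distrib]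
  push_cast at hsum
  linarith

theorem sum_neg_mul_eq_two_mul (hA : IsGCM A) (h0 : ∀ i, ∑ j, (A i j : ℝ) * u j = 0)
    {s : Finset I} (hs : i ∉ s) (hz : ∀ j, j ≠ i → j ∉ s → A i j = 0) :
    ∑ j ∈ s, -(A i j : ℝ) * u j = 2 * u i := by
  classical
  have hsum := h0 i
  rw [← Finset.sum_subset (Finset.subset_univ (insert i s)) fun j _ hj => by
      rw [Finset.mem_insert, not_or] at hj
      rw [hz j hj.1 hj.2, Int.cast_zero, zero_mul], Finset.sum_insert hs, hA.diag] at hsum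
  simp only [neg_mul, Finset.sum_neg_distrib]
  push_cast at hsum
  linarith

theorem neg_mul_le_two_mul (hA : IsGCM A) (hu : ∀ i, 0 < u i)
    (h0 : ∀ i, ∑ j, (A i j : ℝ) * u j = 0) (hij : i ≠ j) : -(A i j : ℝ) * u j ≤ 2 * u i := by
  simpa using sum_neg_mul_le_two_mul hA hu h0 (Finset.notMem_singleton.2 hij)

theorem mul_le_four (hA : IsGCM A) (hu : ∀ i, 0 < u i) (h0 : ∀ i, ∑ j, (A i j : ℝ) * u j = 0)
    (hij : i ≠ j) : A i j * A j i ≤ 4 := by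
  have hi := neg_mul_le_two_mul hA hu h0 hij
  have hj := neg_mul_le_two_mul hA hu h0 hij.symm
  have hji : (0 : ℝ) ≤ -A j i := neg_nonneg.2 (Int.cast_nonpos.2 (hA.offDiag j i hij.symm))
  have h4 : ((A i j * A j i : ℤ) : ℝ) * u j ≤ ((4 : ℤ) : ℝ) * u j := by
    push_cast
    nlinarith
  exact_mod_cast le_of_mul_le_mul_right h4 (hu j)

theorem apply_eq_zero_of_mul_eq_four (hA : IsGCM A) (hu : ∀ i, 0 < u i)
    (h0 : ∀ i, ∑ j, (A i j : ℝ) * u j = 0) (hij : i ≠ j) (h4 : A i j * A j i = 4) (hki : k ≠ i)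
    (hkj : k ≠ j) : A i k = 0 := by
  classical
  by_contra hik
  have hsum := sum_neg_mul_le_two_mul hA hu h0 (i := i) (s := {j, k}) (by simp [hij, hki.symm])
  rw [Finset.sum_pair hkj.symm] at hsum
  have hj := neg_mul_le_two_mul hA hu h0 hij.symm
  have h4' : (A i j * A j i : ℝ) = 4 := by exact_mod_cast h4
  have hij0 := hA.neg_of_ne_zero hij (by rintro h; simp [h] at h4)
  have hkey : 2 * u i ≤ -(A i j : ℝ) * u j := by
    linear_combination (1 / 2) * mul_le_mul_of_nonneg_left hj (neg_nonneg.2 hij0.le) -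
      u i / 2 * h4'
  have hik0 := mul_pos (neg_pos.2 (hA.neg_of_ne_zero hki.symm hik)) (hu k)
  linarith

theorem forall_eq_or_of_mul_eq_four (hA : IsGCM A) (hI : IsIndecomposable A) (hu : ∀ i, 0 < u i)
    (h0 : ∀ i, ∑ j, (A i j : ℝ) * u j = 0) (hij : i ≠ j) (h4 : A i j * A j i = 4) (k : I) :
    k = i ∨ k = j := by
  refine hI.mem_of_closed (S := {i, j}) ⟨i, Or.inl rfl⟩ (fun l hl m hm => ?_) k
  rw [Set.mem_insert_iff, Set.mem_singleton_iff, not_or] at hm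
  rcases hl with rfl | rfl
  · exact apply_eq_zero_of_mul_eq_four hA hu h0 hij h4 hm.1 hm.2
  · exact apply_eq_zero_of_mul_eq_four hA hu h0 hij.symm (by rwa [mul_comm]) hm.2 hm.1

end nullVector

section thin

variable {I : Type*} {A : Matrix I I ℤ} {i j k m : I} {n : ℕ} {N : ℕ → I}

/-- A generalized Cartan matrix with connected Dynkin diagram and with positive null vector `u`,
such that `a_{ij} a_{ji} < 4` for `i ≠ j`, which satisfies the local conditions for the existence
of a solution. -/
structure IsThin [Fintype I] (A : Matrix I I ℤ) (u : I → ℝ) : Prop where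
  gcm : IsGCM A
  indecomposable : IsIndecomposable A
  pos : ∀ i, 0 < u i
  null : ∀ i, ∑ j, (A i j : ℝ) * u j = 0
  lt_four : ∀ i j, i ≠ j → A i j * A j i < 4
  admissible : IsLocallyAdmissible A

/-- The nodes `N 0, …, N n` are distinct, and consecutive ones are joined in the Dynkin diagram. -/
structure IsPath (A : Matrix I I ℤ) (n : ℕ) (N : ℕ → I) : Prop where
  inj : ∀ k ≤ n, ∀ m ≤ n, N k = N m → k = m
  adj : ∀ k < n, A (N k) (N (k + 1)) ≠ 0

theorem IsPath.ne (h : IsPath A n N) {k m : ℕ} (hk : k ≤ n) (hm : m ≤ n) (hkm : k ≠ m) :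
    N k ≠ N m :=
  fun he => hkm (h.inj k hk m hm he)

theorem IsPath.adj_pred (h : IsPath A n N) {k : ℕ} (hk : 0 < k) (hkn : k ≤ n) :
    A (N (k - 1)) (N k) ≠ 0 := by
  simpa only [Nat.sub_add_cancel hk] using h.adj (k - 1) (by lia)

theorem IsPath.lt_card [Fintype I] (h : IsPath A n N) : n < Fintype.card I := by
  have hinj : Function.Injective fun k : Fin (n + 1) => N k := fun k m hkm =>
    Fin.ext (h.inj _ (Nat.le_of_lt_succ k.is_lt) _ (Nat.le_of_lt_succ m.is_lt) hkm)
  exact Nat.lt_of_succ_le (by simpa only [Fintype.card_fin] using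
    Fintype.card_le_of_injective _ hinj)

theorem exists_maximal_path [Finite I] [Nonempty I] (A : Matrix I I ℤ) :
    ∃ n N, IsPath A n N ∧ ∀ N', ¬IsPath A (n + 1) N' := by
  classical
  cases nonempty_fintype I
  have h0 : ∃ N, IsPath A 0 N :=
    ⟨fun _ => Classical.arbitrary I, fun k hk m hm _ => by lia, fun k hk => by lia⟩
  obtain ⟨N, hN⟩ := Nat.findGreatest_spec (P := fun n => ∃ N, IsPath A n N)
    (Nat.zero_le (Fintype.card I)) h0
  exact ⟨_, N, hN, fun N' hN' => (Nat.le_findGreatest (P := fun n => ∃ N, IsPath A n N)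
    hN'.lt_card.le ⟨N', hN'⟩).not_gt (Nat.lt_succ_self _)⟩

theorem IsPath.cons (h : IsPath A n N) (hi : ∀ k ≤ n, N k ≠ i) (hadj : A i (N 0) ≠ 0) :
    IsPath A (n + 1) fun k => k.casesOn i N where
  inj
    | 0, _, 0, _, _ => rfl
    | 0, _, m + 1, hm, he => absurd he.symm (hi m (Nat.le_of_succ_le_succ hm))
    | k + 1, hk, 0, _, he => absurd he (hi k (Nat.le_of_succ_le_succ hk))
    | k + 1, hk, m + 1, hm, he =>
      congrArg Nat.succ (h.inj k (Nat.le_of_succ_le_succ hk) m (Nat.le_of_succ_le_succ hm) he)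
  adj
    | 0, _ => hadj
    | k + 1, hk => h.adj k (Nat.lt_of_succ_lt_succ hk)

theorem IsPath.reverse (hA : IsGCM A) (h : IsPath A n N) : IsPath A n fun k => N (n - k) where
  inj k hk m hm he := by
    have := h.inj _ (Nat.sub_le n k) _ (Nat.sub_le n m) he
    lia
  adj k hk := by
    have hadj := h.adj_pred (k := n - k) (by lia) (Nat.sub_le n k)
    exact hA.ne_zero (by simpa only [Nat.sub_sub] using hadj)

theorem IsPath.apply_first_eq_zero (h : IsPath A n N) (hmax : ∀ N', ¬IsPath A (n + 1) N')
    (hi : ∀ k ≤ n, N k ≠ i) : A i (N 0) = 0 :=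
  by_contra fun hadj => hmax _ (h.cons hi hadj)

theorem IsPath.apply_last_eq_zero (hA : IsGCM A) (h : IsPath A n N)
    (hmax : ∀ N', ¬IsPath A (n + 1) N') (hi : ∀ k ≤ n, N k ≠ i) : A i (N n) = 0 :=
  (h.reverse hA).apply_first_eq_zero hmax fun k _ => hi (n - k) (Nat.sub_le n k)

variable [Fintype I] {u : I → ℝ}

theorem IsThin.edge_cases (h : IsThin A u) (hne : i ≠ j) (h0 : A i j ≠ 0) :
    (A i j = -1 ∧ A j i = -1) ∨ (IsDoubleEdge A i j ∧ (IsLeaf A i j ∨ IsLeaf A j i)) := by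
  have hji0 := h.gcm.ne_zero h0
  have hij_nonpos := h.gcm.offDiag i j hne
  have hji_nonpos := h.gcm.offDiag j i hne.symm
  have hlt := h.lt_four i j hne
  by_cases hij : A i j = -1
  · rcases h.admissible.edge i j hne hij with hji | ⟨hji, hleaf⟩ | hji
    · exact Or.inl ⟨hij, hji⟩
    · exact Or.inr ⟨Or.inl ⟨hij, hji⟩, hleaf⟩
    · simp [hij, hji] at hlt
  by_cases hji : A j i = -1
  · rcases h.admissible.edge j i hne.symm hji with hij' | ⟨hij', hleaf⟩ | hij'
    · exact absurd hij' hij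
    · exact Or.inr ⟨Or.inr ⟨hij', hji⟩, hleaf.symm⟩
    · simp [hij', hji] at hlt
  have hij2 : A i j ≤ -2 := by lia
  have hji2 : A j i ≤ -2 := by lia
  nlinarith

theorem IsThin.eq_neg_one_of_neighbours (h : IsThin A u) (hne : i ≠ j) (h0 : A i j ≠ 0)
    (hi : ∃ k, k ≠ i ∧ k ≠ j ∧ A k i ≠ 0) (hj : ∃ k, k ≠ j ∧ k ≠ i ∧ A k j ≠ 0) :
    A i j = -1 ∧ A j i = -1 := by
  obtain ⟨k, hki, hkj, hk⟩ := hi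
  obtain ⟨m, hmj, hmi, hm⟩ := hj
  rcases h.edge_cases hne h0 with hsimple | ⟨-, hleaf | hleaf⟩
  · exact hsimple
  · exact absurd (hleaf k hki hkj) hk
  · exact absurd (hleaf m hmj hmi) hm

theorem IsThin.eq_neg_two_of_ne_neg_one (h : IsThin A u) (hj : j ≠ i) (hk : k ≠ i) (hjk : j ≠ k)
    (hij : A i j ≠ 0) (hik : A i k ≠ 0) (hij1 : A i j ≠ -1) : A i j = -2 ∧ 2 * u j = u i := by
  rcases h.edge_cases hj.symm hij with ⟨hij1', -⟩ | ⟨⟨hij1', -⟩ | ⟨hij2, hji⟩, hleaf⟩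
  · exact absurd hij1' hij1
  · exact absurd hij1' hij1
  have hleaf' : IsLeaf A j i :=
    hleaf.resolve_left fun hleaf => h.gcm.ne_zero hik (hleaf k hk hjk.symm)
  have hrow := sum_neg_mul_eq_two_mul h.gcm h.null (s := {i}) (Finset.notMem_singleton.2 hj)
    fun l hlj hli => h.gcm.zero _ _ (hleaf' l hlj (Finset.notMem_singleton.1 hli))
  rw [Finset.sum_singleton, hji] at hrow
  push_cast at hrow
  exact ⟨hij2, by linarith⟩

/-- Two double edges at `i` already exhaust the null vector equation at `i`. -/
theorem IsThin.eq_neg_one_or_eq_neg_one (h : IsThin A u) (hj : j ≠ i) (hk : k ≠ i) (hm : m ≠ i)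
    (hjk : j ≠ k) (hjm : j ≠ m) (hkm : k ≠ m) (hij : A i j ≠ 0) (hik : A i k ≠ 0)
    (him : A i m ≠ 0) : A i j = -1 ∨ A i k = -1 := by
  classical
  by_contra! hne
  obtain ⟨hij2, huj⟩ := h.eq_neg_two_of_ne_neg_one hj hk hjk hij hik hne.1
  obtain ⟨hik2, huk⟩ := h.eq_neg_two_of_ne_neg_one hk hj hjk.symm hik hij hne.2
  have hrow := sum_neg_mul_le_two_mul h.gcm h.pos h.null (i := i) (s := {j, k, m})
    (by simp [hj.symm, hk.symm, hm.symm])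
  rw [Finset.sum_insert (by simp [hjk, hjm]), Finset.sum_pair hkm, hij2, hik2] at hrow
  push_cast at hrow
  have hpos := mul_pos (neg_pos.2 (h.gcm.neg_of_ne_zero hm.symm him)) (h.pos m)
  linarith

theorem IsThin.apply_eq_zero_of_two_neighbours (h : IsThin A u) (hj : j ≠ i) (hk : k ≠ i)
    (hm : m ≠ i) (hjk : j ≠ k) (hjm : j ≠ m) (hkm : k ≠ m) (hij : A i j ≠ 0) (hik : A i k ≠ 0) :
    A i m = 0 := by
  by_contra him
  have hbranch := h.admissible.branch i
  rcases h.eq_neg_one_or_eq_neg_one hj hk hm hjk hjm hkm hij hik him with hj1 | hk1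
  · rcases h.eq_neg_one_or_eq_neg_one hk hm hj hkm hjk.symm hjm.symm hik him hij with hk1 | hm1
    · exact h.gcm.ne_zero him (hbranch j k m hj hk hm hjk hjm hkm hj1 hk1)
    · exact h.gcm.ne_zero hik (hbranch j m k hj hm hk hjm hjk hkm.symm hj1 hm1)
  · rcases h.eq_neg_one_or_eq_neg_one hj hm hk hjm hjk hkm.symm hij him hik with hj1 | hm1
    · exact h.gcm.ne_zero him (hbranch j k m hj hk hm hjk hjm hkm hj1 hk1)
    · exact h.gcm.ne_zero hij (hbranch k m j hk hm hj hkm hjk.symm hjm.symm hk1 hm1)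

theorem IsThin.apply_interior_eq_zero (h : IsThin A u) (hN : IsPath A n N) {k : ℕ} (hk : 0 < k)
    (hkn : k < n) (hj : j ≠ N k) (hpred : j ≠ N (k - 1)) (hsucc : j ≠ N (k + 1)) :
    A (N k) j = 0 :=
  h.apply_eq_zero_of_two_neighbours (hN.ne (by lia) (by lia) (by lia))
    (hN.ne (by lia) (by lia) (by lia)) hj (hN.ne (by lia) (by lia) (by lia)) hpred.symm hsucc.symm
    (h.gcm.ne_zero (hN.adj_pred hk hkn.le)) (hN.adj k hkn)

theorem IsThin.exists_path_eq (h : IsThin A u) (hN : IsPath A n N)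
    (hmax : ∀ N', ¬IsPath A (n + 1) N') (i : I) : ∃ k ≤ n, N k = i := by
  refine h.indecomposable.mem_of_closed (S := {i | ∃ k ≤ n, N k = i}) ⟨N 0, 0, n.zero_le, rfl⟩ ?_ i
  rintro _ ⟨k, hk, rfl⟩ j hj
  have hjN : ∀ m ≤ n, N m ≠ j := fun m hm hmj => hj ⟨m, hm, hmj⟩
  rcases Nat.eq_zero_or_pos k with rfl | h0
  · exact h.gcm.zero _ _ (hN.apply_first_eq_zero hmax hjN)
  rcases hk.eq_or_lt with rfl | hkn
  · exact h.gcm.zero _ _ (hN.apply_last_eq_zero h.gcm hmax hjN)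
  · exact h.apply_interior_eq_zero hN h0 hkn (hjN k hk).symm (hjN _ (by lia)).symm
      (hjN _ (by lia)).symm

theorem IsThin.apply_path_eq_zero (h : IsThin A u) (hN : IsPath A n N) {k m : ℕ}
    (hkm : k + 1 < m) (hm : m ≤ n) (h0 : 0 < k ∨ m < n) : A (N k) (N m) = 0 := by
  rcases Nat.eq_zero_or_pos k with rfl | hk
  · exact h.gcm.zero _ _ (h.apply_interior_eq_zero hN (k := m) (by lia) (by lia)
      (hN.ne (by lia) (by lia) (by lia)) (hN.ne (by lia) (by lia) (by lia))
      (hN.ne (by lia) (by lia) (by lia)))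
  · exact h.apply_interior_eq_zero hN hk (by lia) (hN.ne (by lia) (by lia) (by lia))
      (hN.ne (by lia) (by lia) (by lia)) (hN.ne (by lia) (by lia) (by lia))

end thin

section classification

variable {I : Type*} [Fintype I] {A : Matrix I I ℤ} {u : I → ℝ} {n k : ℕ} {N : ℕ → I}

theorem mul_eq_four_of_forall_eq_or (hA : IsGCM A) (hu : ∀ i, 0 < u i)
    (h0 : ∀ i, ∑ j, (A i j : ℝ) * u j = 0) {i j : I} (hij : i ≠ j) (hI : ∀ k, k = i ∨ k = j) :
    A i j * A j i = 4 := by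
  have hi := sum_neg_mul_eq_two_mul hA h0 (Finset.notMem_singleton.2 hij) fun k hki hkj =>
    absurd (Finset.mem_singleton.2 ((hI k).resolve_left hki)) hkj
  have hj := sum_neg_mul_eq_two_mul hA h0 (Finset.notMem_singleton.2 hij.symm) fun k hkj hki =>
    absurd (Finset.mem_singleton.2 ((hI k).resolve_right hkj)) hki
  rw [Finset.sum_singleton] at hi hj
  have h4 : ((A i j * A j i : ℤ) : ℝ) * u i = ((4 : ℤ) : ℝ) * u i := by
    push_cast
    linear_combination (-(A i j : ℝ)) * hj + 2 * hi
  exact Int.cast_injective (mul_right_cancel₀ (hu i).ne' h4)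

theorem IsThin.two_le_of_isPath (h : IsThin A u) (hN : IsPath A n N)
    (hs : ∀ i, ∃ k ≤ n, N k = i) : 2 ≤ n := by
  by_contra! hn
  interval_cases n
  · have hrow := sum_neg_mul_eq_two_mul h.gcm h.null (Finset.notMem_empty (N 0)) fun j hj _ => by
      obtain ⟨k, hk, rfl⟩ := hs j
      exact absurd (congrArg N (Nat.le_zero.1 hk)) hj
    rw [Finset.sum_empty] at hrow
    linarith [h.pos (N 0)]
  · have hne : N 0 ≠ N 1 := hN.ne zero_le_one le_rfl zero_ne_one
    refine (h.lt_four _ _ hne).ne (mul_eq_four_of_forall_eq_or h.gcm h.pos h.null hne fun i => ?_)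
    obtain ⟨k, hk, rfl⟩ := hs i
    exact (Nat.le_one_iff_eq_zero_or_eq_one.1 hk).imp (congrArg N) (congrArg N)

theorem IsThin.edge_interior (h : IsThin A u) (hN : IsPath A n N) (hk : 0 < k) (hkn : k + 1 < n) :
    A (N k) (N (k + 1)) = -1 ∧ A (N (k + 1)) (N k) = -1 :=
  h.eq_neg_one_of_neighbours (hN.ne (by lia) (by lia) (by lia)) (hN.adj k (by lia))
    ⟨N (k - 1), hN.ne (by lia) (by lia) (by lia), hN.ne (by lia) (by lia) (by lia),
      hN.adj_pred hk (by lia)⟩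
    ⟨N (k + 2), hN.ne (by lia) (by lia) (by lia), hN.ne (by lia) (by lia) (by lia),
      h.gcm.ne_zero (hN.adj (k + 1) hkn)⟩

section cycle

variable (h : IsThin A u) (hN : IsPath A n N) (hn : 2 ≤ n) (hc : A (N 0) (N n) ≠ 0)
include h hN hn hc

theorem IsThin.edge_of_cycle (hk : k < n) :
    A (N k) (N (k + 1)) = -1 ∧ A (N (k + 1)) (N k) = -1 := by
  refine h.eq_neg_one_of_neighbours (hN.ne (by lia) (by lia) (by lia)) (hN.adj k hk) ?_ ?_
  · rcases Nat.eq_zero_or_pos k with rfl | h0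
    · exact ⟨N n, hN.ne (by lia) (by lia) (by lia), hN.ne (by lia) (by lia) (by lia),
        h.gcm.ne_zero hc⟩
    · exact ⟨N (k - 1), hN.ne (by lia) (by lia) (by lia), hN.ne (by lia) (by lia) (by lia),
        hN.adj_pred h0 hk.le⟩
  · rcases (Nat.succ_le_of_lt hk).eq_or_lt with rfl | hkn
    · exact ⟨N 0, hN.ne (by lia) (by lia) (by lia), hN.ne (by lia) (by lia) (by lia), hc⟩
    · exact ⟨N (k + 2), hN.ne (by lia) (by lia) (by lia), hN.ne (by lia) (by lia) (by lia),
        h.gcm.ne_zero (hN.adj (k + 1) hkn)⟩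

theorem IsThin.closing_edge_of_cycle : A (N 0) (N n) = -1 ∧ A (N n) (N 0) = -1 :=
  h.eq_neg_one_of_neighbours (hN.ne (by lia) (by lia) (by lia)) hc
    ⟨N 1, hN.ne (by lia) (by lia) (by lia), hN.ne (by lia) (by lia) (by lia),
      h.gcm.ne_zero (hN.adj 0 (by lia))⟩
    ⟨N (n - 1), hN.ne (by lia) (by lia) (by lia), hN.ne (by lia) (by lia) (by lia),
      hN.adj_pred (by lia) le_rfl⟩

theorem IsThin.apply_eq_cartanA_of_lt {i j : Fin (n + 1)} (hij : i < j) :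
    A (N i) (N j) = cartanA n i j ∧ A (N j) (N i) = cartanA n j i := by
  have hj := j.is_le
  have hsucc : j = i + 1 ↔ j.val = i.val + 1 := by
    rw [Fin.ext_iff, Fin.val_add_one_of_lt (hij.trans_le (Fin.le_last j))]
  have hclose : i = j + 1 ↔ i.val = 0 ∧ j.val = n := by
    rw [Fin.ext_iff, Fin.val_add_one]
    split_ifs with hlast <;> rw [Fin.ext_iff, Fin.val_last] at hlast <;> lia
  simp only [cartanA, Matrix.of_apply, if_neg hij.ne, if_neg hij.ne', hsucc, hclose]
  by_cases h1 : j.val = i.val + 1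
  · have hedge := h.edge_of_cycle hN hn hc (k := i) (by lia)
    rw [if_pos h1, if_neg (by lia), h1, hedge.1, hedge.2]
    norm_num
  by_cases h2 : i.val = 0 ∧ j.val = n
  · have hedge := h.closing_edge_of_cycle hN hn hc
    rw [if_neg h1, if_pos h2, h2.1, h2.2, hedge.1, hedge.2]
    norm_num
  · have hfar := h.apply_path_eq_zero hN (k := i) (m := j) (by lia) hj (by lia)
    rw [if_neg h1, if_neg h2, hfar, h.gcm.zero _ _ hfar]
    norm_num

end cycle

omit [Fintype I] in
theorem exists_equiv_of_enum (hs : ∀ i, ∃ k ≤ n, N k = i)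
    (hi : ∀ k ≤ n, ∀ m ≤ n, N k = N m → k = m) :
    ∃ e : Fin (n + 1) ≃ I, ∀ k : Fin (n + 1), e k = N k := by
  refine ⟨Equiv.ofBijective (fun k : Fin (n + 1) => N k) ⟨fun k m hkm => ?_, fun i => ?_⟩,
    fun k => rfl⟩
  · exact Fin.ext (hi _ k.is_le _ m.is_le hkm)
  · obtain ⟨k, hk, rfl⟩ := hs i
    exact ⟨⟨k, Nat.lt_succ_of_le hk⟩, rfl⟩

theorem IsThin.hasType_cartanA (h : IsThin A u) (hN : IsPath A n N)
    (hs : ∀ i, ∃ k ≤ n, N k = i) (hn : 2 ≤ n) (hc : A (N 0) (N n) ≠ 0) :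
    HasType A (cartanA n) := by
  obtain ⟨e, he⟩ := exists_equiv_of_enum hs hN.inj
  refine ⟨e, fun i j => ?_⟩
  rw [he, he]
  rcases lt_trichotomy i j with hij | rfl | hji
  · exact (h.apply_eq_cartanA_of_lt hN hn hc hij).1
  · have hsucc := fin_ne_add_one (one_le_two.trans hn) i
    simp only [h.gcm.diag, cartanA, Matrix.of_apply, if_true, if_neg hsucc, sub_zero]
  · exact (h.apply_eq_cartanA_of_lt hN hn hc hji).2

theorem IsThin.isPathDiagram (h : IsThin A u) (hN : IsPath A n N) (hs : ∀ i, ∃ k ≤ n, N k = i)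
    (hn : 2 ≤ n) (hc : A (N 0) (N n) = 0) : IsPathDiagram A n N where
  two_le := hn
  surj := hs
  inj := hN.inj
  edge _ := h.edge_interior hN
  far k m hkm hm := by
    have hfar : A (N k) (N m) = 0 := by
      by_cases hend : 0 < k ∨ m < n
      · exact h.apply_path_eq_zero hN hkm hm hend
      · obtain rfl : k = 0 := by lia
        obtain rfl : m = n := by lia
        exact hc
    exact ⟨hfar, h.gcm.zero _ _ hfar⟩

theorem IsPathDiagram.increment_eq (hA : IsGCM A) (h : IsPathDiagram A n N)
    (h0 : ∀ i, ∑ j, (A i j : ℝ) * u j = 0) (hk : 0 < k) (hkn : k < n) :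
    -(A (N k) (N (k + 1)) : ℝ) * u (N (k + 1)) - u (N k) =
      u (N 1) + A (N 1) (N 0) * u (N 0) := by
  induction k, hk using Nat.le_induction with
  | base =>
    have hrow := (h.sum_row hA one_pos hkn u).symm.trans (h0 _)
    rw [Nat.sub_self] at hrow
    simp only [Nat.succ_eq_add_one, Nat.zero_add]
    linarith
  | succ k hk ih =>
    have hrow := (h.sum_row hA k.succ_pos hkn u).symm.trans (h0 _)
    have hstep := ih (by lia)
    have hedge := h.edge k hk hkn
    rw [hedge.1] at hstep
    rw [Nat.succ_sub_one, hedge.2] at hrow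
    push_cast at hrow hstep
    linarith

/-- The constant increment of the null vector along the path is nonnegative at the first edge and
nonpositive at the last one. -/
theorem IsPathDiagram.mul_eq_two_of_le_two (hA : IsGCM A) (h : IsPathDiagram A n N)
    (hu : ∀ i, 0 < u i) (h0 : ∀ i, ∑ j, (A i j : ℝ) * u j = 0)
    (hfirst : A (N 0) (N 1) * A (N 1) (N 0) ≤ 2)
    (hlast : A (N n) (N (n - 1)) * A (N (n - 1)) (N n) ≤ 2) :
    A (N 0) (N 1) * A (N 1) (N 0) = 2 := by
  have hn := h.two_le
  have hrow := (h.sum_row_first hA u).symm.trans (h0 _)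
  have hrow' := (h.reverse.sum_row_first hA u).symm.trans (h0 _)
  have hincr := h.increment_eq hA h0 (k := n - 1) (by lia) (by lia)
  rw [Nat.sub_add_cancel (by lia)] at hincr
  rw [Nat.sub_zero] at hrow'
  have hlast' : ((A (N n) (N (n - 1)) * A (N (n - 1)) (N n) : ℤ) : ℝ) * u (N (n - 1)) ≤
      2 * u (N (n - 1)) :=
    mul_le_mul_of_nonneg_right (by exact_mod_cast hlast) (hu _).le
  have h2 : 2 * u (N 1) ≤ ((A (N 0) (N 1) * A (N 1) (N 0) : ℤ) : ℝ) * u (N 1) := by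
    push_cast at hlast' ⊢
    linear_combination hlast' - (A (N 1) (N 0) : ℝ) * hrow - (A (N (n - 1)) (N n) : ℝ) * hrow' -
      2 * hincr
  exact hfirst.antisymm (by exact_mod_cast le_of_mul_le_mul_right h2 (hu (N 1)))

theorem IsThin.isDoublePath (h : IsThin A u) (hN : IsPath A n N)
    (hs : ∀ i, ∃ k ≤ n, N k = i) (hn : 2 ≤ n) (hc : A (N 0) (N n) = 0) :
    IsDoublePath A n N := by
  have hP := h.isPathDiagram hN hs hn hc
  have hle : ∀ {i j}, i ≠ j → A i j ≠ 0 →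
      A i j * A j i ≤ 2 ∧ (A i j * A j i = 2 → IsDoubleEdge A i j) := by
    intro i j hij hadj
    rcases h.edge_cases hij hadj with hsimple | ⟨hdouble, -⟩
    · simp [hsimple]
    · rcases id hdouble with hd | hd <;> simp [hd, hdouble]
  have hfirst := hle (hN.ne (by lia) (by lia) zero_ne_one) (hN.adj 0 (by lia))
  have hlast := hle (hN.ne le_rfl (by lia) (show n ≠ n - 1 by lia))
    (h.gcm.ne_zero (hN.adj_pred (by lia) le_rfl))
  refine ⟨hP, hfirst.2 (hP.mul_eq_two_of_le_two h.gcm h.pos h.null hfirst.1 hlast.1),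
    hlast.2 (hP.reverse.mul_eq_two_of_le_two h.gcm h.pos h.null hlast.1 ?_)⟩
  rw [Nat.sub_self, Nat.sub_sub_self (by lia)]
  exact hfirst.1

end classification

section types

variable {I : Type*} {A : Matrix I I ℤ} {n : ℕ} {N : ℕ → I} {i j : I}

theorem IsPathDiagram.hasType_tridiag (hA : IsGCM A) (h : IsPathDiagram A n N) {f g : ℕ → ℤ}
    (hfg : ∀ k < n, A (N k) (N (k + 1)) = f k ∧ A (N (k + 1)) (N k) = g k) :
    HasType A (tridiag n f g) := by
  obtain ⟨e, he⟩ := exists_equiv_of_enum h.surj h.inj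
  refine ⟨e, fun i j => ?_⟩
  rw [he, he, tridiag, Matrix.of_apply]
  split_ifs with heq hsucc hpred
  · rw [heq, hA.diag]
  · rw [hsucc, (hfg _ (by lia)).1]
  · rw [hpred, (hfg _ (by lia)).2]
  · exact h.apply_eq_zero j.is_le i.is_le (fun hval => heq (Fin.ext hval)) (Ne.symm hsucc) hpred

theorem IsPathDiagram.entries (h : IsPathDiagram A n N) {p p' r r' : ℤ}
    (hfirst : A (N 0) (N 1) = p ∧ A (N 1) (N 0) = p')
    (hlast : A (N n) (N (n - 1)) = r ∧ A (N (n - 1)) (N n) = r') {k : ℕ} (hk : k < n) :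
    A (N k) (N (k + 1)) = (if k = 0 then p else if k + 1 = n then r' else -1) ∧
      A (N (k + 1)) (N k) = if k = 0 then p' else if k + 1 = n then r else -1 := by
  split_ifs with h0 hn
  · subst h0
    exact hfirst
  · subst hn
    exact hlast.symm
  · exact h.edge k (by lia) (by lia)

theorem IsPathDiagram.hasType_cartanC (hA : IsGCM A) (h : IsPathDiagram A n N)
    (hfirst : A (N 0) (N 1) = -1 ∧ A (N 1) (N 0) = -2)
    (hlast : A (N n) (N (n - 1)) = -1 ∧ A (N (n - 1)) (N n) = -2) : HasType A (cartanC n) := by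
  have hn := h.two_le
  refine h.hasType_tridiag hA fun k hk => ?_
  rw [(h.entries hfirst hlast hk).1, (h.entries hfirst hlast hk).2]
  grind

theorem IsPathDiagram.hasType_cartanA2 (hA : IsGCM A) (h : IsPathDiagram A n N)
    (hfirst : A (N 0) (N 1) = -1 ∧ A (N 1) (N 0) = -2)
    (hlast : A (N n) (N (n - 1)) = -2 ∧ A (N (n - 1)) (N n) = -1) : HasType A (cartanA2 n) := by
  have hn := h.two_le
  refine h.hasType_tridiag hA fun k hk => ?_
  rw [(h.entries hfirst hlast hk).1, (h.entries hfirst hlast hk).2]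
  grind

theorem IsPathDiagram.hasType_cartanD2 (hA : IsGCM A) (h : IsPathDiagram A n N)
    (hfirst : A (N 0) (N 1) = -2 ∧ A (N 1) (N 0) = -1)
    (hlast : A (N n) (N (n - 1)) = -2 ∧ A (N (n - 1)) (N n) = -1) : HasType A (cartanD2 n) := by
  have hn := h.two_le
  refine h.hasType_tridiag hA fun k hk => ?_
  rw [(h.entries hfirst hlast hk).1, (h.entries hfirst hlast hk).2]
  grind

theorem IsDoublePath.hasType (hA : IsGCM A) (h : IsDoublePath A n N) :
    HasType A (cartanC n) ∨ HasType A (cartanA2 n) ∨ HasType A (cartanD2 n) := by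
  have hn := h.two_le
  rcases h.left with hl | hl <;> rcases h.right with hr | hr
  · exact Or.inl (h.hasType_cartanC hA hl hr)
  · exact Or.inr (Or.inl (h.hasType_cartanA2 hA hl hr))
  · refine Or.inr (Or.inl (h.reverse.hasType_cartanA2 hA hr ?_))
    rwa [Nat.sub_self, Nat.sub_sub_self (by lia)]
  · exact Or.inr (Or.inr (h.hasType_cartanD2 hA hl hr))

theorem hasType_fin_two (hA : IsGCM A) (hij : i ≠ j) (hI : ∀ k, k = i ∨ k = j)
    {B : Matrix (Fin 2) (Fin 2) ℤ} (hB : B = !![2, A i j; A j i, 2]) :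
    HasType (n := 1) A B := by
  refine ⟨Equiv.ofBijective ![i, j] ⟨?_, fun k => ?_⟩, fun k m => ?_⟩
  · intro k m
    fin_cases k <;> fin_cases m <;> simp [hij, hij.symm]
  · exact (hI k).elim (fun hk => ⟨0, hk.symm⟩) fun hk => ⟨1, hk.symm⟩
  · subst hB
    fin_cases k <;> fin_cases m
    exacts [hA.diag i, rfl, rfl, hA.diag j]

theorem IsGCM.eq_of_mul_eq_four (hA : IsGCM A) (hij : i ≠ j) (h4 : A i j * A j i = 4) :
    (A i j = -2 ∧ A j i = -2) ∨ (A i j = -1 ∧ A j i = -4) ∨ (A j i = -1 ∧ A i j = -4) := by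
  have hle := hA.offDiag i j hij
  have hge : -4 ≤ A i j :=
    neg_le.1 (Int.le_of_dvd four_pos (neg_dvd.2 (Dvd.intro _ h4)))
  interval_cases A i j <;> lia

theorem IsGCM.hasType_of_mul_eq_four (hA : IsGCM A) (hij : i ≠ j) (hI : ∀ k, k = i ∨ k = j)
    (h4 : A i j * A j i = 4) : HasType A (cartanA 1) ∨ HasType A (cartanA2 1) := by
  rcases hA.eq_of_mul_eq_four hij h4 with ⟨h1, h2⟩ | ⟨h1, h2⟩ | ⟨h1, h2⟩
  · exact Or.inl (hasType_fin_two hA hij hI (by rw [h1, h2]; decide))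
  · exact Or.inr (hasType_fin_two hA hij hI (by rw [h1, h2]; decide))
  · exact Or.inr (hasType_fin_two hA hij.symm (fun k => (hI k).symm) (by rw [h1, h2]; decide))

variable [Fintype I]

theorem IsThin.exists_hasType [Nonempty I] {u : I → ℝ} (h : IsThin A u) : ∃ n, 2 ≤ n ∧
    (HasType A (cartanA n) ∨ HasType A (cartanC n) ∨ HasType A (cartanA2 n) ∨
      HasType A (cartanD2 n)) := by
  obtain ⟨n, N, hN, hmax⟩ := exists_maximal_path A
  have hs := h.exists_path_eq hN hmax
  have hn := h.two_le_of_isPath hN hs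
  refine ⟨n, hn, ?_⟩
  by_cases hc : A (N 0) (N n) = 0
  · exact Or.inr ((h.isDoublePath hN hs hn hc).hasType h.gcm)
  · exact Or.inl (h.hasType_cartanA hN hs hn hc)

theorem IsAffineCartan.exists_hasType (hA : IsAffineCartan A) (h : IsLocallyAdmissible A) :
    ∃ n : ℕ,
      (1 ≤ n ∧ HasType A (cartanA n)) ∨ (2 ≤ n ∧ HasType A (cartanC n)) ∨
      (1 ≤ n ∧ HasType A (cartanA2 n)) ∨ (2 ≤ n ∧ HasType A (cartanD2 n)) := by
  obtain ⟨u, hu, h0⟩ := hA.null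
  replace h0 : ∀ i, ∑ j, (A i j : ℝ) * u j = 0 := congrFun h0
  by_cases h4 : ∃ i j, i ≠ j ∧ A i j * A j i = 4
  · obtain ⟨i, j, hij, h4⟩ := h4
    have hI := forall_eq_or_of_mul_eq_four hA.gcm hA.indecomposable hu h0 hij h4
    rcases hA.gcm.hasType_of_mul_eq_four hij hI h4 with hT | hT
    · exact ⟨1, Or.inl ⟨le_rfl, hT⟩⟩
    · exact ⟨1, Or.inr (Or.inr (Or.inl ⟨le_rfl, hT⟩))⟩
  · push Not at h4
    have hthin : IsThin A u := ⟨hA.gcm, hA.indecomposable, hu, h0,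
      fun i j hij => (mul_le_four hA.gcm hu h0 hij).lt_of_ne (h4 i j hij), h⟩
    have := hA.nonempty
    obtain ⟨n, hn, hT | hT | hT | hT⟩ := hthin.exists_hasType
    · exact ⟨n, Or.inl ⟨one_le_two.trans hn, hT⟩⟩
    · exact ⟨n, Or.inr (Or.inl ⟨hn, hT⟩)⟩
    · exact ⟨n, Or.inr (Or.inr (Or.inl ⟨one_le_two.trans hn, hT⟩))⟩
    · exact ⟨n, Or.inr (Or.inr (Or.inr ⟨hn, hT⟩))⟩

variable [DecidableEq I] {Q : I → ℂˣ} {d : I → ℚ} {φ : I → Laurent I}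

theorem IsSolution.exists_hasType (hA : IsAffineCartan A) (hQ : IsQFamily A Q d)
    (hφ : IsSolution A Q φ) : ∃ n : ℕ,
      (1 ≤ n ∧ HasType A (cartanA n)) ∨ (2 ≤ n ∧ HasType A (cartanC n)) ∨
      (1 ≤ n ∧ HasType A (cartanA2 n)) ∨ (2 ≤ n ∧ HasType A (cartanD2 n)) :=
  hA.exists_hasType (((isSolution_iff hA.gcm hQ).1 hφ).isLocallyAdmissible hA.gcm hQ)

theorem exists_isSolution_of_hasType (hA : IsAffineCartan A) {a a' : I → ℕ} (ha : IsLabels A a)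
    (ha' : IsLabels A.transpose a') {ħ : ℂ} (hq : ∀ m : ℕ, 0 < m → Complex.exp ħ ^ m ≠ 1)
    (h : (1 ≤ n ∧ HasType A (cartanA n)) ∨ (2 ≤ n ∧ HasType A (cartanC n)) ∨
      (1 ≤ n ∧ HasType A (cartanA2 n)) ∨ (2 ≤ n ∧ HasType A (cartanD2 n))) :
    ∃ φ, IsSolution A (qi ħ a a') φ := by
  have hsol : ∀ (e : Fin (n + 1) ≃ I) (sol : Fin (n + 1) → Laurent I) (i),
      (sol ∘ e.symm) (e i) = sol i := fun e sol i => congrArg sol (e.symm_apply_apply i)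
  rcases h with ⟨hn, e, he⟩ | ⟨hn, e, he⟩ | ⟨hn, e, he⟩ | ⟨hn, e, he⟩
  · exact ⟨_, (isSolution_iff_of_cartanA hn hA.gcm (isQFamily_qi hA ha ha' hq) he _).2
      ⟨1, hsol e _⟩⟩
  · exact ⟨_, (isSolution_iff_of_cartanC hA ha ha' hq hn he _).2 ⟨_, Or.inl rfl, hsol e _⟩⟩
  · exact ⟨_, (isSolution_iff_of_cartanA2 hA ha ha' hq hn he _).2 (hsol e _)⟩
  · exact ⟨_, (isSolution_iff_of_cartanD2 hA ha ha' hq hn he _).2 (hsol e _)⟩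

end types

end QShift

end

theorem theorem4p1 {I : Type*} [Fintype I] [DecidableEq I] (A : Matrix I I ℤ)
    (hA : QShift.IsAffineCartan A)
    (a a' : I → ℕ) (ha : QShift.IsLabels A a) (ha' : QShift.IsLabels A.transpose a')
    (q ħ : ℂ) (hħ : Complex.exp ħ = q) (hq : ∀ m : ℕ, 0 < m → q ^ m ≠ 1) :
    ((∃ φ : I → QShift.Laurent I, QShift.IsSolution A (QShift.qi ħ a a') φ) ↔
      ∃ n : ℕ,
        (1 ≤ n ∧ QShift.HasType A (QShift.cartanA n)) ∨
        (2 ≤ n ∧ QShift.HasType A (QShift.cartanC n)) ∨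
        (1 ≤ n ∧ QShift.HasType A (QShift.cartanA2 n)) ∨
        (2 ≤ n ∧ QShift.HasType A (QShift.cartanD2 n))) ∧
    (∀ (n : ℕ) (e : Fin (n + 1) ≃ I), 1 ≤ n → QShift.IsNumbering A (QShift.cartanA n) e →
      ∀ φ : I → QShift.Laurent I, QShift.IsSolution A (QShift.qi ħ a a') φ ↔
        ∃ b : ℂˣ, ∀ i, φ (e i) = QShift.solA (QShift.qi ħ a a') e b i) ∧
    (∀ (n : ℕ) (e : Fin (n + 1) ≃ I), 2 ≤ n → QShift.IsNumbering A (QShift.cartanC n) e →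
      ∀ φ : I → QShift.Laurent I, QShift.IsSolution A (QShift.qi ħ a a') φ ↔
        ∃ b : ℂˣ, (b = QShift.qpow ħ (-1 / 4) ∨ b = QShift.im * QShift.qpow ħ (-1 / 4)) ∧
          ∀ i, φ (e i) = QShift.solC (QShift.qi ħ a a') e b i) ∧
    (∀ (n : ℕ) (e : Fin (n + 1) ≃ I), 1 ≤ n → QShift.IsNumbering A (QShift.cartanA2 n) e →
      ∀ φ : I → QShift.Laurent I, QShift.IsSolution A (QShift.qi ħ a a') φ ↔
        ∀ i, φ (e i) = QShift.solA2 ħ (QShift.qi ħ a a') e i) ∧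
    (∀ (n : ℕ) (e : Fin (n + 1) ≃ I), 2 ≤ n → QShift.IsNumbering A (QShift.cartanD2 n) e →
      ∀ φ : I → QShift.Laurent I, QShift.IsSolution A (QShift.qi ħ a a') φ ↔
        ∀ i, φ (e i) = QShift.solD2 ħ (QShift.qi ħ a a') e i) := by
  subst hħ
  have hQ := QShift.isQFamily_qi hA ha ha' hq
  exact ⟨⟨fun ⟨φ, hφ⟩ => hφ.exists_hasType hA hQ,
      fun ⟨n, h⟩ => QShift.exists_isSolution_of_hasType hA ha ha' hq h⟩,
    fun n e hn he => QShift.isSolution_iff_of_cartanA hn hA.gcm hQ he,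
    fun n e hn he => QShift.isSolution_iff_of_cartanC hA ha ha' hq hn he,
    fun n e hn he => QShift.isSolution_iff_of_cartanA2 hA ha ha' hq hn he,
    fun n e hn he => QShift.isSolution_iff_of_cartanD2 hA ha ha' hq hn he⟩
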